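/- Let $T>0$ and $\tfrac14<\beta<\tfrac12$. For $i=1,2$ let data $(b^i,\tilde\gamma^i,v_0^i,\psi^i)$ be given such that - (A1) $\psi^i\in C^\beta([0,T])$ and $\psi^i(0)=0$; - (A2) $b^i\in L^\infty([0,T],L^2(\mathbb R_+))$ and $\tilde\gamma^i\in L^\infty([0,T]\times\mathbb R_+)$; - (A3) $v_0^i\in W^{1,2}(\mathbb R_+)$ and $v_0^i(0)=0$; and assume in addition that $\tilde\gamma^1,\tilde\gamma^2\in C([0,T],L^2(\mathbb R_+))$. Let $G(t,x)=(4\pi t)^{-1/2}e^{-x^2/4t}$ and let $\bar G(t,\cdot)*_D f(x)=\int_0^\infty (G(t,x-y)-G(t,x+y))f(y)\,dy$ for $t>0$, with $\bar G(0,\cdot)*_D f=f$. Let $$\tilde u^i(t,x)=-2\int_0^t\partial_xG(t-\tau,x)\psi^i(\tau)\,d\tau$$ be the solution of the heat equation on the half-line with zero initial condition and boundary condition $\psi^i$, and let $\tilde v^i\in L^\infty([0,T],W^{1,2}(\mathbb R_+))$ be the mild solution of $\partial_t\tilde v=\partial_x^2\tilde v+b^i\partial_x\tilde v+\tilde\gamma^i\tilde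 v+b^i\partial_x\tilde u^i+\tilde\gamma^i\tilde u^i$ with $\tilde v(t,0)=0$, $\tilde v(0,\cdot)=v_0^i$, that is, for every $t\in[0,T]$, $$\tilde v^i(t,\cdot)=\bar G(t,\cdot)*_Dv_0^i+\int_0^t\bar G(t-\tau,\cdot)*_D\big(b^i\partial_x\tilde v^i+\tilde\gamma^i\tilde v^i\big)(\tau,\cdot)\,d\tau+\int_0^t\bar G(t-\tau,\cdot)*_D\big(b^i\partial_x\tilde u^i+\tilde\gamma^i\tilde u^i\big)(\tau,\cdot)\,d\tau .$$ Then $$\sup_{t\in[0,T]}\|\tilde u^1(t,\cdot)-\tilde u^2(t,\cdot)\|_{W^{1,2}(\mathbb R_+)}\le C\,\|\psi^1-\psi^2\|_{C^\beta([0,T])},$$ $$\sup_{t\in[0,T]}\|\tilde v^1(t,\cdot)-\tilde v^2(t,\cdot)\|_{W^{1,2}(\mathbb R_+)}\le \rho_1\|v_0^1-v_0^2\|_{W^{1,2}(\mathbb R_+)}+\rho_2\|\psi^1-\psi^2\|_{C^\beta([0,T])}+\rho_3\left(\|b^1-b^2\|_{L^\infty([0,T],L^2(\mathbb R_+))}+\|\tilde\gamma^1-\tilde\gamma^2\|_{C([0,T],L^2(\mathbb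 R_+))}\right).$$ Here $C$ is a constant depending only on $T$ and $\beta$; $\rho_1,\rho_2$ are the values of non-negative, Borel, locally bounded functions at the four norms $\|b^j\|_{L^\infty([0,T],L^2(\mathbb R_+))}$, $\|\tilde\gamma^j\|_{L^\infty([0,T]\times\mathbb R_+)}$, $j=1,2$; and $\rho_3$ is the value of a non-negative, Borel, locally bounded function at these four norms together with $\|v_0^j\|_{W^{1,2}(\mathbb R_+)}$, $\|\psi^j\|_{C^\beta([0,T])}$, $j=1,2$. These functions depend only on $T$ and $\beta$. -/

import Mathlib

open MeasureTheory Set Filter Topology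
open scoped ENNReal NNReal ContDiff

noncomputable section

namespace HalfLine

/-- Lebesgue measure on the half-line `(0, ∞)`. -/
def μx : Measure ℝ := volume.restrict (Ioi 0)

/-- Lebesgue measure on the time interval `[0, T]`. -/
def μt (T : ℝ) : Measure ℝ := volume.restrict (Icc 0 T)

/-- Lebesgue measure on `[0, T] × (0, ∞)`. -/
def μtx (T : ℝ) : Measure (ℝ × ℝ) := (μt T).prod μx

/-! ### Function spaces -/

/-- `g` is the weak derivative of `f` on `(0, ∞)`. -/
structure HasWeakDeriv (f g : ℝ → ℝ) : Prop where
  locallyIntegrable_fun : LocallyIntegrableOn f (Ioi 0)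
  locallyIntegrable_deriv : LocallyIntegrableOn g (Ioi 0)
  integral_eq : ∀ φ : ℝ → ℝ, ContDiff ℝ ∞ φ → HasCompactSupport φ → tsupport φ ⊆ Ioi 0 →
    ∫ x in Ioi 0, f x * deriv φ x = - ∫ x in Ioi 0, g x * φ x

/-- The norm of `L²(0, ∞)`. -/
def L2Norm (f : ℝ → ℝ) : ℝ≥0∞ := eLpNorm f 2 μx

/-- The norm of `W^{1,2}(0, ∞)`, `(‖f‖² + ‖f'‖²)^{1/2}` with `f'` the weak derivative of `f`.
It is `∞` exactly when `f` is not in `W^{1,2}(0, ∞)`; the weak derivative is unique up to null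
sets, so that the infimum is over at most one value. -/
def W12Norm (f : ℝ → ℝ) : ℝ≥0∞ :=
  ⨅ (g : ℝ → ℝ) (_ : HasWeakDeriv f g), (L2Norm f ^ 2 + L2Norm g ^ 2) ^ (1 / 2 : ℝ)

/-- The continuous representative of `f` on `[0, ∞)` vanishes at `0`. -/
def HasZeroTrace (f : ℝ → ℝ) : Prop :=
  ∃ f₀ : ℝ → ℝ, f =ᵐ[μx] f₀ ∧ ContinuousOn f₀ (Ici 0) ∧ f₀ 0 = 0

/-- The norm of `C^β([0, T])`: supremum norm plus Hölder seminorm. -/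
def CβNorm (T : ℝ) (β : ℝ≥0) (ψ : ℝ → ℝ) : ℝ≥0∞ :=
  (⨆ t ∈ Icc 0 T, ‖ψ t‖ₑ) + eHolderNorm β ((Icc 0 T).domRestrict ψ)

/-- The norm of `L^∞([0, T], L²(0, ∞))`. -/
def LinftyL2Norm (T : ℝ) (b : ℝ → ℝ → ℝ) : ℝ≥0∞ := essSup (fun t => L2Norm (b t)) (μt T)

/-- The norm of `L^∞([0, T] × (0, ∞))`. -/
def LinftyNorm (T : ℝ) (γ : ℝ → ℝ → ℝ) : ℝ≥0∞ := eLpNorm (Function.uncurry γ) ⊤ (μtx T)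

/-- The norm of `C([0, T], L²(0, ∞))`. -/
def CL2Norm (T : ℝ) (γ : ℝ → ℝ → ℝ) : ℝ≥0∞ := ⨆ t ∈ Icc 0 T, L2Norm (γ t)

/-- Membership in `C([0, T], L²(0, ∞))`. -/
structure MemCL2 (T : ℝ) (γ : ℝ → ℝ → ℝ) : Prop where
  memLp : ∀ t ∈ Icc 0 T, MemLp (γ t) 2 μx
  continuous : ∀ t ∈ Icc 0 T,
    Tendsto (fun s => L2Norm (fun x => γ s x - γ t x)) (𝓝[Icc 0 T] t) (𝓝 0)

/-- `v ∈ L^∞([0, T], W^{1,2}(0, ∞))`, with weak spatial derivative `w = ∂ₓ v`. -/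
structure MemLinftyW12 (T : ℝ) (v w : ℝ → ℝ → ℝ) : Prop where
  measurable_fun : AEStronglyMeasurable (Function.uncurry v) (μtx T)
  measurable_deriv : AEStronglyMeasurable (Function.uncurry w) (μtx T)
  hasWeakDeriv : ∀ᵐ t ∂(μt T), HasWeakDeriv (v t) (w t)
  norm_lt_top : essSup (fun t => W12Norm (v t)) (μt T) < ⊤

/-! ### Heat kernel and mild solutions -/

/-- The heat kernel on `ℝ`. -/
def heatKernel (t x : ℝ) : ℝ := 1 / √(4 * Real.pi * t) * Real.exp (-x ^ 2 / (4 * t))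

/-- Convolution with the Dirichlet heat kernel of the half-line; the identity at `t = 0`. -/
def dirichletConv (t : ℝ) (f : ℝ → ℝ) (x : ℝ) : ℝ :=
  if 0 < t then ∫ y in Ioi 0, (heatKernel t (x - y) - heatKernel t (x + y)) * f y else f x

/-- The solution `ũ` of `∂ₜ u = ∂ₓ² u`, `u(0, x) = 0`, `u(t, 0) = ψ t`. -/
def heatSol (ψ : ℝ → ℝ) (t x : ℝ) : ℝ :=
  -2 * ∫ τ in (0 : ℝ)..t, deriv (heatKernel (t - τ)) x * ψ τ

/-- The data of a linear problem: coefficients `b`, `γ` (functions of `(t, x)`), initial datum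
`v₀` and boundary datum `ψ`. -/
structure LinData where
  b : ℝ → ℝ → ℝ
  γ : ℝ → ℝ → ℝ
  v₀ : ℝ → ℝ
  ψ : ℝ → ℝ

/-- Assumptions A1 - A3 on the data, with `p = 2`. -/
structure LinData.Admissible (T : ℝ) (β : ℝ≥0) (D : LinData) : Prop where
  ψ_holder : CβNorm T β D.ψ < ⊤
  ψ_zero : D.ψ 0 = 0
  b_measurable : AEStronglyMeasurable (Function.uncurry D.b) (μtx T)
  b_norm : LinftyL2Norm T D.b < ⊤
  γ_memLp : MemLp (Function.uncurry D.γ) ⊤ (μtx T)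
  v₀_norm : W12Norm D.v₀ < ⊤
  v₀_trace : HasZeroTrace D.v₀

/-- `v` is an `L^∞([0, T], W^{1,2}(0, ∞))` mild solution of
`∂ₜ v = ∂ₓ² v + b ∂ₓ v + γ v + b ∂ₓ ũ + γ ũ`, `v(t, 0) = 0`, `v(0, ·) = v₀`, with `ũ` the heat
solution with boundary datum `ψ`. -/
def IsMildSolution (T : ℝ) (D : LinData) (v : ℝ → ℝ → ℝ) : Prop :=
  ∃ w : ℝ → ℝ → ℝ, MemLinftyW12 T v w ∧
    ∀ t ∈ Icc 0 T, ∀ᵐ x ∂μx,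
      v t x = dirichletConv t D.v₀ x
        + (∫ τ in (0 : ℝ)..t,
            dirichletConv (t - τ) (fun y => D.b τ y * w τ y + D.γ τ y * v τ y) x)
        + ∫ τ in (0 : ℝ)..t,
            dirichletConv (t - τ)
              (fun y => D.b τ y * deriv (heatSol D.ψ τ) y + D.γ τ y * heatSol D.ψ τ y) x

/-- A function with values in `[0, ∞)` is locally bounded. -/
def LocallyBdd {X : Type*} [TopologicalSpace X] (ρ : X → ℝ≥0) : Prop :=
  ∀ x, ∃ U ∈ 𝓝 x, ∃ M : ℝ≥0, ∀ y ∈ U, ρ y ≤ M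

/-- The norms `‖b¹‖, ‖b²‖` in `L^∞ L²` and `‖γ¹‖, ‖γ²‖` in `L^∞`. -/
def coeffNorms (T : ℝ) (D₁ D₂ : LinData) : Fin 4 → ℝ≥0 :=
  ![(LinftyL2Norm T D₁.b).toNNReal, (LinftyL2Norm T D₂.b).toNNReal,
    (LinftyNorm T D₁.γ).toNNReal, (LinftyNorm T D₂.γ).toNNReal]

/-- The norms `‖v₀¹‖, ‖v₀²‖` in `W^{1,2}` and `‖ψ¹‖, ‖ψ²‖` in `C^β`. -/
def dataNorms (T : ℝ) (β : ℝ≥0) (D₁ D₂ : LinData) : Fin 4 → ℝ≥0 :=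
  ![(W12Norm D₁.v₀).toNNReal, (W12Norm D₂.v₀).toNNReal,
    (CβNorm T β D₁.ψ).toNNReal, (CβNorm T β D₂.ψ).toNNReal]

end HalfLine

end

noncomputable section

namespace HalfLine

/-! ### `L²` inequalities for lower integrals -/

section LowerIntegral

variable {α X : Type*} [MeasurableSpace α] [MeasurableSpace X] {ν : Measure α} {μ : Measure X}

/-! Both estimates rest on how the heat kernel `G` acts on `L²(0, ∞)`. Up to constants, `G`, `∂ₓG`
and `∂ₓ²G` at time `s` are dominated by `s^(-1/2)`, `s^(-1)` and `s^(-3/2)` times a Gaussian of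
width `√s`, whose `L²` norm is of order `s^(1/4)`.

The map `ψ ↦ ũ` is linear, so only one boundary datum has to be treated. For `ũ` itself Minkowski's
inequality leaves the integrable singularity `s^(-3/4)`. For `∂ₓũ` it would leave `s^(-5/4)`, which
is not integrable, so `ψ(t)` is subtracted from `ψ(t - s)`: Hölder continuity improves this to `s^(β
- 5/4)`, integrable because `β > 1/4`. Since `∂ₛG = ∂ₓ²G`, the subtracted part integrates to `-2
ψ(t) G(t, ·)`, and `|ψ(t)| ≤ N t^β`, a consequence of `ψ(0) = 0`, makes its `L²` norm bounded. This
is `l2Norm_heatSol_le`.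

For mild solutions, `b ∂ₓv` is a product of two `L²` functions and hence lies in `L¹`, while `γ v`
lies in `L²`. The Dirichlet kernel and its `x`-derivative map `L¹ + L²` to `L²` with norm of order
`s^(-3/4)` (`eLpNorm_kernel_le`). The semigroup is bounded on `W^{1,2}` functions of zero trace,
because integration by parts moves the derivative onto the datum (`W12Bound.dirichletConv`). A
Gronwall argument in a norm with weight `exp(-l t)`, `l` large, then bounds any solution of a
Duhamel equation (`w12Norm_le_of_duhamel`).

That argument is used twice: for one solution, giving an a priori bound, and for `z = v¹ - v²`. The
latter has source `b¹ ∂ₓz + γ¹ z`, the same expression in `ũ¹ - ũ²`, and `(b¹ - b²) ∂ₓ(v² + ũ²) +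
(γ¹ - γ²)(v² + ũ²)`. The last part is controlled in `L¹` by the a priori bound, which is why `‖γ¹ -
γ²‖` is measured in `L²` and why `ρ₃` also depends on the norms of the data. -/

theorem eLpNorm_two_sq {ε : Type*} [TopologicalSpace ε] [ContinuousENorm ε] (f : X → ε) :
    eLpNorm f 2 μ ^ 2 = ∫⁻ x, ‖f x‖ₑ ^ 2 ∂μ := by
  rw [eLpNorm_eq_lintegral_rpow_enorm_toReal (by norm_num) (by norm_num), ← ENNReal.rpow_natCast,
    ← ENNReal.rpow_mul]
  norm_num

theorem eLpNorm_two_le_iff {ε : Type*} [TopologicalSpace ε] [ContinuousENorm ε] (f : X → ε)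
    (N : ℝ≥0∞) : eLpNorm f 2 μ ≤ N ↔ ∫⁻ x, ‖f x‖ₑ ^ 2 ∂μ ≤ N ^ 2 := by
  rw [← eLpNorm_two_sq]
  exact (ENNReal.pow_le_pow_left_iff two_ne_zero).symm

theorem lintegral_mul_le_eLpNorm_two {f g : X → ℝ≥0∞} (hf : AEMeasurable f μ)
    (hg : AEMeasurable g μ) :
    ∫⁻ x, f x * g x ∂μ ≤ eLpNorm f 2 μ * eLpNorm g 2 μ := by
  have := ENNReal.lintegral_mul_le_Lp_mul_Lq μ Real.HolderConjugate.two_two hf hg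
  rw [eLpNorm_eq_lintegral_rpow_enorm_toReal (by norm_num) (by norm_num),
    eLpNorm_eq_lintegral_rpow_enorm_toReal (by norm_num) (by norm_num)]
  simpa using this

/-- The square of the left side is a triple integral of `H a x * H a' x`. Tonelli moves the
`x`-integral innermost, where Cauchy–Schwarz gives the product of the two norms. With values in
`ℝ≥0∞` no integrability has to be checked. -/
theorem eLpNorm_two_lintegral_le_of_measurable [SFinite ν] [SFinite μ] {H : α → X → ℝ≥0∞}
    (hH : Measurable (Function.uncurry H)) :
    eLpNorm (fun x => ∫⁻ a, H a x ∂ν) 2 μ ≤ ∫⁻ a, eLpNorm (H a) 2 μ ∂ν := by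
  have hHa : ∀ a, Measurable (H a) := fun a => hH.comp measurable_prodMk_left
  have hHx : ∀ x, Measurable fun a => H a x := fun x => hH.comp measurable_prodMk_right
  have hg : Measurable fun x => ∫⁻ a, H a x ∂ν := hH.lintegral_prod_left'
  have hn : Measurable fun a => eLpNorm (H a) 2 μ := by
    simp_rw [eLpNorm_eq_lintegral_rpow_enorm_toReal two_ne_zero ENNReal.ofNat_ne_top]
    refine Measurable.pow_const ?_ _
    exact Measurable.lintegral_prod_right (f := fun a x => ‖H a x‖ₑ ^ (2 : ℝ≥0∞).toReal)
      (by simpa [Function.uncurry_def] using hH.pow_const 2)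
  rw [eLpNorm_two_le_iff]
  calc ∫⁻ x, ‖∫⁻ a, H a x ∂ν‖ₑ ^ 2 ∂μ
      = ∫⁻ x, ∫⁻ a, H a x * ∫⁻ a', H a' x ∂ν ∂ν ∂μ := by
        refine lintegral_congr fun x => ?_
        rw [lintegral_mul_const _ (hHx x), enorm_eq_self, sq]
    _ = ∫⁻ a, ∫⁻ x, H a x * ∫⁻ a', H a' x ∂ν ∂μ ∂ν := by
        refine lintegral_lintegral_swap (Measurable.aemeasurable ?_)
        exact (hH.comp measurable_swap).mul (hg.comp measurable_fst)
    _ = ∫⁻ a, ∫⁻ x, ∫⁻ a', H a x * H a' x ∂ν ∂μ ∂ν := by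
        refine lintegral_congr fun a => lintegral_congr fun x => ?_
        rw [lintegral_const_mul _ (hHx x)]
    _ = ∫⁻ a, ∫⁻ a', ∫⁻ x, H a x * H a' x ∂μ ∂ν ∂ν := by
        refine lintegral_congr fun a => lintegral_lintegral_swap (Measurable.aemeasurable ?_)
        exact ((hHa a).comp measurable_fst).mul (hH.comp measurable_swap)
    _ ≤ ∫⁻ a, ∫⁻ a', eLpNorm (H a) 2 μ * eLpNorm (H a') 2 μ ∂ν ∂ν :=
        lintegral_mono fun a => lintegral_mono fun a' =>
          lintegral_mul_le_eLpNorm_two (hHa a).aemeasurable (hHa a').aemeasurable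
    _ = (∫⁻ a, eLpNorm (H a) 2 μ ∂ν) ^ 2 := by
        simp_rw [lintegral_const_mul _ hn]
        rw [lintegral_mul_const _ hn, sq]

/-- Minkowski's integral inequality in `L²`. -/
theorem eLpNorm_two_lintegral_le [SFinite ν] [SFinite μ] {H : α → X → ℝ≥0∞}
    (hH : AEMeasurable (Function.uncurry H) (ν.prod μ)) :
    eLpNorm (fun x => ∫⁻ a, H a x ∂ν) 2 μ ≤ ∫⁻ a, eLpNorm (H a) 2 μ ∂ν := by
  obtain ⟨K, hK, hHK⟩ := hH
  have h1 : ∀ᵐ a ∂ν, ∀ᵐ x ∂μ, H a x = K (a, x) := Measure.ae_ae_of_ae_prod hHK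
  have h0 : ∀ᵐ p ∂μ.prod ν, H p.2 p.1 = K (p.2, p.1) :=
    (Measure.measurePreserving_swap (μ := μ) (ν := ν)).quasiMeasurePreserving.ae hHK
  have h2 : ∀ᵐ x ∂μ, ∀ᵐ a ∂ν, H a x = K (a, x) := Measure.ae_ae_of_ae_prod h0
  have e1 : eLpNorm (fun x => ∫⁻ a, H a x ∂ν) 2 μ = eLpNorm (fun x => ∫⁻ a, K (a, x) ∂ν) 2 μ :=
    eLpNorm_congr_ae (h2.mono fun x hx => lintegral_congr_ae hx)
  have e2 : ∫⁻ a, eLpNorm (H a) 2 μ ∂ν = ∫⁻ a, eLpNorm (fun x => K (a, x)) 2 μ ∂ν :=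
    lintegral_congr_ae (h1.mono fun a ha => eLpNorm_congr_ae ha)
  rw [e1, e2]
  exact eLpNorm_two_lintegral_le_of_measurable (H := fun a x => K (a, x)) hK

/-- Schur's test in `L²`. -/
theorem eLpNorm_two_lintegral_mul_le [SFinite ν] [SFinite μ] {k : X → α → ℝ≥0∞} {f : α → ℝ≥0∞}
    (hk : Measurable (Function.uncurry k)) (hf : AEMeasurable f ν) {A : ℝ≥0∞}
    (h₁ : ∀ x, ∫⁻ y, k x y ∂ν ≤ A) (h₂ : ∀ y, ∫⁻ x, k x y ∂μ ≤ A) :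
    eLpNorm (fun x => ∫⁻ y, k x y * f y ∂ν) 2 μ ≤ A * eLpNorm f 2 ν := by
  have hkx : ∀ x, Measurable (k x) := fun x => hk.comp measurable_prodMk_left
  have hky : ∀ y, Measurable fun x => k x y := fun x => hk.comp measurable_prodMk_right
  have hsq : ∀ c : ℝ≥0∞, c ^ (1 / 2 : ℝ) * c ^ (1 / 2 : ℝ) = c := fun c => by
    rw [← ENNReal.rpow_add_of_nonneg _ _ (by norm_num) (by norm_num)]; norm_num
  -- Cauchy–Schwarz with the kernel split as `k = k^(1/2) * k^(1/2)`; one factor is integrated out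
  -- by the row bound `h₁`, the other is left for the column bound `h₂`.
  have key : ∀ x, (∫⁻ y, k x y * f y ∂ν) ^ 2 ≤ A * ∫⁻ y, k x y * f y ^ 2 ∂ν := by
    intro x
    have h := lintegral_mul_le_eLpNorm_two (μ := ν) (f := fun y => k x y ^ (1 / 2 : ℝ))
      (g := fun y => k x y ^ (1 / 2 : ℝ) * f y) ((hkx x).pow_const _).aemeasurable
      (((hkx x).pow_const _).aemeasurable.mul hf)
    simp_rw [← mul_assoc, hsq] at h
    calc (∫⁻ y, k x y * f y ∂ν) ^ 2 ≤ _ := pow_le_pow_left₀ zero_le h 2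
      _ = (∫⁻ y, k x y ∂ν) * ∫⁻ y, k x y * f y ^ 2 ∂ν := by
        rw [mul_pow, eLpNorm_two_sq, eLpNorm_two_sq]
        simp_rw [enorm_eq_self, mul_pow, sq, hsq]
      _ ≤ _ := mul_le_mul_left (h₁ x) _
  rw [eLpNorm_two_le_iff]
  calc ∫⁻ x, ‖∫⁻ y, k x y * f y ∂ν‖ₑ ^ 2 ∂μ ≤ ∫⁻ x, A * ∫⁻ y, k x y * f y ^ 2 ∂ν ∂μ :=
        lintegral_mono fun x => key x
    _ = A * ∫⁻ x, ∫⁻ y, k x y * f y ^ 2 ∂ν ∂μ := by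
        rw [lintegral_const_mul'']
        exact AEMeasurable.lintegral_prod_right'
          (f := fun p : X × α => k p.1 p.2 * f p.2 ^ 2)
          (hk.aemeasurable.mul ((hf.comp_quasiMeasurePreserving
            Measure.quasiMeasurePreserving_snd).pow_const 2))
    _ = A * ∫⁻ y, ∫⁻ x, k x y * f y ^ 2 ∂μ ∂ν := by
        rw [lintegral_lintegral_swap]
        exact hk.aemeasurable.mul ((hf.comp_quasiMeasurePreserving
            Measure.quasiMeasurePreserving_snd).pow_const 2)
    _ ≤ A * ∫⁻ y, A * f y ^ 2 ∂ν := by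
        gcongr with y
        rw [lintegral_mul_const _ (hky y)]
        gcongr
        exact h₂ y
    _ = (A * eLpNorm f 2 ν) ^ 2 := by
        rw [lintegral_const_mul'' _ (hf.pow_const 2), mul_pow, eLpNorm_two_sq, sq A, mul_assoc]
        simp

end LowerIntegral

/-! ### Weak derivatives on the half-line -/

theorem ae_μx_iff {p : ℝ → Prop} : (∀ᵐ x ∂μx, p x) ↔ ∀ᵐ x, 0 < x → p x := by
  rw [μx, ae_restrict_iff' measurableSet_Ioi]; rfl

theorem locallyIntegrableOn_congr_ae {f g : ℝ → ℝ} (h : LocallyIntegrableOn f (Ioi 0))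
    (hfg : f =ᵐ[μx] g) : LocallyIntegrableOn g (Ioi 0) := by
  rw [locallyIntegrableOn_iff isOpen_Ioi.isLocallyClosed] at h ⊢
  exact fun K hK hc => (h K hK hc).congr (ae_restrict_of_ae_restrict_of_subset hK hfg)

theorem HasWeakDeriv.congr {f g f' g' : ℝ → ℝ} (h : HasWeakDeriv f g) (hf : f =ᵐ[μx] f')
    (hg : g =ᵐ[μx] g') : HasWeakDeriv f' g' where
  locallyIntegrable_fun := locallyIntegrableOn_congr_ae h.1 hf
  locallyIntegrable_deriv := locallyIntegrableOn_congr_ae h.2 hg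
  integral_eq φ h1 h2 h3 := by
    have e1 : ∫ x in Ioi 0, f' x * deriv φ x = ∫ x in Ioi 0, f x * deriv φ x :=
      integral_congr_ae (hf.mono fun x hx => by simp only [hx])
    have e2 : ∫ x in Ioi 0, g' x * φ x = ∫ x in Ioi 0, g x * φ x :=
      integral_congr_ae (hg.mono fun x hx => by simp only [hx])
    rw [e1, e2, h.3 φ h1 h2 h3]

theorem integrable_mul_of_hasCompactSupport {f φ : ℝ → ℝ} (hf : LocallyIntegrableOn f (Ioi 0))
    (h1 : Continuous φ) (h2 : HasCompactSupport φ) (h3 : tsupport φ ⊆ Ioi 0) :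
    Integrable (fun x => f x * φ x) μx := by
  have hK : IntegrableOn f (tsupport φ) :=
    (locallyIntegrableOn_iff isOpen_Ioi.isLocallyClosed).1 hf _ h3 h2
  have : IntegrableOn (fun x => f x * φ x) (tsupport φ) := hK.mul_continuousOn h1.continuousOn h2
  have h' : Integrable (fun x => f x * φ x) :=
    (integrableOn_iff_integrable_of_support_subset
      ((Function.support_mul_subset_right _ _).trans (subset_tsupport φ))).1 this
  exact h'.restrict

theorem tsupport_deriv_subset' {φ : ℝ → ℝ} (h3 : tsupport φ ⊆ Ioi 0) :
    tsupport (deriv φ) ⊆ Ioi 0 :=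
  (closure_minimal support_deriv_subset (isClosed_tsupport φ)).trans h3

theorem HasWeakDeriv.add {f g f' g' : ℝ → ℝ} (h : HasWeakDeriv f g) (h' : HasWeakDeriv f' g') :
    HasWeakDeriv (fun x => f x + f' x) (fun x => g x + g' x) where
  locallyIntegrable_fun := h.1.add h'.1
  locallyIntegrable_deriv := h.2.add h'.2
  integral_eq φ h1 h2 h3 := by
    have d1 := h1.continuous_deriv (by simp)
    have d2 := h2.deriv
    have d3 := tsupport_deriv_subset' h3
    simp_rw [add_mul]
    have i1 := integrable_mul_of_hasCompactSupport h.1 d1 d2 d3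
    have i2 := integrable_mul_of_hasCompactSupport h'.1 d1 d2 d3
    have i3 := integrable_mul_of_hasCompactSupport h.2 h1.continuous h2 h3
    have i4 := integrable_mul_of_hasCompactSupport h'.2 h1.continuous h2 h3
    rw [μx] at i1 i2 i3 i4
    rw [integral_add i1 i2, integral_add i3 i4, h.3 φ h1 h2 h3, h'.3 φ h1 h2 h3]
    ring

theorem HasWeakDeriv.neg {f g : ℝ → ℝ} (h : HasWeakDeriv f g) :
    HasWeakDeriv (fun x => -f x) (fun x => -g x) where
  locallyIntegrable_fun := h.1.neg
  locallyIntegrable_deriv := h.2.neg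
  integral_eq φ h1 h2 h3 := by
    simp_rw [neg_mul, integral_neg]
    rw [h.3 φ h1 h2 h3]

theorem HasWeakDeriv.sub {f g f' g' : ℝ → ℝ} (h : HasWeakDeriv f g) (h' : HasWeakDeriv f' g') :
    HasWeakDeriv (fun x => f x - f' x) (fun x => g x - g' x) := by
  simpa only [sub_eq_add_neg] using h.add h'.neg

/-- The difference of two weak derivatives integrates to zero against every test function, so the
fundamental lemma of the calculus of variations applies. This is what makes the infimum in `W12Norm`
harmless. -/
theorem HasWeakDeriv.ae_eq {f g g' : ℝ → ℝ} (h : HasWeakDeriv f g) (h' : HasWeakDeriv f g') :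
    g =ᵐ[μx] g' := by
  have hd : LocallyIntegrableOn (fun x => g x - g' x) (Ioi 0) := h.2.sub h'.2
  have := isOpen_Ioi.ae_eq_zero_of_integral_contDiff_smul_eq_zero (μ := volume) hd
    fun φ h1 h2 h3 => by
      have e : ∫ x in Ioi 0, φ x • (g x - g' x) = ∫ x, φ x • (g x - g' x) := by
        refine setIntegral_eq_integral_of_forall_compl_eq_zero fun x hx => ?_
        rw [image_eq_zero_of_notMem_tsupport fun hx' => hx (h3 hx'), zero_smul]
      rw [← e]
      have i3 := integrable_mul_of_hasCompactSupport h.2 h1.continuous h2 h3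
      have i4 := integrable_mul_of_hasCompactSupport h'.2 h1.continuous h2 h3
      have e2 : ∀ x, φ x • (g x - g' x) = g x * φ x - g' x * φ x := fun x => by
        simp only [smul_eq_mul]; ring
      rw [μx] at i3 i4
      simp_rw [e2]
      rw [integral_sub i3 i4]
      linarith [h.3 φ h1 h2 h3, h'.3 φ h1 h2 h3]
  refine ae_μx_iff.2 (this.mono fun x hx h0 => ?_)
  linarith [hx h0]

theorem HasWeakDeriv.aestronglyMeasurable_fun {f g : ℝ → ℝ} (h : HasWeakDeriv f g) :
    AEStronglyMeasurable f μx := h.1.aestronglyMeasurable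

theorem HasWeakDeriv.aestronglyMeasurable_deriv {f g : ℝ → ℝ} (h : HasWeakDeriv f g) :
    AEStronglyMeasurable g μx := h.2.aestronglyMeasurable

/-- A continuously differentiable function has a weak derivative. -/
theorem HasWeakDeriv.of_hasDerivAt {f g : ℝ → ℝ} (h : ∀ x ∈ Ioi (0 : ℝ), HasDerivAt f (g x) x)
    (hg : ContinuousOn g (Ioi 0)) : HasWeakDeriv f g := by
  have hf : ContinuousOn f (Ioi 0) := fun x hx => (h x hx).continuousAt.continuousWithinAt
  have lf := hf.locallyIntegrableOn (μ := volume) measurableSet_Ioi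
  have lg := hg.locallyIntegrableOn (μ := volume) measurableSet_Ioi
  refine ⟨lf, lg, fun φ h1 h2 h3 => ?_⟩
  have i1 := integrable_mul_of_hasCompactSupport lf (h1.continuous_deriv (by simp)) h2.deriv
    (tsupport_deriv_subset' h3)
  have i2 := integrable_mul_of_hasCompactSupport lg h1.continuous h2 h3
  have i0 := integrable_mul_of_hasCompactSupport lf h1.continuous h2 h3
  have z : ∀ x, x ∉ Ioi (0 : ℝ) → φ =ᶠ[𝓝 x] 0 := fun x hx =>
    notMem_tsupport_iff_eventuallyEq.1 fun hx' => hx (h3 hx')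
  have z0 : ∀ x, x ∉ Ioi (0 : ℝ) → φ x = 0 := fun x hx => (z x hx).self_of_nhds
  have z1 : ∀ x, x ∉ Ioi (0 : ℝ) → deriv φ x = 0 := fun x hx => by
    simpa using (z x hx).deriv_eq
  -- The product `f * φ` is differentiable on all of `ℝ`, because `φ` vanishes near every point
  -- outside `(0, ∞)`. The integral of its derivative over the line is therefore zero.
  have key : ∫ x, (g x * φ x + f x * deriv φ x) = 0 := by
    refine integral_eq_zero_of_hasDerivAt_of_integrable (f := fun x => f x * φ x) (fun x => ?_) ?_ ?_
    · by_cases hx : x ∈ Ioi (0 : ℝ)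
      · exact (h x hx).mul ((h1.differentiable (by simp) x).hasDerivAt)
      · rw [z0 x hx, z1 x hx]
        have : (fun x => f x * φ x) =ᶠ[𝓝 x] fun _ => 0 := (z x hx).mono fun y hy => by simp [hy]
        simpa using (hasDerivAt_const x (0 : ℝ)).congr_of_eventuallyEq this
    · refine (integrableOn_iff_integrable_of_support_subset (s := Ioi 0) ?_).1 (i2.add i1)
      intro x hx
      by_contra hx'
      exact hx (by simp [z0 x hx', z1 x hx'])
    · refine (integrableOn_iff_integrable_of_support_subset (s := Ioi 0) ?_).1 i0
      intro x hx
      by_contra hx'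
      exact hx (by simp [z0 x hx'])
  have e : ∫ x in Ioi 0, (g x * φ x + f x * deriv φ x) = 0 := by
    rw [setIntegral_eq_integral_of_forall_compl_eq_zero, key]
    intro x hx
    simp [z0 x hx, z1 x hx]
  rw [μx] at i1 i2
  rw [integral_add i2 i1] at e
  linarith

/-! ### Additive bounds in `W^{1,2}` -/

/-- `f` is in `W^{1,2}(0, ∞)`, and both `f` and its weak derivative have `L²` norm at most `N`. -/
def W12Bound (f : ℝ → ℝ) (N : ℝ≥0∞) : Prop :=
  ∃ g, HasWeakDeriv f g ∧ L2Norm f ≤ N ∧ L2Norm g ≤ N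

theorem W12Bound.mono {f : ℝ → ℝ} {N M : ℝ≥0∞} (h : W12Bound f N) (hNM : N ≤ M) :
    W12Bound f M :=
  let ⟨g, h1, h2, h3⟩ := h
  ⟨g, h1, h2.trans hNM, h3.trans hNM⟩

theorem W12Bound.congr {f f' : ℝ → ℝ} {N : ℝ≥0∞} (h : W12Bound f N) (hf : f =ᵐ[μx] f') :
    W12Bound f' N :=
  let ⟨g, h1, h2, h3⟩ := h
  ⟨g, h1.congr hf ae_eq_rfl, (eLpNorm_congr_ae hf).symm.trans_le h2, h3⟩

theorem W12Bound.add {f f' : ℝ → ℝ} {N N' : ℝ≥0∞} (h : W12Bound f N) (h' : W12Bound f' N') :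
    W12Bound (fun x => f x + f' x) (N + N') :=
  let ⟨_, h1, h2, h3⟩ := h
  let ⟨_, h1', h2', h3'⟩ := h'
  ⟨_, h1.add h1',
    (eLpNorm_add_le h1.aestronglyMeasurable_fun h1'.aestronglyMeasurable_fun one_le_two).trans
      (add_le_add h2 h2'),
    (eLpNorm_add_le h1.aestronglyMeasurable_deriv h1'.aestronglyMeasurable_deriv one_le_two).trans
      (add_le_add h3 h3')⟩

theorem W12Bound.neg {f : ℝ → ℝ} {N : ℝ≥0∞} (h : W12Bound f N) :
    W12Bound (fun x => -f x) N :=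
  let ⟨_, h1, h2, h3⟩ := h
  ⟨_, h1.neg, (eLpNorm_neg f 2 μx).trans_le h2, (eLpNorm_neg _ 2 μx).trans_le h3⟩

theorem W12Bound.sub {f f' : ℝ → ℝ} {N N' : ℝ≥0∞} (h : W12Bound f N) (h' : W12Bound f' N') :
    W12Bound (fun x => f x - f' x) (N + N') := by
  simpa only [sub_eq_add_neg] using h.add h'.neg

/-- The true factor `√2` is rounded up to `2`. Estimates are carried out with `W12Bound`, which is
additive and mentions no root, and are converted to `W12Norm` only at the end. -/
theorem W12Bound.w12Norm_le {f : ℝ → ℝ} {N : ℝ≥0∞} (h : W12Bound f N) : W12Norm f ≤ 2 * N := by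
  obtain ⟨g, h1, h2, h3⟩ := h
  refine (iInf₂_le g h1).trans ?_
  calc (L2Norm f ^ 2 + L2Norm g ^ 2) ^ (1 / 2 : ℝ)
      ≤ ((2 * N) ^ 2) ^ (1 / 2 : ℝ) := by
        refine ENNReal.rpow_le_rpow ?_ (by norm_num)
        calc L2Norm f ^ 2 + L2Norm g ^ 2 ≤ N ^ 2 + N ^ 2 := by gcongr
          _ = 2 * N ^ 2 := by ring
          _ ≤ 4 * N ^ 2 := by gcongr; norm_num
          _ = (2 * N) ^ 2 := by rw [mul_pow]; norm_num
    _ = 2 * N := by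
        rw [← ENNReal.rpow_natCast, ← ENNReal.rpow_mul]; norm_num

theorem HasWeakDeriv.l2Norm_le {f g : ℝ → ℝ} (h : HasWeakDeriv f g) :
    L2Norm f ≤ W12Norm f ∧ L2Norm g ≤ W12Norm f := by
  have hsq : ∀ c : ℝ≥0∞, c = (c ^ 2) ^ (1 / 2 : ℝ) := fun c => by
    rw [← ENNReal.rpow_natCast, ← ENNReal.rpow_mul]; norm_num
  refine ⟨le_iInf₂ fun g' _ => ?_, le_iInf₂ fun g' hg' => ?_⟩
  · conv_lhs => rw [hsq (L2Norm f)]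
    exact ENNReal.rpow_le_rpow le_self_add (by norm_num)
  · have : L2Norm g = L2Norm g' := eLpNorm_congr_ae (h.ae_eq hg')
    rw [this]
    conv_lhs => rw [hsq (L2Norm g')]
    exact ENNReal.rpow_le_rpow le_add_self (by norm_num)

theorem W12Bound.of_w12Norm_lt_top {f : ℝ → ℝ} (h : W12Norm f < ⊤) : W12Bound f (W12Norm f) := by
  obtain ⟨g, hg⟩ := iInf_lt_iff.1 h
  obtain ⟨hg, -⟩ := iInf_lt_iff.1 hg
  exact ⟨g, hg, hg.l2Norm_le⟩

instance : SFinite μx := by rw [μx]; infer_instance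

instance : SigmaFinite μx := by rw [μx]; infer_instance

/-! ### Weak derivatives of parametric integrals -/

section Parametric

variable {α : Type*} [MeasurableSpace α] {ν : Measure α}

/-- On a compact set an `L²` function of `x` is integrable, by Cauchy–Schwarz against the constant
`1`. This supplies the joint integrability that Fubini requires; it need not hold on the whole
half-line. -/
theorem integrable_prod_of_eLpNorm_two [SFinite ν] {h : α → ℝ → ℝ}
    (hh : AEStronglyMeasurable (Function.uncurry h) (ν.prod μx))
    (nh : eLpNorm (fun x => ∫⁻ a, ‖h a x‖ₑ ∂ν) 2 μx < ⊤)
    {K : Set ℝ} (hK : IsCompact K) (hK0 : K ⊆ Ioi 0) :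
    Integrable (Function.uncurry h) (ν.prod (volume.restrict K)) := by
  have hr : volume.restrict K ≤ μx := Measure.restrict_mono hK0 le_rfl
  have hm : AEStronglyMeasurable (Function.uncurry h) (ν.prod (volume.restrict K)) := by
    refine hh.mono_ac ?_
    exact Measure.AbsolutelyContinuous.prod .rfl hr.absolutelyContinuous
  refine ⟨hm, ?_⟩
  rw [hasFiniteIntegral_iff_enorm, lintegral_prod_symm _ hm.enorm]
  have hm' : AEMeasurable (fun x => ∫⁻ a, ‖h a x‖ₑ ∂ν) (volume.restrict K) :=
    (hm.enorm).lintegral_prod_left'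
  have := lintegral_mul_le_eLpNorm_two (μ := volume.restrict K) (f := fun _ => 1)
    aemeasurable_const hm'
  simp_rw [one_mul] at this
  refine this.trans_lt (ENNReal.mul_lt_top ?_ ((eLpNorm_mono_measure _ hr).trans_lt nh))
  have hfin : IsFiniteMeasure (volume.restrict K) := ⟨by simpa using hK.measure_lt_top⟩
  rw [← not_le, ← ENNReal.pow_le_pow_left_iff two_ne_zero, not_le, eLpNorm_two_sq]
  simpa using hK.measure_lt_top

/-- Test functions have compact support, so Fubini exchanges the two integrals and the definition
applies for each `a`. No pointwise domination of the derivative is needed, which is what makes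
singular kernels accessible. -/
theorem HasWeakDeriv.integral [SFinite ν] {h g : α → ℝ → ℝ}
    (hh : AEStronglyMeasurable (Function.uncurry h) (ν.prod μx))
    (hg : AEStronglyMeasurable (Function.uncurry g) (ν.prod μx))
    (hw : ∀ᵐ a ∂ν, HasWeakDeriv (h a) (g a))
    (nh : eLpNorm (fun x => ∫⁻ a, ‖h a x‖ₑ ∂ν) 2 μx < ⊤)
    (ng : eLpNorm (fun x => ∫⁻ a, ‖g a x‖ₑ ∂ν) 2 μx < ⊤) :
    HasWeakDeriv (fun x => ∫ a, h a x ∂ν) (fun x => ∫ a, g a x ∂ν) := by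
  have swap : ∀ (f : α → ℝ → ℝ) (φ : ℝ → ℝ), AEStronglyMeasurable (Function.uncurry f) (ν.prod μx) →
      eLpNorm (fun x => ∫⁻ a, ‖f a x‖ₑ ∂ν) 2 μx < ⊤ → Continuous φ → HasCompactSupport φ →
      tsupport φ ⊆ Ioi 0 →
      ∫ x in Ioi 0, (∫ a, f a x ∂ν) * φ x = ∫ a, (∫ x in Ioi 0, f a x * φ x) ∂ν := by
    intro f φ hf nf h1 h2 h3
    have sub : ∀ F : ℝ → ℝ, ∫ x in Ioi 0, F x * φ x = ∫ x in tsupport φ, F x * φ x := fun F => by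
      refine setIntegral_eq_of_subset_of_forall_sdiff_eq_zero measurableSet_Ioi h3 fun x hx => ?_
      rw [image_eq_zero_of_notMem_tsupport hx.2, mul_zero]
    simp_rw [sub, ← integral_mul_const]
    symm
    refine integral_integral_swap (f := fun a x => f a x * φ x) ?_
    have hi := integrable_prod_of_eLpNorm_two hf nf h2 h3
    obtain ⟨C, hC⟩ := h2.exists_bound_of_continuous h1
    exact hi.mul_bdd (c := C) (g := fun p : α × ℝ => φ p.2)
      (h1.measurable.comp measurable_snd).aestronglyMeasurable (ae_of_all _ fun p => hC p.2)
  refine ⟨?_, ?_, fun φ h1 h2 h3 => ?_⟩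
  · rw [locallyIntegrableOn_iff isOpen_Ioi.isLocallyClosed]
    exact fun K hK hc => (integrable_prod_of_eLpNorm_two hh nh hc hK).integral_prod_right
  · rw [locallyIntegrableOn_iff isOpen_Ioi.isLocallyClosed]
    exact fun K hK hc => (integrable_prod_of_eLpNorm_two hg ng hc hK).integral_prod_right
  · rw [swap h _ hh nh (h1.continuous_deriv (by simp)) h2.deriv (tsupport_deriv_subset' h3),
      swap g _ hg ng h1.continuous h2 h3, ← integral_neg]
    exact integral_congr_ae (hw.mono fun a ha => ha.3 φ h1 h2 h3)

theorem l2Norm_integral_le (h : α → ℝ → ℝ) :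
    L2Norm (fun x => ∫ a, h a x ∂ν) ≤ eLpNorm (fun x => ∫⁻ a, ‖h a x‖ₑ ∂ν) 2 μx :=
  eLpNorm_mono_enorm fun x => by
    rw [enorm_eq_self]
    exact enorm_integral_le_lintegral_enorm _

theorem W12Bound.integral [SFinite ν] {h g : α → ℝ → ℝ} {N : ℝ≥0∞}
    (hh : AEStronglyMeasurable (Function.uncurry h) (ν.prod μx))
    (hg : AEStronglyMeasurable (Function.uncurry g) (ν.prod μx))
    (hw : ∀ᵐ a ∂ν, HasWeakDeriv (h a) (g a)) (hN : N < ⊤)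
    (nh : eLpNorm (fun x => ∫⁻ a, ‖h a x‖ₑ ∂ν) 2 μx ≤ N)
    (ng : eLpNorm (fun x => ∫⁻ a, ‖g a x‖ₑ ∂ν) 2 μx ≤ N) :
    W12Bound (fun x => ∫ a, h a x ∂ν) N :=
  ⟨_, HasWeakDeriv.integral hh hg hw (nh.trans_lt hN) (ng.trans_lt hN),
    (l2Norm_integral_le h).trans nh, (l2Norm_integral_le g).trans ng⟩

end Parametric

/-! ### Gaussian bounds for the heat kernel -/

/-- The Gaussian that dominates the heat kernel and its derivatives. -/
def gauss (s z : ℝ) : ℝ := Real.exp (-z ^ 2 / (8 * s))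

/-- The spatial derivative of the heat kernel. -/
def heatDx (t x : ℝ) : ℝ := -x / (2 * t) * heatKernel t x

/-- The second spatial derivative of the heat kernel. -/
def heatDxx (t x : ℝ) : ℝ := (x ^ 2 / (4 * t ^ 2) - 1 / (2 * t)) * heatKernel t x

theorem gauss_nonneg (s z : ℝ) : 0 ≤ gauss s z := (Real.exp_pos _).le

theorem gauss_neg (s z : ℝ) : gauss s (-z) = gauss s z := by simp [gauss]

theorem hasDerivAt_heatKernel {t : ℝ} (ht : 0 < t) (x : ℝ) :
    HasDerivAt (heatKernel t) (heatDx t x) x := by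
  have h1 : HasDerivAt (fun x : ℝ => -x ^ 2 / (4 * t)) (-(2 * x) / (4 * t)) x := by
    simpa using ((hasDerivAt_pow 2 x).neg.div_const (4 * t))
  have h2 := (h1.exp).const_mul (1 / √(4 * Real.pi * t))
  refine h2.congr_deriv ?_
  rw [heatDx, heatKernel]
  field_simp
  ring

theorem hasDerivAt_heatDx {t : ℝ} (ht : 0 < t) (x : ℝ) :
    HasDerivAt (heatDx t) (heatDxx t x) x := by
  have h1 : HasDerivAt (fun x : ℝ => -x / (2 * t)) (-1 / (2 * t)) x :=
    (hasDerivAt_id x).neg.div_const (2 * t)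
  refine (h1.mul (hasDerivAt_heatKernel ht x)).congr_deriv ?_
  rw [heatDxx, heatDx]
  field_simp
  ring

theorem hasDerivAt_heatKernel_time {t : ℝ} (ht : 0 < t) (x : ℝ) :
    HasDerivAt (fun s => heatKernel s x) (heatDxx t x) t := by
  have h1 : HasDerivAt (fun s : ℝ => -x ^ 2 / (4 * s)) (x ^ 2 / (4 * t ^ 2)) t := by
    have := ((hasDerivAt_inv ht.ne').const_mul (-x ^ 2 / 4))
    refine (this.congr_of_eventuallyEq (Eventually.of_forall fun s => ?_)).congr_deriv ?_
    · simp only [div_eq_mul_inv, mul_inv]; ring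
    · field_simp
  have hp : 0 < 4 * Real.pi * t := by positivity
  have h2 : HasDerivAt (fun s : ℝ => 1 / √(4 * Real.pi * s))
      (-(1 / (2 * t)) * (1 / √(4 * Real.pi * t))) t := by
    have h3 : HasDerivAt (fun s : ℝ => 4 * Real.pi * s) (4 * Real.pi) t := by
      simpa using (hasDerivAt_id t).const_mul (4 * Real.pi)
    have h4 := (h3.sqrt hp.ne').inv (Real.sqrt_pos.2 hp).ne'
    simp only [one_div]
    refine h4.congr_deriv ?_
    rw [Real.sq_sqrt hp.le]
    field_simp
  refine (h2.mul h1.exp).congr_deriv ?_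
  rw [heatDxx, heatKernel]
  ring

theorem continuous_heatKernel (t : ℝ) : Continuous (heatKernel t) := by
  unfold heatKernel; fun_prop

theorem continuous_heatDx (t : ℝ) : Continuous (heatDx t) := by
  unfold heatDx heatKernel; fun_prop

theorem continuous_heatDxx (t : ℝ) : Continuous (heatDxx t) := by
  unfold heatDxx heatKernel; fun_prop

theorem measurable_heatDx : Measurable fun p : ℝ × ℝ => heatDx p.1 p.2 := by
  unfold heatDx heatKernel; fun_prop

theorem measurable_heatDxx : Measurable fun p : ℝ × ℝ => heatDxx p.1 p.2 := by
  unfold heatDxx heatKernel; fun_prop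

theorem heatKernel_nonneg (t x : ℝ) : 0 ≤ heatKernel t x := by unfold heatKernel; positivity

/-- The width in `gauss` is chosen so that `exp(-x²/4t)` is its square: one factor absorbs powers of
`x²/t` coming from derivatives, the other remains as the dominating Gaussian. -/
theorem heatKernel_le_gauss_sq {t : ℝ} (ht : 0 < t) (x : ℝ) :
    heatKernel t x ≤ 1 / (2 * √t) * (gauss t x * gauss t x) := by
  rw [heatKernel, gauss, ← Real.exp_add]
  have e : -x ^ 2 / (8 * t) + -x ^ 2 / (8 * t) = -x ^ 2 / (4 * t) := by field_simp; ring
  rw [e]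
  have : 2 * √t ≤ √(4 * Real.pi * t) := by
    rw [show 2 * √t = √(4 * t) by
      rw [Real.sqrt_mul (by norm_num), show (4 : ℝ) = 2 ^ 2 by norm_num, Real.sqrt_sq (by norm_num)]]
    refine Real.sqrt_le_sqrt ?_
    nlinarith [Real.pi_gt_three]
  gcongr

theorem mul_gauss_le (t x : ℝ) : x ^ 2 / (8 * t) * gauss t x ≤ 1 := by
  rw [gauss, show -x ^ 2 / (8 * t) = -(x ^ 2 / (8 * t)) by ring]
  refine (mul_le_mul_of_nonneg_right (?_ : _ ≤ Real.exp (x ^ 2 / (8 * t))) (Real.exp_pos _).le).trans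
    ?_
  · linarith [Real.add_one_le_exp (x ^ 2 / (8 * t))]
  · rw [← Real.exp_add]; simp

theorem gauss_le_one {t : ℝ} (ht : 0 < t) (x : ℝ) : gauss t x ≤ 1 := by
  rw [gauss, Real.exp_le_one_iff, neg_div]
  simp only [Left.neg_nonpos_iff]
  positivity

theorem heatKernel_le {t : ℝ} (ht : 0 < t) (x : ℝ) : heatKernel t x ≤ 1 / √t * gauss t x := by
  refine (heatKernel_le_gauss_sq ht x).trans ?_
  have h1 := gauss_le_one ht x
  have h0 := gauss_nonneg t x
  have hs := Real.sqrt_pos.2 ht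
  rw [← mul_assoc]
  refine mul_le_mul_of_nonneg_right ?_ h0
  calc 1 / (2 * √t) * gauss t x ≤ 1 / (2 * √t) * 1 := by gcongr
    _ ≤ 1 / √t := by rw [mul_one]; gcongr; linarith

theorem abs_heatDx_le {t : ℝ} (ht : 0 < t) (x : ℝ) : |heatDx t x| ≤ 1 / t * gauss t x := by
  have hs := Real.sqrt_pos.2 ht
  have hss : √t * √t = t := Real.mul_self_sqrt ht.le
  have h0 := gauss_nonneg t x
  have hx : |x| / √t * gauss t x ≤ 4 := by
    have h1 := gauss_le_one ht x
    have h2 := mul_gauss_le t x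
    -- The linear factor is reduced to the quadratic one by `r ≤ 1 + r²/4`, so that `mul_gauss_le`
    -- applies.
    have h3 : |x| / √t ≤ 1 + 1 / 4 * (|x| / √t) ^ 2 := by nlinarith [sq_nonneg (|x| / √t - 2)]
    have h4 : (|x| / √t) ^ 2 = 8 * (x ^ 2 / (8 * t)) := by
      rw [div_pow, sq_abs, Real.sq_sqrt ht.le]; field_simp
    rw [h4] at h3
    nlinarith
  rw [heatDx, abs_mul, abs_of_nonneg (heatKernel_nonneg t x), abs_div, abs_neg,
    abs_of_pos (by positivity : 0 < 2 * t)]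
  calc |x| / (2 * t) * heatKernel t x
      ≤ |x| / (2 * t) * (1 / (2 * √t) * (gauss t x * gauss t x)) := by
        gcongr; exact heatKernel_le_gauss_sq ht x
    _ = 1 / (4 * t) * (|x| / √t * gauss t x) * gauss t x := by field_simp; ring
    _ ≤ 1 / (4 * t) * 4 * gauss t x := by gcongr
    _ = 1 / t * gauss t x := by field_simp

theorem abs_heatDxx_le {t : ℝ} (ht : 0 < t) (x : ℝ) :
    |heatDxx t x| ≤ 2 / (t * √t) * gauss t x := by
  have hs := Real.sqrt_pos.2 ht
  have h0 := gauss_nonneg t x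
  have h1 := gauss_le_one ht x
  have h2 := mul_gauss_le t x
  rw [heatDxx, abs_mul, abs_of_nonneg (heatKernel_nonneg t x)]
  have h3 : |x ^ 2 / (4 * t ^ 2) - 1 / (2 * t)| ≤ 1 / t * (2 * (x ^ 2 / (8 * t)) + 1) := by
    have e1 : x ^ 2 / (4 * t ^ 2) = 1 / t * (2 * (x ^ 2 / (8 * t))) := by field_simp; ring
    have e2 : 1 / (2 * t) ≤ 1 / t := by gcongr; linarith
    have e3 : 0 ≤ x ^ 2 / (4 * t ^ 2) := by positivity
    have e4 : 0 ≤ 1 / (2 * t) := by positivity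
    rw [mul_add, ← e1, mul_one, abs_le]
    constructor <;> linarith
  calc |x ^ 2 / (4 * t ^ 2) - 1 / (2 * t)| * heatKernel t x
      ≤ 1 / t * (2 * (x ^ 2 / (8 * t)) + 1) * (1 / (2 * √t) * (gauss t x * gauss t x)) :=
        mul_le_mul h3 (heatKernel_le_gauss_sq ht x) (heatKernel_nonneg t x) (by positivity)
    _ = 1 / (2 * (t * √t)) * (2 * (x ^ 2 / (8 * t) * gauss t x) + gauss t x) * gauss t x := by
        field_simp
    _ ≤ 1 / (2 * (t * √t)) * (2 * 1 + 1) * gauss t x := by gcongr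
    _ ≤ 2 / (t * √t) * gauss t x := by
        gcongr
        rw [one_div, mul_inv, div_eq_mul_inv]
        have : 0 < (t * √t)⁻¹ := by positivity
        linarith

theorem lintegral_gauss_le {s : ℝ} (hs : 0 < s) :
    ∫⁻ z, ENNReal.ofReal (gauss s z) ≤ ENNReal.ofReal (6 * √s) := by
  have e : ∀ z, gauss s z = Real.exp (-(1 / (8 * s)) * z ^ 2) := fun z => by
    rw [gauss]; congr 1; ring
  have hb : 0 < 1 / (8 * s) := by positivity
  simp_rw [e]
  rw [← ofReal_integral_eq_lintegral_ofReal (integrable_exp_neg_mul_sq hb)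
    (ae_of_all _ fun z => (Real.exp_pos _).le), integral_gaussian]
  refine ENNReal.ofReal_le_ofReal ?_
  rw [show 6 * √s = √(36 * s) by
    rw [Real.sqrt_mul (by norm_num), show (36 : ℝ) = 6 ^ 2 by norm_num, Real.sqrt_sq (by norm_num)]]
  refine Real.sqrt_le_sqrt ?_
  rw [div_div_eq_mul_div, div_one]
  nlinarith [Real.pi_lt_four]

/-- The squared norm is `√(4πs) ≤ 4√s`. The resulting power `s^(1/4)` weakens every kernel
singularity below by a quarter. -/
theorem eLpNorm_gauss_le {s : ℝ} (hs : 0 < s) :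
    eLpNorm (fun z => ENNReal.ofReal (gauss s z)) 2 volume
      ≤ ENNReal.ofReal (2 * s ^ (1 / 4 : ℝ)) := by
  rw [eLpNorm_two_le_iff]
  have e : ∀ z, ‖ENNReal.ofReal (gauss s z)‖ₑ ^ 2
      = ENNReal.ofReal (Real.exp (-(1 / (4 * s)) * z ^ 2)) := fun z => by
    rw [enorm_eq_self, ← ENNReal.ofReal_pow (gauss_nonneg _ _), gauss, ← Real.exp_nat_mul]
    congr 2
    push_cast
    field_simp
    ring
  have hb : 0 < 1 / (4 * s) := by positivity
  simp_rw [e]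
  rw [← ofReal_integral_eq_lintegral_ofReal (integrable_exp_neg_mul_sq hb)
    (ae_of_all _ fun z => (Real.exp_pos _).le), integral_gaussian,
    ← ENNReal.ofReal_pow (by positivity)]
  refine ENNReal.ofReal_le_ofReal ?_
  rw [mul_pow, ← Real.rpow_natCast, ← Real.rpow_natCast, ← Real.rpow_mul hs.le,
    show (1 / 4 : ℝ) * (2 : ℕ) = 1 / 2 by norm_num, ← Real.sqrt_eq_rpow]
  rw [show (2 : ℝ) ^ ((2 : ℕ) : ℝ) * √s = √(16 * s) by
    rw [Real.sqrt_mul (by norm_num), show (16 : ℝ) = 4 ^ 2 by norm_num, Real.sqrt_sq (by norm_num)]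
    norm_num]
  refine Real.sqrt_le_sqrt ?_
  rw [div_div_eq_mul_div, div_one]
  nlinarith [Real.pi_lt_four]

/-- The Gaussian and its reflection, which dominate the half-line kernels. -/
def gaussSum (s x y : ℝ) : ℝ := gauss s (x - y) + gauss s (x + y)

theorem gaussSum_nonneg (s x y : ℝ) : 0 ≤ gaussSum s x y :=
  add_nonneg (gauss_nonneg _ _) (gauss_nonneg _ _)

theorem gaussSum_comm (s x y : ℝ) : gaussSum s x y = gaussSum s y x := by
  rw [gaussSum, gaussSum, ← gauss_neg s (x - y), neg_sub, add_comm x y]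

theorem measurable_gaussSum (s : ℝ) : Measurable fun p : ℝ × ℝ => gaussSum s p.1 p.2 := by
  unfold gaussSum gauss; fun_prop

theorem lintegral_gaussSum_le {s : ℝ} (hs : 0 < s) (y : ℝ) :
    ∫⁻ x, ENNReal.ofReal (gaussSum s x y) ∂μx ≤ ENNReal.ofReal (12 * √s) := by
  have m : Measurable fun z => ENNReal.ofReal (gauss s z) := by unfold gauss; fun_prop
  calc ∫⁻ x, ENNReal.ofReal (gaussSum s x y) ∂μx
      ≤ ∫⁻ x, ENNReal.ofReal (gaussSum s x y) := lintegral_mono' Measure.restrict_le_self le_rfl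
    _ = ∫⁻ x, ENNReal.ofReal (gauss s (x - y)) + ENNReal.ofReal (gauss s (x + y)) := by
        refine lintegral_congr fun x => ?_
        rw [gaussSum, ENNReal.ofReal_add (gauss_nonneg _ _) (gauss_nonneg _ _)]
    _ = (∫⁻ x, ENNReal.ofReal (gauss s x)) + ∫⁻ x, ENNReal.ofReal (gauss s x) := by
        rw [lintegral_add_left (by unfold gauss; fun_prop),
          lintegral_sub_right_eq_self (fun x => ENNReal.ofReal (gauss s x)) y,
          lintegral_add_right_eq_self (fun x => ENNReal.ofReal (gauss s x)) y]
    _ ≤ ENNReal.ofReal (6 * √s) + ENNReal.ofReal (6 * √s) :=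
        add_le_add (lintegral_gauss_le hs) (lintegral_gauss_le hs)
    _ = ENNReal.ofReal (12 * √s) := by
        rw [← ENNReal.ofReal_add (by positivity) (by positivity)]; ring_nf

theorem eLpNorm_gaussSum_le {s : ℝ} (hs : 0 < s) (y : ℝ) :
    eLpNorm (fun x => ENNReal.ofReal (gaussSum s x y)) 2 μx
      ≤ ENNReal.ofReal (4 * s ^ (1 / 4 : ℝ)) := by
  have m : Measurable fun z => ENNReal.ofReal (gauss s z) := by unfold gauss; fun_prop
  have tr : ∀ c : ℝ, eLpNorm (fun x => ENNReal.ofReal (gauss s (x + c))) 2 volume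
      ≤ ENNReal.ofReal (2 * s ^ (1 / 4 : ℝ)) := fun c => by
    have := eLpNorm_comp_measurePreserving (p := 2) m.aestronglyMeasurable
      (measurePreserving_add_right volume c)
    exact this.trans_le (eLpNorm_gauss_le hs)
  calc eLpNorm (fun x => ENNReal.ofReal (gaussSum s x y)) 2 μx
      ≤ eLpNorm (fun x => ENNReal.ofReal (gaussSum s x y)) 2 volume :=
        eLpNorm_mono_measure _ Measure.restrict_le_self
    _ = eLpNorm ((fun x => ENNReal.ofReal (gauss s (x + -y)))
          + fun x => ENNReal.ofReal (gauss s (x + y))) 2 volume := by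
        congr 1
        ext x
        rw [gaussSum, ENNReal.ofReal_add (gauss_nonneg _ _) (gauss_nonneg _ _), sub_eq_add_neg]
        rfl
    _ ≤ ENNReal.ofReal (2 * s ^ (1 / 4 : ℝ)) + ENNReal.ofReal (2 * s ^ (1 / 4 : ℝ)) := by
        refine (eLpNorm_add_le ?_ ?_ one_le_two).trans (add_le_add (tr _) (tr _))
        · exact (m.comp (measurable_add_const _)).aestronglyMeasurable
        · exact (m.comp (measurable_add_const _)).aestronglyMeasurable
    _ = ENNReal.ofReal (4 * s ^ (1 / 4 : ℝ)) := by
        rw [← ENNReal.ofReal_add (by positivity) (by positivity)]; ring_nf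

/-! ### Integral operators with Gaussian kernels -/

/-- Schur's test; `gaussSum` is symmetric in `x` and `y`, so one computation gives both row and
column bounds. -/
theorem eLpNorm_kernel_le_of_two {s a : ℝ} (hs : 0 < s) (ha : 0 ≤ a) {k : ℝ → ℝ → ℝ}
    (hk : ∀ x y, |k x y| ≤ a * gaussSum s x y) {f : ℝ → ℝ} (hf : AEStronglyMeasurable f μx) :
    eLpNorm (fun x => ∫⁻ y, ‖k x y * f y‖ₑ ∂μx) 2 μx
      ≤ ENNReal.ofReal (a * (12 * √s)) * eLpNorm f 2 μx := by
  have hm : Measurable (Function.uncurry fun x y => ENNReal.ofReal (a * gaussSum s x y)) :=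
    ((measurable_gaussSum s).const_mul a).ennreal_ofReal
  have hA : ∀ y, ∫⁻ x, ENNReal.ofReal (a * gaussSum s x y) ∂μx
      ≤ ENNReal.ofReal (a * (12 * √s)) := fun y => by
    simp_rw [ENNReal.ofReal_mul ha]
    rw [lintegral_const_mul' _ _ ENNReal.ofReal_ne_top]
    gcongr
    exact lintegral_gaussSum_le hs y
  calc eLpNorm (fun x => ∫⁻ y, ‖k x y * f y‖ₑ ∂μx) 2 μx
      ≤ eLpNorm (fun x => ∫⁻ y, ENNReal.ofReal (a * gaussSum s x y) * ‖f y‖ₑ ∂μx) 2 μx := by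
        refine eLpNorm_mono_enorm fun x => ?_
        simp only [enorm_eq_self]
        refine lintegral_mono fun y => ?_
        rw [enorm_mul]
        gcongr
        rw [Real.enorm_eq_ofReal_abs]
        exact ENNReal.ofReal_le_ofReal (hk x y)
    _ ≤ _ := eLpNorm_two_lintegral_mul_le hm hf.enorm
        (fun x => by simpa only [gaussSum_comm s x] using hA x) hA
    _ = _ := by rw [eLpNorm_enorm]

/-- For `L¹` input Minkowski's inequality is applied in `y`. What enters is the `L²` norm of a
column of the kernel, hence `s^(1/4)` in place of `s^(1/2)`. -/
theorem eLpNorm_kernel_le_of_one {s a : ℝ} (hs : 0 < s) (ha : 0 ≤ a) {k : ℝ → ℝ → ℝ}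
    (hk : ∀ x y, |k x y| ≤ a * gaussSum s x y) {f : ℝ → ℝ} (hf : AEStronglyMeasurable f μx) :
    eLpNorm (fun x => ∫⁻ y, ‖k x y * f y‖ₑ ∂μx) 2 μx
      ≤ ENNReal.ofReal (a * (4 * s ^ (1 / 4 : ℝ))) * eLpNorm f 1 μx := by
  have hm : AEMeasurable (Function.uncurry fun y x => ENNReal.ofReal (a * gaussSum s x y) * ‖f y‖ₑ)
      (μx.prod μx) := by
    refine AEMeasurable.mul ?_ (hf.enorm.comp_quasiMeasurePreserving
      Measure.quasiMeasurePreserving_fst)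
    exact (((measurable_gaussSum s).comp measurable_swap).const_mul a).ennreal_ofReal.aemeasurable
  calc eLpNorm (fun x => ∫⁻ y, ‖k x y * f y‖ₑ ∂μx) 2 μx
      ≤ eLpNorm (fun x => ∫⁻ y, ENNReal.ofReal (a * gaussSum s x y) * ‖f y‖ₑ ∂μx) 2 μx := by
        refine eLpNorm_mono_enorm fun x => ?_
        simp only [enorm_eq_self]
        refine lintegral_mono fun y => ?_
        rw [enorm_mul]
        gcongr
        rw [Real.enorm_eq_ofReal_abs]
        exact ENNReal.ofReal_le_ofReal (hk x y)
    _ ≤ ∫⁻ y, eLpNorm (fun x => ENNReal.ofReal (a * gaussSum s x y) * ‖f y‖ₑ) 2 μx ∂μx :=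
        eLpNorm_two_lintegral_le hm
    _ ≤ ∫⁻ y, ENNReal.ofReal (a * (4 * s ^ (1 / 4 : ℝ))) * ‖f y‖ₑ ∂μx := by
        refine lintegral_mono fun y => ?_
        rw [eLpNorm_two_le_iff]
        calc ∫⁻ x, ‖ENNReal.ofReal (a * gaussSum s x y) * ‖f y‖ₑ‖ₑ ^ 2 ∂μx
            = ∫⁻ x, (ENNReal.ofReal a * ‖f y‖ₑ) ^ 2 * ENNReal.ofReal (gaussSum s x y) ^ 2 ∂μx := by
              refine lintegral_congr fun x => ?_
              rw [enorm_eq_self, ENNReal.ofReal_mul ha]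
              ring
          _ = (ENNReal.ofReal a * ‖f y‖ₑ) ^ 2
                * eLpNorm (fun x => ENNReal.ofReal (gaussSum s x y)) 2 μx ^ 2 := by
              rw [lintegral_const_mul' _ _ (by finiteness), eLpNorm_two_sq]
              simp
          _ ≤ (ENNReal.ofReal a * ‖f y‖ₑ) ^ 2 * ENNReal.ofReal (4 * s ^ (1 / 4 : ℝ)) ^ 2 := by
              gcongr
              exact eLpNorm_gaussSum_le hs y
          _ = _ := by rw [ENNReal.ofReal_mul ha]; ring
    _ = _ := by
        rw [lintegral_const_mul' _ _ ENNReal.ofReal_ne_top, eLpNorm_one_eq_lintegral_enorm]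

/-! ### Dirichlet and Neumann kernels of the half-line -/

/-- The Dirichlet heat kernel of the half-line. -/
def dirKer (s x y : ℝ) : ℝ := heatKernel s (x - y) - heatKernel s (x + y)

/-- The spatial derivative of the Dirichlet heat kernel. -/
def dirKerDx (s x y : ℝ) : ℝ := heatDx s (x - y) - heatDx s (x + y)

/-- The Neumann heat kernel of the half-line. -/
def neuKer (s x y : ℝ) : ℝ := heatKernel s (x - y) + heatKernel s (x + y)

theorem abs_dirKer_le {s : ℝ} (hs : 0 < s) (x y : ℝ) :
    |dirKer s x y| ≤ 1 / √s * gaussSum s x y := by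
  have h1 := heatKernel_le hs (x - y)
  have h2 := heatKernel_le hs (x + y)
  have h3 := heatKernel_nonneg s (x - y)
  have h4 := heatKernel_nonneg s (x + y)
  rw [dirKer, gaussSum, mul_add, abs_le]
  constructor <;> linarith

theorem abs_neuKer_le {s : ℝ} (hs : 0 < s) (x y : ℝ) :
    |neuKer s x y| ≤ 1 / √s * gaussSum s x y := by
  have h1 := heatKernel_le hs (x - y)
  have h2 := heatKernel_le hs (x + y)
  have h3 := heatKernel_nonneg s (x - y)
  have h4 := heatKernel_nonneg s (x + y)
  rw [neuKer, gaussSum, mul_add, abs_le]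
  constructor <;> linarith

theorem abs_dirKerDx_le {s : ℝ} (hs : 0 < s) (x y : ℝ) :
    |dirKerDx s x y| ≤ 1 / s * gaussSum s x y := by
  have h1 := abs_heatDx_le hs (x - y)
  have h2 := abs_heatDx_le hs (x + y)
  rw [dirKerDx, gaussSum, mul_add]
  exact (abs_sub _ _).trans (add_le_add h1 h2)

theorem hasDerivAt_dirKer {s : ℝ} (hs : 0 < s) (x y : ℝ) :
    HasDerivAt (fun x => dirKer s x y) (dirKerDx s x y) x :=
  ((hasDerivAt_heatKernel hs (x - y)).comp_sub_const x y).sub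
    ((hasDerivAt_heatKernel hs (x + y)).comp_add_const x y)

/-- The reflected term changes sign between the two boundary conditions, so the `x`-derivative of
the Dirichlet kernel is minus the `y`-derivative of the Neumann kernel. Integration by parts can
thus move the derivative onto the datum. -/
theorem hasDerivAt_neuKer {s : ℝ} (hs : 0 < s) (x y : ℝ) :
    HasDerivAt (neuKer s x) (-dirKerDx s x y) y := by
  have h1 := (hasDerivAt_heatKernel hs (x - y)).comp_const_sub x y
  have h2 := (hasDerivAt_heatKernel hs (x + y)).comp_const_add x y
  refine (h1.add h2).congr_deriv ?_
  rw [dirKerDx]; ring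

theorem hasWeakDeriv_dirKer_mul {s : ℝ} (hs : 0 < s) (y c : ℝ) :
    HasWeakDeriv (fun x => dirKer s x y * c) (fun x => dirKerDx s x y * c) := by
  refine .of_hasDerivAt (fun x _ => (hasDerivAt_dirKer hs x y).mul_const c) ?_
  have := continuous_heatDx s
  unfold dirKerDx
  fun_prop

/-- The constant in the smoothing estimates up to time `T`. -/
def smoothConst (T : ℝ) : ℝ := 12 * (1 + √T) * (1 + T ^ (1 / 4 : ℝ))

theorem smoothConst_pos {T : ℝ} (hT : 0 < T) : 0 < smoothConst T := by
  unfold smoothConst; positivity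

/-- The `L¹` part costs `s^(1/4) / s = s^(-3/4)`; the `L²` part costs only `s^(-1/2)`, which is at
most `T^(1/4) s^(-3/4)`. The prefactor `(1 + √T) / s` dominates both `1/s` and, for `s ≤ T`, `1/√s`,
so the kernel and its derivative are covered together. -/
theorem eLpNorm_kernel_le {T s : ℝ} (hs : 0 < s) (hsT : s ≤ T) {k : ℝ → ℝ → ℝ}
    (hk : ∀ x y, |k x y| ≤ (1 + √T) / s * gaussSum s x y) {f₁ f₂ : ℝ → ℝ}
    (hf₁ : AEStronglyMeasurable f₁ μx) (hf₂ : AEStronglyMeasurable f₂ μx)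
    (hkm : Measurable (Function.uncurry k)) :
    eLpNorm (fun x => ∫⁻ y, ‖k x y * (f₁ y + f₂ y)‖ₑ ∂μx) 2 μx
      ≤ ENNReal.ofReal (smoothConst T * s ^ (-(3 / 4) : ℝ))
        * (eLpNorm f₁ 1 μx + eLpNorm f₂ 2 μx) := by
  have hT : 0 < T := hs.trans_le hsT
  have ha : 0 ≤ (1 + √T) / s := by positivity
  have e1 : s ^ (1 / 4 : ℝ) / s = s ^ (-(3 / 4) : ℝ) := by
    rw [← Real.rpow_sub_one hs.ne']; norm_num
  have e2 : √s / s ≤ T ^ (1 / 4 : ℝ) * s ^ (-(3 / 4) : ℝ) := by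
    rw [Real.sqrt_eq_rpow, ← Real.rpow_sub_one hs.ne',
      show (1 / 2 - 1 : ℝ) = 1 / 4 + (-(3 / 4)) by norm_num, Real.rpow_add hs]
    gcongr
  have hp : 0 < s ^ (-(3 / 4) : ℝ) := Real.rpow_pos_of_pos hs _
  have hq : 0 < T ^ (1 / 4 : ℝ) := Real.rpow_pos_of_pos hT _
  have c1 : (1 + √T) / s * (4 * s ^ (1 / 4 : ℝ)) ≤ smoothConst T * s ^ (-(3 / 4) : ℝ) := by
    calc (1 + √T) / s * (4 * s ^ (1 / 4 : ℝ)) = 4 * (1 + √T) * 1 * s ^ (-(3 / 4) : ℝ) := by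
          rw [← e1]; ring
      _ ≤ 12 * (1 + √T) * (1 + T ^ (1 / 4 : ℝ)) * s ^ (-(3 / 4) : ℝ) := by
          gcongr <;> linarith
  have c2 : (1 + √T) / s * (12 * √s) ≤ smoothConst T * s ^ (-(3 / 4) : ℝ) := by
    calc (1 + √T) / s * (12 * √s) = 12 * (1 + √T) * (√s / s) := by ring
      _ ≤ 12 * (1 + √T) * (T ^ (1 / 4 : ℝ) * s ^ (-(3 / 4) : ℝ)) := by gcongr
      _ = 12 * (1 + √T) * T ^ (1 / 4 : ℝ) * s ^ (-(3 / 4) : ℝ) := by ring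
      _ ≤ 12 * (1 + √T) * (1 + T ^ (1 / 4 : ℝ)) * s ^ (-(3 / 4) : ℝ) := by
          gcongr; linarith
  have m : ∀ f : ℝ → ℝ, AEStronglyMeasurable f μx →
      AEStronglyMeasurable (fun x => ∫⁻ y, ‖k x y * f y‖ₑ ∂μx) μx := fun f hf => by
    refine AEMeasurable.aestronglyMeasurable (AEMeasurable.lintegral_prod_right'
      (f := fun p : ℝ × ℝ => ‖k p.1 p.2 * f p.2‖ₑ) ?_)
    exact (hkm.aestronglyMeasurable.mul
      (hf.comp_quasiMeasurePreserving Measure.quasiMeasurePreserving_snd)).enorm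
  calc eLpNorm (fun x => ∫⁻ y, ‖k x y * (f₁ y + f₂ y)‖ₑ ∂μx) 2 μx
      ≤ eLpNorm ((fun x => ∫⁻ y, ‖k x y * f₁ y‖ₑ ∂μx) + fun x => ∫⁻ y, ‖k x y * f₂ y‖ₑ ∂μx)
          2 μx := by
        refine eLpNorm_mono_enorm fun x => ?_
        simp only [enorm_eq_self, Pi.add_apply]
        rw [← lintegral_add_left']
        · refine lintegral_mono fun y => ?_
          rw [mul_add]
          exact enorm_add_le _ _
        · exact ((hkm.comp measurable_prodMk_left).aestronglyMeasurable.mul hf₁).enorm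
    _ ≤ _ := eLpNorm_add_le (m f₁ hf₁) (m f₂ hf₂) one_le_two
    _ ≤ ENNReal.ofReal (smoothConst T * s ^ (-(3 / 4) : ℝ)) * eLpNorm f₁ 1 μx
        + ENNReal.ofReal (smoothConst T * s ^ (-(3 / 4) : ℝ)) * eLpNorm f₂ 2 μx := by
        refine add_le_add ((eLpNorm_kernel_le_of_one hs ha hk hf₁).trans ?_)
          ((eLpNorm_kernel_le_of_two hs ha hk hf₂).trans ?_)
        · gcongr
        · gcongr
    _ = _ := by rw [mul_add]

/-! ### The Duhamel integral -/

/-- The Duhamel integral of `F`. -/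
def duhamel (F : ℝ → ℝ → ℝ) (t x : ℝ) : ℝ :=
  ∫ τ in (0 : ℝ)..t, dirichletConv (t - τ) (F τ) x

/-- `F τ` is the sum of an `L¹` function and an `L²` function with total norm at most `N τ`, for
almost every `τ ∈ [0, T]`. -/
def IsSource (T : ℝ) (F : ℝ → ℝ → ℝ) (N : ℝ → ℝ≥0∞) : Prop :=
  ∃ h₁ h₂ : ℝ → ℝ → ℝ, AEStronglyMeasurable (Function.uncurry h₁) (μtx T) ∧
    AEStronglyMeasurable (Function.uncurry h₂) (μtx T) ∧ (∀ τ y, F τ y = h₁ τ y + h₂ τ y) ∧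
    ∀ᵐ τ ∂μt T, eLpNorm (h₁ τ) 1 μx + eLpNorm (h₂ τ) 2 μx ≤ N τ

instance (T : ℝ) : SFinite (μt T) := by rw [μt]; infer_instance

theorem ae_aestronglyMeasurable_of_uncurry {T : ℝ} {h : ℝ → ℝ → ℝ}
    (hh : AEStronglyMeasurable (Function.uncurry h) (μtx T)) :
    ∀ᵐ τ ∂μt T, AEStronglyMeasurable (h τ) μx :=
  hh.prodMk_left

theorem IsSource.mono {T : ℝ} {F : ℝ → ℝ → ℝ} {N N' : ℝ → ℝ≥0∞} (h : IsSource T F N)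
    (hN : ∀ᵐ τ ∂μt T, N τ ≤ N' τ) : IsSource T F N' := by
  obtain ⟨h₁, h₂, m₁, m₂, e, b⟩ := h
  exact ⟨h₁, h₂, m₁, m₂, e, by filter_upwards [b, hN] with τ a b using a.trans b⟩

theorem IsSource.add {T : ℝ} {F F' : ℝ → ℝ → ℝ} {N N' : ℝ → ℝ≥0∞} (hF : IsSource T F N)
    (hF' : IsSource T F' N') : IsSource T (fun τ y => F τ y + F' τ y) fun τ => N τ + N' τ := by
  obtain ⟨h₁, h₂, m₁, m₂, e, b⟩ := hF
  obtain ⟨h₁', h₂', m₁', m₂', e', b'⟩ := hF'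
  refine ⟨fun τ y => h₁ τ y + h₁' τ y, fun τ y => h₂ τ y + h₂' τ y, m₁.add m₁', m₂.add m₂',
    fun τ y => by simp only [e, e']; ring, ?_⟩
  filter_upwards [b, b', ae_aestronglyMeasurable_of_uncurry m₁,
    ae_aestronglyMeasurable_of_uncurry m₂, ae_aestronglyMeasurable_of_uncurry m₁',
    ae_aestronglyMeasurable_of_uncurry m₂'] with τ hb hb' q₁ q₂ q₁' q₂'
  calc _ ≤ (eLpNorm (h₁ τ) 1 μx + eLpNorm (h₁' τ) 1 μx)
        + (eLpNorm (h₂ τ) 2 μx + eLpNorm (h₂' τ) 2 μx) :=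
        add_le_add (eLpNorm_add_le q₁ q₁' le_rfl) (eLpNorm_add_le q₂ q₂' one_le_two)
    _ = (eLpNorm (h₁ τ) 1 μx + eLpNorm (h₂ τ) 2 μx)
        + (eLpNorm (h₁' τ) 1 μx + eLpNorm (h₂' τ) 2 μx) := by ring
    _ ≤ _ := add_le_add hb hb'

theorem IsSource.aestronglyMeasurable {T : ℝ} {F : ℝ → ℝ → ℝ} {N : ℝ → ℝ≥0∞}
    (h : IsSource T F N) : AEStronglyMeasurable (Function.uncurry F) (μtx T) := by
  obtain ⟨h₁, h₂, m₁, m₂, e, b⟩ := h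
  exact (m₁.add m₂).congr (ae_of_all _ fun p => (e p.1 p.2).symm)

/-- With `s = t - τ` and `exp(lτ) = exp(lt) exp(-ls)`, enlarging the domain to the half-line leaves
a Gamma integral equal to `Γ(1/4) l^(-1/4)`. Its decay in `l` replaces the smallness of `T` in the
Gronwall argument. -/
theorem lintegral_duhamel_weight_le {C l t : ℝ} (hC : 0 ≤ C) (hl : 0 < l) (M : ℝ≥0∞) :
    ∫⁻ τ in Ioo 0 t, ENNReal.ofReal (C * (t - τ) ^ (-(3 / 4) : ℝ))
        * (M * ENNReal.ofReal (Real.exp (l * τ)))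
      ≤ ENNReal.ofReal (C * Real.Gamma (1 / 4) * (1 / l) ^ (1 / 4 : ℝ) * Real.exp (l * t)) * M := by
  set g : ℝ → ℝ≥0∞ := (Ioi 0).indicator fun s =>
    ENNReal.ofReal (s ^ ((1 / 4 : ℝ) - 1) * Real.exp (-(l * s))) with hg
  have hgm : Measurable g := by
    refine Measurable.indicator ?_ measurableSet_Ioi
    fun_prop
  have hint : ∫⁻ s, g s = ENNReal.ofReal ((1 / l) ^ (1 / 4 : ℝ) * Real.Gamma (1 / 4)) := by
    rw [hg, lintegral_indicator measurableSet_Ioi,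
      ← Real.integral_rpow_mul_exp_neg_mul_Ioi (by norm_num : (0 : ℝ) < 1 / 4) hl,
      ofReal_integral_eq_lintegral_ofReal]
    -- Integrability is read off from the value: a non-integrable function would have Bochner
    -- integral `0`, whereas the Gamma integral is positive.
    · by_contra hcon
      have h0 := integral_undef hcon
      rw [Real.integral_rpow_mul_exp_neg_mul_Ioi (by norm_num : (0 : ℝ) < 1 / 4) hl] at h0
      have : 0 < (1 / l) ^ (1 / 4 : ℝ) * Real.Gamma (1 / 4) := by positivity
      exact this.ne' h0
    · filter_upwards [self_mem_ae_restrict measurableSet_Ioi] with s hs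
      have := Real.rpow_nonneg (le_of_lt hs) ((1 / 4 : ℝ) - 1)
      positivity
  calc ∫⁻ τ in Ioo 0 t, ENNReal.ofReal (C * (t - τ) ^ (-(3 / 4) : ℝ))
        * (M * ENNReal.ofReal (Real.exp (l * τ)))
      ≤ ∫⁻ τ in Ioo 0 t, ENNReal.ofReal (C * Real.exp (l * t)) * M * g (t - τ) := by
        refine setLIntegral_mono' measurableSet_Ioo fun τ hτ => ?_
        have hs : 0 < t - τ := sub_pos.2 hτ.2
        have hp := Real.rpow_nonneg hs.le (-(3 / 4) : ℝ)
        have key : ENNReal.ofReal (C * (t - τ) ^ (-(3 / 4) : ℝ)) * ENNReal.ofReal (Real.exp (l * τ))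
            = ENNReal.ofReal (C * Real.exp (l * t)) * g (t - τ) := by
          rw [hg, indicator_of_mem (show t - τ ∈ Ioi 0 from hs), ← ENNReal.ofReal_mul (by positivity),
            ← ENNReal.ofReal_mul (by positivity), show (1 / 4 : ℝ) - 1 = -(3 / 4) by norm_num,
            show Real.exp (l * τ) = Real.exp (l * t) * Real.exp (-(l * (t - τ))) by
              rw [← Real.exp_add]; ring_nf]
          congr 1
          ring
        rw [mul_left_comm, key, mul_right_comm, mul_comm M]
    _ ≤ ∫⁻ τ, ENNReal.ofReal (C * Real.exp (l * t)) * M * g (t - τ) :=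
        lintegral_mono' Measure.restrict_le_self le_rfl
    _ = ENNReal.ofReal (C * Real.exp (l * t)) * M * ∫⁻ s, g s := by
        rw [lintegral_const_mul _ (by fun_prop), lintegral_sub_left_eq_self g t]
    _ = _ := by
        rw [hint, mul_right_comm, ← ENNReal.ofReal_mul (by positivity)]
        congr 2
        ring

/-- Lebesgue measure on `(0, t) × (0, ∞)`. -/
def νtx (t : ℝ) : Measure (ℝ × ℝ) := (volume.restrict (Ioo 0 t)).prod μx

instance (t : ℝ) : SFinite (νtx t) := by rw [νtx]; infer_instance

theorem restrict_Ioo_le {t T : ℝ} (ht : t ≤ T) : volume.restrict (Ioo 0 t) ≤ μt T :=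
  Measure.restrict_mono (fun _ h => ⟨h.1.le, h.2.le.trans ht⟩ : Ioo 0 t ⊆ Icc 0 T) le_rfl

theorem νtx_ac {t T : ℝ} (ht : t ≤ T) : νtx t ≪ μtx T :=
  Measure.AbsolutelyContinuous.prod (restrict_Ioo_le ht).absolutelyContinuous .rfl

theorem quasiMeasurePreserving_skip (t : ℝ) :
    Measure.QuasiMeasurePreserving (fun q : (ℝ × ℝ) × ℝ => (q.1.1, q.2))
      (((volume.restrict (Ioo 0 t)).prod μx).prod μx) (νtx t) :=
  QuasiMeasurePreserving.prodMap Measure.quasiMeasurePreserving_fst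
    (Measure.QuasiMeasurePreserving.id μx)

/-- Minkowski's inequality in `τ`, the smoothing estimate at time `t - τ`, then the weighted time
integral. The kernel is left general so that `dirKer` and `dirKerDx` are both covered. -/
theorem eLpNorm_duhamel_le {T l t : ℝ} (hl : 0 < l) (ht : t ∈ Icc 0 T)
    {k : ℝ → ℝ → ℝ → ℝ} (hkm : Measurable fun q : (ℝ × ℝ) × ℝ => k q.1.1 q.1.2 q.2)
    (hk : ∀ s, 0 < s → s ≤ T → ∀ x y, |k s x y| ≤ (1 + √T) / s * gaussSum s x y)
    {F : ℝ → ℝ → ℝ} {M : ℝ≥0∞} (hF : IsSource T F fun τ => M * ENNReal.ofReal (Real.exp (l * τ))) :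
    eLpNorm (fun x => ∫⁻ p, ‖k (t - p.1) x p.2 * F p.1 p.2‖ₑ ∂νtx t) 2 μx
      ≤ ENNReal.ofReal (smoothConst T * Real.Gamma (1 / 4) * (1 / l) ^ (1 / 4 : ℝ)
        * Real.exp (l * t)) * M := by
  have hFm := hF.aestronglyMeasurable.mono_ac (νtx_ac ht.2)
  obtain ⟨h₁, h₂, m₁, m₂, e, b⟩ := hF
  have hC : 0 ≤ smoothConst T := by
    have := Real.rpow_nonneg (ht.1.trans ht.2) (1 / 4 : ℝ)
    unfold smoothConst; positivity
  have hb : ∀ᵐ τ ∂volume.restrict (Ioo 0 t),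
      eLpNorm (fun x => ∫⁻ y, ‖k (t - τ) x y * F τ y‖ₑ ∂μx) 2 μx
        ≤ ENNReal.ofReal (smoothConst T * (t - τ) ^ (-(3 / 4) : ℝ))
          * (M * ENNReal.ofReal (Real.exp (l * τ))) := by
    have hle := Measure.absolutelyContinuous_of_le (restrict_Ioo_le ht.2)
    filter_upwards [hle.ae_le b, hle.ae_le (ae_aestronglyMeasurable_of_uncurry m₁),
      hle.ae_le (ae_aestronglyMeasurable_of_uncurry m₂), self_mem_ae_restrict measurableSet_Ioo]
      with τ hb hm₁ hm₂ hτ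
    have hs : 0 < t - τ := sub_pos.2 hτ.2
    have hsT : t - τ ≤ T := by linarith [hτ.1, ht.2]
    simp_rw [e]
    refine (eLpNorm_kernel_le hs hsT (hk _ hs hsT) hm₁ hm₂ ?_).trans (by gcongr)
    exact hkm.comp (g := fun q : (ℝ × ℝ) × ℝ => k q.1.1 q.1.2 q.2)
      (f := fun p : ℝ × ℝ => ((t - τ, p.1), p.2)) (by fun_prop)
  have e1 : ∀ x, ∫⁻ p, ‖k (t - p.1) x p.2 * F p.1 p.2‖ₑ ∂νtx t
      = ∫⁻ τ in Ioo 0 t, ∫⁻ y, ‖k (t - τ) x y * F τ y‖ₑ ∂μx := fun x => by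
    rw [νtx, lintegral_prod]
    refine (AEStronglyMeasurable.mul ?_ hFm).enorm
    exact (hkm.comp (f := fun p : ℝ × ℝ => ((t - p.1, x), p.2)) (by fun_prop)).aestronglyMeasurable
  simp_rw [e1]
  refine (eLpNorm_two_lintegral_le ?_).trans ((lintegral_mono_ae hb).trans
    (lintegral_duhamel_weight_le hC hl M))
  refine AEMeasurable.lintegral_prod_right'
    (f := fun q : (ℝ × ℝ) × ℝ => ‖k (t - q.1.1) q.1.2 q.2 * F q.1.1 q.2‖ₑ) ?_
  refine (AEStronglyMeasurable.mul ?_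
    (hFm.comp_quasiMeasurePreserving (quasiMeasurePreserving_skip t))).enorm
  exact (hkm.comp (f := fun q : (ℝ × ℝ) × ℝ => ((t - q.1.1, q.1.2), q.2))
    (by fun_prop)).aestronglyMeasurable

theorem one_div_sqrt_le {s T : ℝ} (hs : 0 < s) (hsT : s ≤ T) : 1 / √s ≤ (1 + √T) / s := by
  have h := Real.sqrt_pos.2 hs
  rw [div_le_div_iff₀ h hs]
  have h1 := Real.mul_self_sqrt hs.le
  have h2 := Real.sqrt_le_sqrt hsT
  nlinarith

theorem measurable_dirKer : Measurable fun q : (ℝ × ℝ) × ℝ => dirKer q.1.1 q.1.2 q.2 := by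
  unfold dirKer heatKernel; fun_prop

theorem measurable_dirKerDx : Measurable fun q : (ℝ × ℝ) × ℝ => dirKerDx q.1.1 q.1.2 q.2 := by
  unfold dirKerDx heatDx heatKernel; fun_prop

theorem abs_dirKer_le' {s T : ℝ} (hs : 0 < s) (hsT : s ≤ T) (x y : ℝ) :
    |dirKer s x y| ≤ (1 + √T) / s * gaussSum s x y :=
  (abs_dirKer_le hs x y).trans
    (mul_le_mul_of_nonneg_right (one_div_sqrt_le hs hsT) (gaussSum_nonneg s x y))

theorem abs_dirKerDx_le' {s T : ℝ} (hs : 0 < s) (x y : ℝ) :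
    |dirKerDx s x y| ≤ (1 + √T) / s * gaussSum s x y := by
  refine (abs_dirKerDx_le hs x y).trans
    (mul_le_mul_of_nonneg_right ?_ (gaussSum_nonneg s x y))
  gcongr
  linarith [Real.sqrt_nonneg T]

/-- The Duhamel integral as an integral over `(0, t) × (0, ∞)`. -/
theorem ae_duhamel_eq {T l t : ℝ} (hl : 0 < l) (ht : t ∈ Icc 0 T) {F : ℝ → ℝ → ℝ} {M : ℝ≥0∞}
    (hM : M < ⊤) (hF : IsSource T F fun τ => M * ENNReal.ofReal (Real.exp (l * τ))) :
    ∀ᵐ x ∂μx, Integrable (fun p => dirKer (t - p.1) x p.2 * F p.1 p.2) (νtx t) ∧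
      duhamel F t x = ∫ p, dirKer (t - p.1) x p.2 * F p.1 p.2 ∂νtx t := by
  have hFm := hF.aestronglyMeasurable.mono_ac (νtx_ac ht.2)
  have hb := eLpNorm_duhamel_le hl ht measurable_dirKer
    (fun s hs hsT x y => abs_dirKer_le' hs hsT x y) hF
  -- Finiteness of this `L²` norm forces the inner absolute integral to be finite for almost every
  -- `x`, which is exactly the integrability needed for Fubini.
  have hlt : ∫⁻ x, ‖∫⁻ p, ‖dirKer (t - p.1) x p.2 * F p.1 p.2‖ₑ ∂νtx t‖ₑ ^ 2 ∂μx < ⊤ := by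
    rw [← eLpNorm_two_sq]
    exact ENNReal.pow_lt_top (hb.trans_lt (ENNReal.mul_lt_top ENNReal.ofReal_lt_top hM))
  have hmeas : AEMeasurable (fun x => ‖∫⁻ p, ‖dirKer (t - p.1) x p.2 * F p.1 p.2‖ₑ ∂νtx t‖ₑ ^ 2)
      μx := by
    simp only [enorm_eq_self]
    refine AEMeasurable.pow_const (AEMeasurable.lintegral_prod_right'
      (f := fun q : ℝ × (ℝ × ℝ) => ‖dirKer (t - q.2.1) q.1 q.2.2 * F q.2.1 q.2.2‖ₑ) ?_) 2
    refine (AEStronglyMeasurable.mul ?_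
      (hFm.comp_quasiMeasurePreserving Measure.quasiMeasurePreserving_snd)).enorm
    exact (measurable_dirKer.comp (f := fun q : ℝ × (ℝ × ℝ) => ((t - q.2.1, q.1), q.2.2))
      (by fun_prop)).aestronglyMeasurable
  filter_upwards [ae_lt_top' hmeas hlt.ne] with x hx
  have hi : Integrable (fun p => dirKer (t - p.1) x p.2 * F p.1 p.2) (νtx t) := by
    refine ⟨AEStronglyMeasurable.mul ?_ hFm, ?_⟩
    · exact (measurable_dirKer.comp (f := fun p : ℝ × ℝ => ((t - p.1, x), p.2))
        (by fun_prop)).aestronglyMeasurable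
    · rw [hasFiniteIntegral_iff_enorm]
      rw [enorm_eq_self] at hx
      by_contra hcon
      rw [not_lt, top_le_iff] at hcon
      rw [hcon] at hx
      simp at hx
  refine ⟨hi, ?_⟩
  rw [νtx] at hi ⊢
  rw [integral_prod _ hi, duhamel, intervalIntegral.integral_of_le ht.1,
    integral_Ioc_eq_integral_Ioo]
  refine setIntegral_congr_fun measurableSet_Ioo fun τ hτ => ?_
  -- On the open interval `t - τ` is positive, so the branch of `dirichletConv` at time zero does
  -- not occur.
  simp only [dirichletConv, sub_pos, hτ.2, if_true]
  rfl

/-- The Duhamel integral is a superposition over `(τ, y)` of multiples of the smooth functions `x ↦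
dirKer (t - τ) x y`; the weak derivative is taken slice by slice. -/
theorem W12Bound.duhamel {T l t : ℝ} (hl : 0 < l) (ht : t ∈ Icc 0 T) {F : ℝ → ℝ → ℝ} {M : ℝ≥0∞}
    (hM : M < ⊤) (hF : IsSource T F fun τ => M * ENNReal.ofReal (Real.exp (l * τ))) :
    W12Bound (HalfLine.duhamel F t) (ENNReal.ofReal (smoothConst T * Real.Gamma (1 / 4)
      * (1 / l) ^ (1 / 4 : ℝ) * Real.exp (l * t)) * M) := by
  have hFm := hF.aestronglyMeasurable.mono_ac (νtx_ac ht.2)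
  have hm : ∀ {k : ℝ → ℝ → ℝ → ℝ}, (Measurable fun q : (ℝ × ℝ) × ℝ => k q.1.1 q.1.2 q.2) →
      AEStronglyMeasurable (Function.uncurry fun (p : ℝ × ℝ) x => k (t - p.1) x p.2 * F p.1 p.2)
        ((νtx t).prod μx) := fun hk => by
    refine AEStronglyMeasurable.mul ?_
      (hFm.comp_quasiMeasurePreserving Measure.quasiMeasurePreserving_fst)
    exact (hk.comp (f := fun q : (ℝ × ℝ) × ℝ => ((t - q.1.1, q.2), q.1.2))
      (by fun_prop)).aestronglyMeasurable
  refine (W12Bound.integral (ν := νtx t) (hm measurable_dirKer) (hm measurable_dirKerDx) ?_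
    (ENNReal.mul_lt_top ENNReal.ofReal_lt_top hM)
    (eLpNorm_duhamel_le hl ht measurable_dirKer (fun s hs hsT x y => abs_dirKer_le' hs hsT x y) hF)
    (eLpNorm_duhamel_le hl ht measurable_dirKerDx (fun s hs _ x y => abs_dirKerDx_le' hs x y) hF)
    ).congr ((ae_duhamel_eq hl ht hM hF).mono fun x hx => hx.2.symm)
  have : ∀ᵐ p ∂νtx t, p.1 ∈ Ioo 0 t :=
    Measure.quasiMeasurePreserving_fst.ae (self_mem_ae_restrict measurableSet_Ioo)
  filter_upwards [this] with p hp
  exact hasWeakDeriv_dirKer_mul (sub_pos.2 hp.2) _ _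

theorem IsSource.of_const {T : ℝ} {F : ℝ → ℝ → ℝ} {M : ℝ≥0∞} (hF : IsSource T F fun _ => M) :
    IsSource T F fun τ => M * ENNReal.ofReal (Real.exp (1 * τ)) := by
  refine hF.mono ?_
  filter_upwards [self_mem_ae_restrict measurableSet_Icc] with τ hτ
  refine le_mul_of_one_le_right zero_le ?_
  rw [← ENNReal.ofReal_one]
  exact ENNReal.ofReal_le_ofReal (Real.one_le_exp (by linarith [hτ.1]))

/-- Bochner integrals add only where both integrands are integrable, here for almost every `x`. The
exponential rate `1` used in the proof is arbitrary, since only finiteness matters. -/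
theorem ae_duhamel_add {T t : ℝ} (ht : t ∈ Icc 0 T) {F F' : ℝ → ℝ → ℝ} {M M' : ℝ≥0∞}
    (hM : M < ⊤) (hF : IsSource T F fun _ => M) (hM' : M' < ⊤) (hF' : IsSource T F' fun _ => M') :
    ∀ᵐ x ∂μx, duhamel (fun τ y => F τ y + F' τ y) t x = duhamel F t x + duhamel F' t x := by
  have hadd := hF.add hF'
  filter_upwards [ae_duhamel_eq one_pos ht hM hF.of_const, ae_duhamel_eq one_pos ht hM' hF'.of_const,
    ae_duhamel_eq one_pos ht (ENNReal.add_lt_top.2 ⟨hM, hM'⟩) hadd.of_const] with x h h' h''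
  rw [h.2, h'.2, h''.2, ← integral_add h.1 h'.1]
  simp only [mul_add]

/-! ### The initial datum -/

/-- A smooth function that is `0` on `(-∞, 1]` and `1` on `[2, ∞)`. -/
def smoothStep (y : ℝ) : ℝ := Real.smoothTransition (y - 1)

theorem contDiff_smoothStep : ContDiff ℝ ∞ smoothStep := by
  have := Real.smoothTransition.contDiff (n := (⊤ : ℕ∞))
  unfold smoothStep
  fun_prop

theorem smoothStep_of_le {y : ℝ} (hy : y ≤ 1) : smoothStep y = 0 :=
  Real.smoothTransition.zero_of_nonpos (by linarith)

theorem smoothStep_of_ge {y : ℝ} (hy : 2 ≤ y) : smoothStep y = 1 :=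
  Real.smoothTransition.one_of_one_le (by linarith)

theorem abs_smoothStep_le (y : ℝ) : |smoothStep y| ≤ 1 := by
  rw [smoothStep, abs_of_nonneg (Real.smoothTransition.nonneg _)]
  exact Real.smoothTransition.le_one _

theorem abs_one_sub_smoothStep_le (y : ℝ) : |1 - smoothStep y| ≤ 1 := by
  have h1 : 0 ≤ smoothStep y := Real.smoothTransition.nonneg _
  have h2 : smoothStep y ≤ 1 := Real.smoothTransition.le_one _
  rw [abs_of_nonneg (by linarith)]
  linarith

theorem deriv_smoothStep_of_gt {y : ℝ} (hy : 2 < y) : deriv smoothStep y = 0 := by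
  have : smoothStep =ᶠ[𝓝 y] fun _ => 1 := by
    filter_upwards [lt_mem_nhds hy] with z hz using smoothStep_of_ge hz.le
  rw [this.deriv_eq, deriv_const]

theorem deriv_smoothStep_of_lt {y : ℝ} (hy : y < 1) : deriv smoothStep y = 0 := by
  have : smoothStep =ᶠ[𝓝 y] fun _ => 0 := by
    filter_upwards [gt_mem_nhds hy] with z hz using smoothStep_of_le (le_of_lt hz)
  rw [this.deriv_eq, deriv_const]

theorem continuous_deriv_smoothStep : Continuous (deriv smoothStep) :=
  contDiff_smoothStep.continuous_deriv (by simp)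

theorem exists_abs_deriv_smoothStep_le : ∃ D : ℝ, 0 ≤ D ∧ ∀ y, |deriv smoothStep y| ≤ D := by
  obtain ⟨D, hD⟩ := (HasCompactSupport.intro (isCompact_Icc (a := (1 : ℝ)) (b := 2))
    (f := deriv smoothStep) fun y hy => by
      rw [mem_Icc, not_and_or, not_le, not_le] at hy
      exact hy.elim deriv_smoothStep_of_lt deriv_smoothStep_of_gt).exists_bound_of_continuous
    continuous_deriv_smoothStep
  exact ⟨D, (norm_nonneg _).trans (hD 0), hD⟩

/-- A smooth cutoff function supported in `[1 / n, 2 n]`. -/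
def cutoff (n : ℕ) (y : ℝ) : ℝ := smoothStep (n * y) * (1 - smoothStep (y / n))

theorem hasDerivAt_cutoff (n : ℕ) (y : ℝ) : HasDerivAt (cutoff n)
    (n * deriv smoothStep (n * y) * (1 - smoothStep (y / n))
      - smoothStep (n * y) * (deriv smoothStep (y / n) / n)) y := by
  have hd : ∀ z, HasDerivAt smoothStep (deriv smoothStep z) z := fun z =>
    (contDiff_smoothStep.differentiable (by simp) z).hasDerivAt
  have h1 : HasDerivAt (fun y : ℝ => n * y) n y := by
    simpa using (hasDerivAt_id y).const_mul (n : ℝ)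
  have h2 : HasDerivAt (fun y : ℝ => y / n) (1 / n) y := (hasDerivAt_id y).div_const (n : ℝ)
  refine (((hd _).comp y h1).mul (((hd _).comp y h2).const_sub 1)).congr_deriv ?_
  simp only [Function.comp_apply]
  ring

theorem tsupport_cutoff_subset {n : ℕ} (hn : 0 < n) :
    tsupport (cutoff n) ⊆ Icc (1 / (n : ℝ)) (2 * n) := by
  have hn' : (0 : ℝ) < n := by exact_mod_cast hn
  refine closure_minimal (fun y hy => ?_) isClosed_Icc
  rw [Function.mem_support, cutoff] at hy
  constructor
  · by_contra hcon
    rw [not_le, lt_div_iff₀ hn', mul_comm] at hcon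
    exact hy (by rw [smoothStep_of_le hcon.le, zero_mul])
  · by_contra hcon
    rw [not_le, ← lt_div_iff₀ hn'] at hcon
    exact hy (by rw [smoothStep_of_ge hcon.le, sub_self, mul_zero])

theorem abs_cutoff_le (n : ℕ) (y : ℝ) : |cutoff n y| ≤ 1 := by
  rw [cutoff, abs_mul]
  exact mul_le_one₀ (abs_smoothStep_le _) (abs_nonneg _) (abs_one_sub_smoothStep_le _)

theorem eventually_smoothStep_mul {y : ℝ} (hy : 0 < y) :
    ∀ᶠ n : ℕ in atTop, smoothStep (n * y) = 1 := by
  have := (tendsto_natCast_atTop_atTop (R := ℝ)).atTop_mul_const hy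
  filter_upwards [this.eventually_ge_atTop 2] with n hn using smoothStep_of_ge hn

theorem eventually_div_lt (y : ℝ) : ∀ᶠ n : ℕ in atTop, y / (n : ℝ) < 1 :=
  (tendsto_const_div_atTop_nhds_zero_nat y).eventually_lt_const one_pos

/-- Integration by parts on the half-line for a `W^{1,2}` function with zero trace. -/
theorem HasWeakDeriv.integral_mul_eq_of_hasZeroTrace {z g κ κ' : ℝ → ℝ} (h : HasWeakDeriv z g)
    (h0 : HasZeroTrace z) (hz : MemLp z 2 μx) (hg : MemLp g 2 μx) (hκ : ContDiff ℝ ∞ κ)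
    (hκ' : ∀ y, HasDerivAt κ (κ' y) y) (mκ : MemLp κ 2 μx) (mκ' : MemLp κ' 2 μx) :
    ∫ y, z y * κ' y ∂μx = -∫ y, g y * κ y ∂μx := by
  obtain ⟨f₀, hf₀, cf₀, f₀0⟩ := h0
  obtain ⟨D, hD0, hD⟩ := exists_abs_deriv_smoothStep_le
  have cs := contDiff_smoothStep.continuous
  have cd := continuous_deriv_smoothStep
  have cκ := hκ.continuous
  have pos : ∀ᵐ y ∂μx, 0 < y := self_mem_ae_restrict measurableSet_Ioi
  have i1 : Integrable (fun y => z y * κ' y) μx := hz.integrable_mul mκ'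
  have i2 : Integrable (fun y => z y * κ y) μx := hz.integrable_mul mκ
  have i3 : Integrable (fun y => g y * κ y) μx := hg.integrable_mul mκ
  have cc : ∀ n, Continuous (cutoff n) := fun n => by unfold cutoff; fun_prop
  have lim : ∀ F : ℝ → ℝ, Integrable F μx →
      Tendsto (fun n : ℕ => ∫ y, F y * cutoff n y ∂μx) atTop (𝓝 (∫ y, F y ∂μx)) := by
    intro F hF
    refine tendsto_integral_of_dominated_convergence (fun y => |F y|)
      (fun n => hF.1.mul (cc n).aestronglyMeasurable) hF.abs
      (fun n => ae_of_all _ fun y => ?_) (pos.mono fun y hy => ?_)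
    · rw [Real.norm_eq_abs, abs_mul]
      exact mul_le_of_le_one_right (abs_nonneg _) (abs_cutoff_le n y)
    · refine tendsto_const_nhds.congr' ?_
      filter_upwards [eventually_smoothStep_mul hy, eventually_div_lt y] with n h1 h2
      rw [cutoff, h1, smoothStep_of_le h2.le]
      ring
  -- The derivative of the outer cutoff is bounded by `D / n` and vanishes at a fixed `y` once `y /
  -- n < 1`.
  have lim2 : Tendsto (fun n : ℕ => ∫ y, z y * κ y * (smoothStep (n * y)
      * (deriv smoothStep (y / n) / n)) ∂μx) atTop (𝓝 0) := by
    rw [show (0 : ℝ) = ∫ y, (0 : ℝ) ∂μx by simp]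
    refine tendsto_integral_of_dominated_convergence (fun y => |z y * κ y| * D)
      (fun n => i2.1.mul (by fun_prop : Continuous _).aestronglyMeasurable) (i2.abs.mul_const D)
      (fun n => ae_of_all _ fun y => ?_) (ae_of_all _ fun y => ?_)
    · rw [Real.norm_eq_abs, abs_mul]
      refine mul_le_mul_of_nonneg_left ?_ (abs_nonneg _)
      rw [abs_mul, abs_div, Nat.abs_cast]
      have a : |deriv smoothStep (y / n)| / n ≤ D := by
        rcases Nat.eq_zero_or_pos n with rfl | hn
        · simpa using hD0
        · exact (div_le_self (abs_nonneg _) (by exact_mod_cast hn)).trans (hD _)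
      calc _ ≤ 1 * D := mul_le_mul (abs_smoothStep_le _) a (by positivity) zero_le_one
        _ = D := one_mul D
    · refine tendsto_const_nhds.congr' ?_
      filter_upwards [eventually_div_lt y] with n h2
      rw [deriv_smoothStep_of_lt h2]
      simp
  -- The derivative of the inner cutoff has size `n` on `[1/n, 2/n]`. Rescaling `y` to `y / n`
  -- absorbs the factor `n`, and the integrand then tends to `0` because `f₀` is continuous with `f₀
  -- 0 = 0`. This is where the zero trace is used.
  have lim3 : Tendsto (fun n : ℕ => ∫ y, f₀ y * κ y * (n * deriv smoothStep (n * y)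
      * (1 - smoothStep (y / n))) ∂μx) atTop (𝓝 0) := by
    have cf : ContinuousOn (fun y => f₀ y * κ y) (Icc 0 2) :=
      (cf₀.mono Icc_subset_Ici_self).mul cκ.continuousOn
    obtain ⟨B, hB⟩ := isCompact_Icc.exists_bound_of_continuousOn cf
    have hB0 : 0 ≤ B := (norm_nonneg _).trans (hB 0 ⟨le_rfl, zero_le_two⟩)
    have e : ∀ᶠ n : ℕ in atTop, ∫ y in Ioi 0, f₀ (y / n) * κ (y / n)
          * (deriv smoothStep y * (1 - smoothStep (y / n / n)))
        = ∫ y, f₀ y * κ y * (n * deriv smoothStep (n * y) * (1 - smoothStep (y / n))) ∂μx := by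
      filter_upwards [eventually_gt_atTop 0] with n hn
      have hn' : (0 : ℝ) < n := by exact_mod_cast hn
      have := integral_comp_mul_left_Ioi (fun y => f₀ (y / n) * κ (y / n)
          * (deriv smoothStep y * (1 - smoothStep (y / n / n)))) 0 hn'
      rw [mul_zero, smul_eq_mul, eq_inv_mul_iff_mul_eq₀ hn'.ne', ← integral_const_mul] at this
      rw [← this, μx]
      refine integral_congr_ae (ae_of_all _ fun y => ?_)
      simp only [mul_div_cancel_left₀ y hn'.ne']
      ring
    refine Tendsto.congr' e ?_
    have e0 : 𝓝 (0 : ℝ) = 𝓝 (∫ y in Ioi (0 : ℝ), (0 : ℝ)) := by simp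
    rw [e0]
    apply tendsto_integral_filter_of_dominated_convergence
      ((Ioc (0 : ℝ) 2).indicator fun _ => B * D)
    · filter_upwards with n
      refine ContinuousOn.aestronglyMeasurable ?_ measurableSet_Ioi
      have : ContinuousOn (fun y : ℝ => f₀ (y / n)) (Ioi 0) :=
        cf₀.comp (by fun_prop) fun y (hy : 0 < y) => show (0 : ℝ) ≤ y / n by positivity
      exact (this.mul (by fun_prop)).mul (by fun_prop)
    · filter_upwards [eventually_gt_atTop 0] with n hn
      have hn' : (1 : ℝ) ≤ n := by exact_mod_cast hn
      filter_upwards [self_mem_ae_restrict measurableSet_Ioi] with y hy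
      by_cases hy2 : y ≤ 2
      · rw [indicator_of_mem (show y ∈ Ioc 0 2 from ⟨hy, hy2⟩), norm_mul]
        have hy0 : 0 ≤ y := le_of_lt hy
        refine mul_le_mul (hB _ ⟨by positivity, (div_le_self hy0 hn').trans hy2⟩) ?_ (by positivity)
          hB0
        rw [norm_mul]
        calc _ ≤ D * 1 := mul_le_mul (hD _) (abs_one_sub_smoothStep_le _) (abs_nonneg _) hD0
          _ = D := mul_one D
      · rw [deriv_smoothStep_of_gt (not_le.1 hy2)]
        simp only [zero_mul, mul_zero, norm_zero]
        exact indicator_nonneg (fun _ _ => mul_nonneg hB0 hD0) y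
    · refine Integrable.mono_measure ?_ Measure.restrict_le_self
      exact (integrable_indicator_iff measurableSet_Ioc).2 (integrableOn_const (by simp) (by finiteness))
    · filter_upwards [self_mem_ae_restrict measurableSet_Ioi] with y hy
      have hy0 : 0 ≤ y := le_of_lt hy
      have t0 : Tendsto (fun n : ℕ => y / (n : ℝ)) atTop (𝓝[Ici 0] 0) :=
        tendsto_nhdsWithin_iff.2 ⟨tendsto_const_div_atTop_nhds_zero_nat y,
          Eventually.of_forall fun n => show (0 : ℝ) ≤ y / n by positivity⟩
      have t1 : Tendsto (fun n : ℕ => f₀ (y / n) * κ (y / n)) atTop (𝓝 0) := by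
        have := ((cf₀ 0 self_mem_Ici).tendsto.comp t0).mul
          ((cκ.continuousWithinAt (s := Ici 0) (x := 0)).tendsto.comp t0)
        simpa [f₀0] using this
      have t2 : ∀ᶠ n : ℕ in atTop, f₀ (y / n) * κ (y / n) * deriv smoothStep y
          = f₀ (y / n) * κ (y / n) * (deriv smoothStep y * (1 - smoothStep (y / n / n))) := by
        filter_upwards [eventually_div_lt y, eventually_gt_atTop 0] with n h1 hn
        have hn' : (1 : ℝ) ≤ n := by exact_mod_cast hn
        have h3 : y / n / n ≤ 1 := (div_le_self (by positivity) hn').trans h1.le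
        rw [smoothStep_of_le h3, sub_zero, mul_one]
      refine Tendsto.congr' t2 ?_
      simpa using t1.mul_const (deriv smoothStep y)
  -- The definition of weak derivative, tested with `κ * cutoff n`; the limit `n → ∞` of this
  -- identity is the claim.
  have key : ∀ᶠ n : ℕ in atTop, ∫ y, z y * κ' y * cutoff n y ∂μx
      + ∫ y, f₀ y * κ y * (n * deriv smoothStep (n * y) * (1 - smoothStep (y / n))) ∂μx
      - ∫ y, z y * κ y * (smoothStep (n * y) * (deriv smoothStep (y / n) / n)) ∂μx
      = -∫ y, g y * κ y * cutoff n y ∂μx := by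
    filter_upwards [eventually_gt_atTop 0] with n hn
    have hn' : (0 : ℝ) < n := by exact_mod_cast hn
    have sc := contDiff_smoothStep
    have t1 : tsupport (fun y => κ y * cutoff n y) ⊆ Icc (1 / (n : ℝ)) (2 * n) :=
      (tsupport_mul_subset_right).trans (tsupport_cutoff_subset hn)
    have t2 : HasCompactSupport (fun y => κ y * cutoff n y) :=
      isCompact_Icc.of_isClosed_subset (isClosed_tsupport _) t1
    have t3 : ContDiff ℝ ∞ (fun y => κ y * cutoff n y) := by
      unfold cutoff; fun_prop
    have w := h.3 (fun y => κ y * cutoff n y) t3 t2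
      (t1.trans fun y hy => lt_of_lt_of_le (by positivity) hy.1)
    have bdd : ∀ {F G : ℝ → ℝ} (c : ℝ), Integrable F μx → Continuous G → (∀ y, |G y| ≤ c) →
        Integrable (fun y => F y * G y) μx := fun c hF hG hc =>
      hF.mul_bdd hG.aestronglyMeasurable (ae_of_all _ hc)
    have j1 : Integrable (fun y => z y * κ' y * cutoff n y) μx :=
      bdd 1 i1 (cc n) (abs_cutoff_le n)
    have j2 : Integrable (fun y => z y * κ y * (n * deriv smoothStep (n * y)
        * (1 - smoothStep (y / n)))) μx := by
      refine bdd (n * D * 1) i2 (by fun_prop) fun y => ?_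
      rw [abs_mul, abs_mul, Nat.abs_cast]
      gcongr
      · exact hD _
      · exact abs_one_sub_smoothStep_le _
    have j3 : Integrable (fun y => z y * κ y * (smoothStep (n * y)
        * (deriv smoothStep (y / n) / n))) μx := by
      refine bdd (1 * (D / n)) i2 (by fun_prop) fun y => ?_
      rw [abs_mul, abs_div, Nat.abs_cast]
      gcongr
      · exact abs_smoothStep_le _
      · exact hD _
    have j12 : Integrable (fun y => z y * κ' y * cutoff n y + z y * κ y * (n * deriv smoothStep (n * y)
        * (1 - smoothStep (y / n)))) μx := j1.add j2
    have e2 : ∫ y, f₀ y * κ y * (n * deriv smoothStep (n * y) * (1 - smoothStep (y / n))) ∂μx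
        = ∫ y, z y * κ y * (n * deriv smoothStep (n * y) * (1 - smoothStep (y / n))) ∂μx :=
      integral_congr_ae (hf₀.mono fun y hy => by simp only [hy])
    rw [e2, ← integral_add j1 j2, ← integral_sub j12 j3]
    simp_rw [mul_assoc (g _)]
    rw [← show μx = volume.restrict (Ioi 0) from rfl] at w
    rw [← w]
    refine integral_congr_ae (ae_of_all _ fun y => ?_)
    have := ((hκ' y).mul (hasDerivAt_cutoff n y)).deriv
    simp only
    rw [show deriv (fun y => κ y * cutoff n y) y = deriv (κ * cutoff n) y from rfl, this]
    ring
  have L := ((lim _ i1).add lim3).sub lim2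
  have R := (lim _ i3).neg
  rw [add_zero, sub_zero] at L
  exact tendsto_nhds_unique (L.congr' key) R

theorem memLp_two_of_abs_le_gaussSum {s a : ℝ} (hs : 0 < s) {k : ℝ → ℝ} (x : ℝ)
    (hkc : Continuous k) (ha : 0 ≤ a) (hk : ∀ y, |k y| ≤ a * gaussSum s x y) : MemLp k 2 μx := by
  refine ⟨hkc.aestronglyMeasurable, ?_⟩
  have h1 : MemLp (fun y => gaussSum s x y) 2 μx := by
    refine ⟨((measurable_gaussSum s).comp measurable_prodMk_left).aestronglyMeasurable, ?_⟩
    refine lt_of_le_of_lt ?_ ((eLpNorm_gaussSum_le hs x).trans_lt ENNReal.ofReal_lt_top)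
    refine eLpNorm_mono_enorm fun y => ?_
    rw [gaussSum_comm, Real.enorm_of_nonneg (gaussSum_nonneg _ _ _), enorm_eq_self]
  refine ((h1.const_mul a).eLpNorm_lt_top).trans_le' (eLpNorm_mono fun y => ?_)
  rw [Real.norm_eq_abs, Real.norm_eq_abs, abs_of_nonneg (mul_nonneg ha (gaussSum_nonneg _ _ _))]
  exact hk y

/-- Differentiating the kernel directly would give a bound of order `t^(-1/2)`. Since `z` has zero
trace, the derivative equals the Neumann kernel applied to `g = z'`, and the Neumann kernel is
bounded on `L²` uniformly in time. The constant `12` is Schur's `(1/√t) * 12√t`. -/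
theorem W12Bound.dirichletConv {t : ℝ} (ht : 0 ≤ t) {z : ℝ → ℝ} {N : ℝ≥0∞} (hN : N < ⊤)
    (hz : W12Bound z N) (h0 : HasZeroTrace z) : W12Bound (dirichletConv t z) (12 * N) := by
  rcases ht.eq_or_lt with rfl | ht
  · have : HalfLine.dirichletConv 0 z = z := by ext x; simp [HalfLine.dirichletConv]
    rw [this]
    exact hz.mono (le_mul_of_one_le_left zero_le (by norm_num))
  obtain ⟨g, hg, nz, ng⟩ := hz
  have hst := Real.sqrt_pos.2 ht
  have mz := hg.aestronglyMeasurable_fun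
  have mg := hg.aestronglyMeasurable_deriv
  have lz : MemLp z 2 μx := ⟨mz, nz.trans_lt hN⟩
  have lg : MemLp g 2 μx := ⟨mg, ng.trans_lt hN⟩
  have b1 := eLpNorm_kernel_le_of_two ht (by positivity) (abs_dirKer_le ht) mz
  -- This bound blows up as `t → 0`; it serves only as the finiteness condition in
  -- `HasWeakDeriv.integral`.
  have b2 := eLpNorm_kernel_le_of_two ht (by positivity) (abs_dirKerDx_le ht) mz
  have b3 := eLpNorm_kernel_le_of_two ht (by positivity) (abs_neuKer_le ht) mg
  have c12 : ENNReal.ofReal (1 / √t * (12 * √t)) = 12 := by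
    rw [show 1 / √t * (12 * √t) = 12 by field_simp]; norm_num
  rw [c12] at b1 b3
  have hm : ∀ {k : ℝ → ℝ → ℝ → ℝ}, (Measurable fun q : (ℝ × ℝ) × ℝ => k q.1.1 q.1.2 q.2) →
      AEStronglyMeasurable (Function.uncurry fun y x => k t x y * z y) (μx.prod μx) := fun hk => by
    refine AEStronglyMeasurable.mul ?_
      (mz.comp_quasiMeasurePreserving Measure.quasiMeasurePreserving_fst)
    exact (hk.comp (f := fun q : ℝ × ℝ => ((t, q.2), q.1)) (by fun_prop)).aestronglyMeasurable
  have hw := HasWeakDeriv.integral (hm measurable_dirKer) (hm measurable_dirKerDx)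
    (ae_of_all _ fun y => hasWeakDeriv_dirKer_mul ht y (z y))
    (b1.trans_lt (ENNReal.mul_lt_top (by simp) lz.2))
    (b2.trans_lt (ENNReal.mul_lt_top ENNReal.ofReal_lt_top lz.2))
  have e1 : HalfLine.dirichletConv t z = fun x => ∫ y, dirKer t x y * z y ∂μx := by
    ext x
    simp only [HalfLine.dirichletConv, ht, if_true]
    rfl
  have e2 : ∀ x, ∫ y, dirKerDx t x y * z y ∂μx = ∫ y, neuKer t x y * g y ∂μx := fun x => by
    have c1 := continuous_heatDx t
    have c2 := continuous_heatKernel t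
    have hib := hg.integral_mul_eq_of_hasZeroTrace h0 lz lg (κ := neuKer t x)
      (by unfold neuKer heatKernel; fun_prop) (hasDerivAt_neuKer ht x)
      (memLp_two_of_abs_le_gaussSum ht x (by unfold neuKer; fun_prop) (by positivity)
        (abs_neuKer_le ht x))
      (memLp_two_of_abs_le_gaussSum (a := 1 / t) ht x (by unfold dirKerDx; fun_prop) (by positivity)
        (fun y => by rw [abs_neg]; exact abs_dirKerDx_le ht x y))
    simp_rw [mul_neg, integral_neg, neg_inj] at hib
    simp_rw [mul_comm _ (z _), mul_comm _ (g _)]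
    exact hib
  rw [e1]
  refine ⟨_, hw, ?_, ?_⟩
  · exact (l2Norm_integral_le _).trans (b1.trans (by gcongr; exact nz))
  · simp_rw [e2]
    exact (l2Norm_integral_le (fun y x => neuKer t x y * g y)).trans (b3.trans (by gcongr; exact ng))

/-! ### The heat solution with boundary datum `ψ` -/

/-- From `exp v ≥ v²/2` with `v = c²/(8s)`. Away from the boundary the factor `s²` beats the
singularities of the kernel and its derivatives at `s = 0`, so `heatSol` can be differentiated
classically for `x > 0`. -/
theorem gauss_le_of_le {s c y : ℝ} (hs : 0 < s) (hc : 0 < c) (hy : c ≤ y) :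
    gauss s y ≤ 128 * s ^ 2 / c ^ 4 := by
  have hv : 0 < c ^ 2 / (8 * s) := by positivity
  have h1 : gauss s y ≤ Real.exp (-(c ^ 2 / (8 * s))) := by
    rw [gauss, neg_div]
    refine Real.exp_le_exp.2 (neg_le_neg ?_)
    gcongr
  refine h1.trans ?_
  rw [Real.exp_neg, inv_le_comm₀ (Real.exp_pos _) (by positivity)]
  refine le_trans (le_of_eq ?_) ((by nlinarith : (c ^ 2 / (8 * s)) ^ 2 / 2 ≤ _).trans
    (Real.quadratic_le_exp_of_nonneg hv.le))
  field_simp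
  norm_num

theorem abs_heatDx_le_of_le {s c y : ℝ} (hs : 0 < s) (hc : 0 < c) (hy : c ≤ y) :
    |heatDx s y| ≤ 128 * s / c ^ 4 := by
  refine (abs_heatDx_le hs y).trans ?_
  calc 1 / s * gauss s y ≤ 1 / s * (128 * s ^ 2 / c ^ 4) := by
        gcongr; exact gauss_le_of_le hs hc hy
    _ = _ := by field_simp

theorem abs_heatDxx_le_of_le {s c y : ℝ} (hs : 0 < s) (hc : 0 < c) (hy : c ≤ y) :
    |heatDxx s y| ≤ 256 * √s / c ^ 4 := by
  have h := Real.sqrt_pos.2 hs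
  refine (abs_heatDxx_le hs y).trans ?_
  calc 2 / (s * √s) * gauss s y ≤ 2 / (s * √s) * (128 * s ^ 2 / c ^ 4) := by
        gcongr; exact gauss_le_of_le hs hc hy
    _ = 2 / (√s * √s * √s) * (128 * (√s * √s) ^ 2 / c ^ 4) := by rw [Real.mul_self_sqrt hs.le]
    _ = _ := by field_simp; ring

theorem heatKernel_le_of_le {s c y : ℝ} (hs : 0 < s) (hc : 0 < c) (hy : c ≤ y) :
    heatKernel s y ≤ 128 / c ^ 4 * (s * √s) := by
  have h := Real.sqrt_pos.2 hs
  refine (heatKernel_le hs y).trans ?_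
  calc 1 / √s * gauss s y ≤ 1 / √s * (128 * s ^ 2 / c ^ 4) := by
        gcongr; exact gauss_le_of_le hs hc hy
    _ = 1 / √s * (128 * (s * (√s * √s)) / c ^ 4) := by rw [Real.mul_self_sqrt hs.le, sq]
    _ = _ := by field_simp

theorem heatSol_eq {ψ : ℝ → ℝ} {t : ℝ} (ht : 0 ≤ t) (x : ℝ) :
    heatSol ψ t x = ∫ s in Ioo 0 t, -2 * heatDx s x * ψ (t - s) := by
  have h := intervalIntegral.integral_comp_sub_left (a := 0) (b := t)
    (fun s => deriv (heatKernel s) x * ψ (t - s)) t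
  simp only [sub_sub_cancel, sub_self, sub_zero] at h
  rw [heatSol, h, intervalIntegral.integral_of_le ht, integral_Ioc_eq_integral_Ioo,
    ← integral_const_mul]
  refine setIntegral_congr_fun measurableSet_Ioo fun s hs => ?_
  simp only [(hasDerivAt_heatKernel hs.1 x).deriv]
  ring

/-- The spatial derivative of `heatSol ψ`. -/
def heatSolDx (ψ : ℝ → ℝ) (t x : ℝ) : ℝ := ∫ s in Ioo 0 t, -2 * heatDxx s x * ψ (t - s)

theorem exists_bound_comp_sub {ψ : ℝ → ℝ} (hψ : Continuous ψ) (t : ℝ) :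
    ∃ B, 0 ≤ B ∧ ∀ s ∈ Ioo 0 t, |ψ (t - s)| ≤ B := by
  obtain ⟨B, hB⟩ := (isCompact_Icc (a := 0) (b := t)).exists_bound_of_continuousOn hψ.continuousOn
  refine ⟨max B 0, le_max_right _ _, fun s hs => le_max_of_le_left ?_⟩
  exact hB _ ⟨by linarith [hs.2], by linarith [hs.1]⟩

theorem integrable_heatDx_mul {ψ : ℝ → ℝ} (hψ : Continuous ψ) (t : ℝ) {x : ℝ} (hx : 0 < x) :
    Integrable (fun s => -2 * heatDx s x * ψ (t - s)) (volume.restrict (Ioo 0 t)) := by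
  obtain ⟨B, hB0, hB⟩ := exists_bound_comp_sub hψ t
  have m := measurable_heatDx
  refine Integrable.of_bound (C := 2 * (128 * t / x ^ 4) * B) (Measurable.aestronglyMeasurable ?_) ?_
  · exact ((m.comp (f := fun s : ℝ => (s, x)) (by fun_prop)).const_mul _).mul
      (hψ.measurable.comp (by fun_prop))
  · filter_upwards [self_mem_ae_restrict measurableSet_Ioo] with s hs
    rw [Real.norm_eq_abs, abs_mul, abs_mul, show |(-2 : ℝ)| = 2 by norm_num]
    have h0 : 0 < t := hs.1.trans hs.2
    have h1 : |heatDx s x| ≤ 128 * t / x ^ 4 :=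
      (abs_heatDx_le_of_le hs.1 hx le_rfl).trans (by gcongr; exact hs.2.le)
    have h2 := hB s hs
    gcongr

theorem abs_heatDxx_mul_le {ψ : ℝ → ℝ} {t B c y s : ℝ} (hB : ∀ s ∈ Ioo 0 t, |ψ (t - s)| ≤ B)
    (hs : s ∈ Ioo 0 t) (hc : 0 < c) (hy : c ≤ y) :
    ‖-2 * heatDxx s y * ψ (t - s)‖ ≤ 2 * (256 * √t / c ^ 4) * B := by
  rw [Real.norm_eq_abs, abs_mul, abs_mul, show |(-2 : ℝ)| = 2 by norm_num]
  have h1 : |heatDxx s y| ≤ 256 * √t / c ^ 4 :=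
    (abs_heatDxx_le_of_le hs.1 hc hy).trans (by gcongr; exact hs.2.le)
  have h2 := hB s hs
  gcongr

theorem measurable_heatDxx_mul {ψ : ℝ → ℝ} (hψ : Continuous ψ) (t x : ℝ) :
    Measurable (fun s => -2 * heatDxx s x * ψ (t - s)) :=
  ((measurable_heatDxx.comp (f := fun s : ℝ => (s, x)) (by fun_prop)).const_mul _).mul
    (hψ.measurable.comp (by fun_prop))

theorem integrable_heatDxx_mul {ψ : ℝ → ℝ} (hψ : Continuous ψ) (t : ℝ) {x : ℝ} (hx : 0 < x) :
    Integrable (fun s => -2 * heatDxx s x * ψ (t - s)) (volume.restrict (Ioo 0 t)) := by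
  obtain ⟨B, hB0, hB⟩ := exists_bound_comp_sub hψ t
  refine Integrable.of_bound (C := 2 * (256 * √t / x ^ 4) * B)
    (measurable_heatDxx_mul hψ t x).aestronglyMeasurable ?_
  filter_upwards [self_mem_ae_restrict measurableSet_Ioo] with s hs
  exact abs_heatDxx_mul_le hB hs hx le_rfl

theorem hasDerivAt_heatSol {ψ : ℝ → ℝ} (hψ : Continuous ψ) {t : ℝ} (ht : 0 ≤ t) {x : ℝ}
    (hx : 0 < x) : HasDerivAt (heatSol ψ t) (heatSolDx ψ t x) x := by
  obtain ⟨B, hB0, hB⟩ := exists_bound_comp_sub hψ t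
  have e : heatSol ψ t = fun x => ∫ s in Ioo 0 t, -2 * heatDx s x * ψ (t - s) :=
    funext fun x => heatSol_eq ht x
  rw [e]
  -- On `(x/2, ∞)` the kernel bounds are uniform, which gives a constant dominating function.
  refine (hasDerivAt_integral_of_dominated_loc_of_deriv_le (s := Ioi (x / 2))
    (F' := fun x s => -2 * heatDxx s x * ψ (t - s))
    (bound := fun _ => 2 * (256 * √t / (x / 2) ^ 4) * B) (Ioi_mem_nhds (by linarith))
    (Filter.eventually_of_mem (Ioi_mem_nhds hx) fun y hy => (integrable_heatDx_mul hψ t hy).1)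
    (integrable_heatDx_mul hψ t hx) (measurable_heatDxx_mul hψ t x).aestronglyMeasurable
    ?_ (integrable_const _) ?_).2
  · filter_upwards [self_mem_ae_restrict measurableSet_Ioo] with s hs y hy
    exact abs_heatDxx_mul_le hB hs (by linarith) (le_of_lt hy)
  · filter_upwards [self_mem_ae_restrict measurableSet_Ioo] with s hs y hy
    exact ((hasDerivAt_heatDx hs.1 y).const_mul (-2)).mul_const _

theorem continuousOn_heatSolDx {ψ : ℝ → ℝ} (hψ : Continuous ψ) (t : ℝ) :
    ContinuousOn (heatSolDx ψ t) (Ioi 0) := by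
  obtain ⟨B, hB0, hB⟩ := exists_bound_comp_sub hψ t
  intro x hx
  have hx : 0 < x := hx
  refine ContinuousAt.continuousWithinAt ?_
  refine continuousAt_of_dominated (bound := fun _ => 2 * (256 * √t / (x / 2) ^ 4) * B)
    (Eventually.of_forall fun y => (measurable_heatDxx_mul hψ t y).aestronglyMeasurable) ?_
    (integrable_const _) (ae_of_all _ fun s => ?_)
  · filter_upwards [Ioi_mem_nhds (show x / 2 < x by linarith)] with y hy
    filter_upwards [self_mem_ae_restrict measurableSet_Ioo] with s hs
    exact abs_heatDxx_mul_le hB hs (by linarith) (le_of_lt hy)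
  · have := continuous_heatDxx s
    fun_prop

theorem hasWeakDeriv_heatSol {ψ : ℝ → ℝ} (hψ : Continuous ψ) {t : ℝ} (ht : 0 ≤ t) :
    HasWeakDeriv (heatSol ψ t) (heatSolDx ψ t) :=
  .of_hasDerivAt (fun _ hx => hasDerivAt_heatSol hψ ht hx) (continuousOn_heatSolDx hψ t)

/-- The heat equation `∂ₛG = ∂ₓ²G` and the fundamental theorem of calculus in time; for `x > 0` the
kernel tends to `0` as `s → 0`. -/
theorem integral_heatDxx {t x : ℝ} (ht : 0 ≤ t) (hx : 0 < x) :
    ∫ s in Ioo 0 t, heatDxx s x = heatKernel t x := by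
  -- The constant datum `-1/2` cancels the factor `-2`.
  have hi := integrable_heatDxx_mul (ψ := fun _ => -1 / 2) continuous_const t hx
  have hi' : IntegrableOn (fun s => heatDxx s x) (Ioo 0 t) :=
    hi.congr (ae_of_all _ fun s => by simp only; ring)
  -- Division by zero gives the kernel the value `0` at time `0`, which agrees with its limit for `x
  -- > 0`; continuity on the closed time interval follows.
  have h0 : heatKernel 0 x = 0 := by simp [heatKernel]
  rw [← integral_Ioc_eq_integral_Ioo, ← intervalIntegral.integral_of_le ht,
    intervalIntegral.integral_eq_sub_of_hasDerivAt_of_le ht (f := fun s => heatKernel s x) ?_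
      (fun s hs => hasDerivAt_heatKernel_time hs.1 x)
      ((intervalIntegrable_iff_integrableOn_Ioo_of_le ht).2 hi'), h0, sub_zero]
  intro s hs
  rcases hs.1.eq_or_lt with rfl | hs0
  · have hlim : Tendsto (fun s : ℝ => 128 / x ^ 4 * (s * √s)) (𝓝[Icc 0 t] 0) (𝓝 0) := by
      have : Continuous fun s : ℝ => 128 / x ^ 4 * (s * √s) := by fun_prop
      simpa using (this.tendsto 0).mono_left nhdsWithin_le_nhds
    rw [ContinuousWithinAt, h0]
    refine tendsto_of_tendsto_of_tendsto_of_le_of_le' tendsto_const_nhds hlim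
      (Eventually.of_forall fun s => heatKernel_nonneg s x) ?_
    filter_upwards [self_mem_nhdsWithin] with s hs
    rcases hs.1.eq_or_lt with rfl | hs0
    · simp [h0]
    · exact heatKernel_le_of_le hs0 hx le_rfl
  · exact (hasDerivAt_heatKernel_time hs0 x).continuousAt.continuousWithinAt

/-- The kernel `∂ₓ²G` alone would contribute `s^(-5/4)` in `L²`. The increment of `ψ` makes the
first term integrable, and the frozen value `ψ t` is integrated exactly by `integral_heatDxx`. -/
theorem heatSolDx_eq {ψ : ℝ → ℝ} (hψ : Continuous ψ) {t x : ℝ} (ht : 0 ≤ t) (hx : 0 < x) :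
    heatSolDx ψ t x = (∫ s in Ioo 0 t, -2 * heatDxx s x * (ψ (t - s) - ψ t))
      + -2 * ψ t * heatKernel t x := by
  have hi := integrable_heatDxx_mul hψ t hx
  have hi' := integrable_heatDxx_mul (ψ := fun _ => ψ t) continuous_const t hx
  rw [← integral_heatDxx ht hx, ← integral_const_mul, heatSolDx,
    ← sub_eq_iff_eq_add]
  have e : ∀ s, -2 * ψ t * heatDxx s x = -2 * heatDxx s x * ψ t := fun s => by ring
  simp_rw [e]
  rw [← integral_sub hi hi']
  simp_rw [mul_sub]

theorem lintegral_rpow_le {t q : ℝ} (ht : 0 ≤ t) (hq : -1 < q) :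
    ∫⁻ s in Ioo 0 t, ENNReal.ofReal (s ^ q) = ENNReal.ofReal (t ^ (q + 1) / (q + 1)) := by
  have hi := intervalIntegral.intervalIntegrable_rpow' (a := 0) (b := t) hq
  rw [intervalIntegrable_iff_integrableOn_Ioo_of_le ht] at hi
  rw [← ofReal_integral_eq_lintegral_ofReal hi, ← integral_Ioc_eq_integral_Ioo,
    ← intervalIntegral.integral_of_le ht, integral_rpow (Or.inl hq),
    Real.zero_rpow (by linarith), sub_zero]
  filter_upwards [self_mem_ae_restrict measurableSet_Ioo] with s hs
  exact Real.rpow_nonneg hs.1.le q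

theorem eLpNorm_le_of_abs_le_gauss {s a : ℝ} (hs : 0 < s) (ha : 0 ≤ a) {k : ℝ → ℝ}
    (hk : ∀ x, |k x| ≤ a * gauss s x) :
    eLpNorm k 2 μx ≤ ENNReal.ofReal (a * (2 * s ^ (1 / 4 : ℝ))) := by
  calc eLpNorm k 2 μx ≤ eLpNorm k 2 volume := eLpNorm_mono_measure _ Measure.restrict_le_self
    _ ≤ eLpNorm (fun x => a * gauss s x) 2 volume := by
        refine eLpNorm_mono fun x => ?_
        rw [Real.norm_eq_abs, Real.norm_eq_abs, abs_of_nonneg (mul_nonneg ha (gauss_nonneg _ _))]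
        exact hk x
    _ = ENNReal.ofReal a * eLpNorm (fun x => ENNReal.ofReal (gauss s x)) 2 volume := by
        rw [show (fun x => a * gauss s x) = a • gauss s from rfl, eLpNorm_const_smul,
          Real.enorm_of_nonneg ha]
        congr 1
        refine eLpNorm_congr_enorm_ae (ae_of_all _ fun x => ?_)
        rw [Real.enorm_of_nonneg (gauss_nonneg _ _), enorm_eq_self]
    _ ≤ ENNReal.ofReal a * ENNReal.ofReal (2 * s ^ (1 / 4 : ℝ)) := by
        gcongr; exact eLpNorm_gauss_le hs
    _ = _ := by rw [← ENNReal.ofReal_mul ha]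

/-- By Minkowski the time integrand is of order `s^p * s^(1/4)`, integrable at `0` precisely when `p
> -5/4`. -/
theorem l2Norm_setIntegral_le {T t A p : ℝ} (ht : t ∈ Icc 0 T) (hA : 0 ≤ A) (hp : -(5 / 4) < p)
    {f : ℝ → ℝ → ℝ} (hf : Measurable (Function.uncurry f))
    (hb : ∀ s ∈ Ioo 0 t, ∀ x, |f s x| ≤ A * s ^ p * gauss s x) :
    L2Norm (fun x => ∫ s in Ioo 0 t, f s x)
      ≤ ENNReal.ofReal (2 * A * (T ^ (p + 5 / 4) / (p + 5 / 4))) := by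
  refine (l2Norm_integral_le f).trans ((eLpNorm_two_lintegral_le ?_).trans ?_)
  · exact hf.enorm.aemeasurable
  calc ∫⁻ s in Ioo 0 t, eLpNorm (fun x => ‖f s x‖ₑ) 2 μx
      ≤ ∫⁻ s in Ioo 0 t, ENNReal.ofReal (2 * A) * ENNReal.ofReal (s ^ (p + 1 / 4)) := by
        refine setLIntegral_mono' measurableSet_Ioo fun s hs => ?_
        have hsp := Real.rpow_nonneg hs.1.le p
        rw [eLpNorm_enorm, ← ENNReal.ofReal_mul (by positivity)]
        refine (eLpNorm_le_of_abs_le_gauss hs.1 (mul_nonneg hA hsp) (hb s hs)).trans (le_of_eq ?_)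
        rw [Real.rpow_add hs.1]
        congr 1
        ring
    _ = ENNReal.ofReal (2 * A) * ENNReal.ofReal (t ^ (p + 5 / 4) / (p + 5 / 4)) := by
        rw [lintegral_const_mul' _ _ ENNReal.ofReal_ne_top, lintegral_rpow_le ht.1 (by linarith)]
        ring_nf
    _ ≤ _ := by
        rw [← ENNReal.ofReal_mul (by positivity)]
        refine ENNReal.ofReal_le_ofReal ?_
        have : 0 < p + 5 / 4 := by linarith
        gcongr
        · exact ht.1
        · exact ht.2

/-- The constant in the estimate of the heat solution. -/
def heatSolConst (T β : ℝ) : ℝ :=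
  16 * T ^ (1 / 4 : ℝ) + 8 * (T ^ (β - 1 / 4) / (β - 1 / 4)) + 4 * T ^ (β - 1 / 4)

theorem heatSolConst_pos {T β : ℝ} (hT : 0 < T) (hβ : 1 / 4 < β) : 0 < heatSolConst T β := by
  have : 0 < β - 1 / 4 := by linarith
  unfold heatSolConst; positivity

/-- The three terms of `heatSolConst` come from `ũ` (`p = -1`), from the Hölder increment in `∂ₓũ`
(`p = β - 3/2`), and from the boundary term `-2 ψ(t) G(t, ·)`. -/
theorem l2Norm_heatSol_le {T β N : ℝ} (hT : 0 < T) (hβ : 1 / 4 < β) (hN : 0 ≤ N) {ψ : ℝ → ℝ}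
    (hψ : Continuous ψ) (h0 : ψ 0 = 0) (hb : ∀ s ∈ Icc 0 T, |ψ s| ≤ N)
    (hh : ∀ s ∈ Icc 0 T, ∀ r ∈ Icc 0 T, |ψ s - ψ r| ≤ N * |s - r| ^ β) {t : ℝ}
    (ht : t ∈ Icc 0 T) :
    L2Norm (heatSol ψ t) ≤ ENNReal.ofReal (heatSolConst T β * N) ∧
      L2Norm (heatSolDx ψ t) ≤ ENNReal.ofReal (heatSolConst T β * N) := by
  have hβ' : 0 < β - 1 / 4 := by linarith
  have p1 : 0 ≤ T ^ (1 / 4 : ℝ) := by positivity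
  have p2 : 0 ≤ T ^ (β - 1 / 4) / (β - 1 / 4) := by positivity
  have p3 : 0 ≤ T ^ (β - 1 / 4) := by positivity
  constructor
  · have e : heatSol ψ t = fun x => ∫ s in Ioo 0 t, -2 * heatDx s x * ψ (t - s) :=
      funext fun x => heatSol_eq ht.1 x
    have m : Measurable (Function.uncurry fun s x => -2 * heatDx s x * ψ (t - s)) :=
      (measurable_heatDx.const_mul _).mul
        (hψ.measurable.comp (f := fun p : ℝ × ℝ => t - p.1) (by fun_prop))
    rw [e]
    refine (l2Norm_setIntegral_le (p := -1) (A := 2 * N) ht (by positivity) (by norm_num) m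
      fun s hs x => ?_).trans (ENNReal.ofReal_le_ofReal ?_)
    · rw [abs_mul, abs_mul, show |(-2 : ℝ)| = 2 by norm_num, Real.rpow_neg_one]
      have h1 := abs_heatDx_le hs.1 x
      have h2 := hb (t - s) ⟨by linarith [hs.2], by linarith [hs.1, ht.2]⟩
      have h3 := gauss_nonneg s x
      have h4 := inv_pos.2 hs.1
      rw [one_div] at h1
      calc 2 * |heatDx s x| * |ψ (t - s)| ≤ 2 * (s⁻¹ * gauss s x) * N := by gcongr
        _ = _ := by ring
    · rw [heatSolConst, show (-1 + 5 / 4 : ℝ) = 1 / 4 by norm_num]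
      nlinarith [mul_nonneg p2 hN, mul_nonneg p3 hN]
  · have e : heatSolDx ψ t =ᵐ[μx] (fun x => ∫ s in Ioo 0 t, -2 * heatDxx s x * (ψ (t - s) - ψ t))
        + fun x => -2 * ψ t * heatKernel t x := by
      filter_upwards [self_mem_ae_restrict measurableSet_Ioi] with x hx
      exact heatSolDx_eq hψ ht.1 hx
    have m : Measurable (Function.uncurry fun s x => -2 * heatDxx s x * (ψ (t - s) - ψ t)) :=
      (measurable_heatDxx.const_mul _).mul
        ((hψ.measurable.comp (f := fun p : ℝ × ℝ => t - p.1) (by fun_prop)).sub_const _)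
    have m' : StronglyMeasurable fun x => ∫ s in Ioo 0 t, -2 * heatDxx s x * (ψ (t - s) - ψ t) :=
      (m.comp measurable_swap).stronglyMeasurable.integral_prod_right'
    rw [L2Norm, eLpNorm_congr_ae e]
    refine (eLpNorm_add_le m'.aestronglyMeasurable
      ((continuous_heatKernel t).const_mul _).aestronglyMeasurable one_le_two).trans ?_
    have b1 : L2Norm (fun x => ∫ s in Ioo 0 t, -2 * heatDxx s x * (ψ (t - s) - ψ t))
        ≤ ENNReal.ofReal (8 * N * (T ^ (β - 1 / 4) / (β - 1 / 4))) := by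
      refine (l2Norm_setIntegral_le (p := β - 3 / 2) (A := 4 * N) ht (by positivity) (by linarith)
        m fun s hs x => ?_).trans (ENNReal.ofReal_le_ofReal ?_)
      · rw [abs_mul, abs_mul, show |(-2 : ℝ)| = 2 by norm_num]
        have h1 := abs_heatDxx_le hs.1 x
        have h2 := hh (t - s) ⟨by linarith [hs.2], by linarith [hs.1, ht.2]⟩ t ht
        rw [sub_sub_cancel_left, abs_neg, abs_of_pos hs.1] at h2
        have h3 := gauss_nonneg s x
        have h5 := Real.sqrt_pos.2 hs.1
        have h6 : s ^ (3 / 2 : ℝ) = s * √s := by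
          rw [Real.sqrt_eq_rpow, show (3 / 2 : ℝ) = 1 + 1 / 2 by norm_num, Real.rpow_add hs.1,
            Real.rpow_one]
        have h7 := hs.1
        calc 2 * |heatDxx s x| * |ψ (t - s) - ψ t|
            ≤ 2 * (2 / (s * √s) * gauss s x) * (N * s ^ β) := by gcongr
          _ = _ := by rw [Real.rpow_sub hs.1, h6]; ring
      · rw [show β - 3 / 2 + 5 / 4 = β - 1 / 4 by ring]
        linarith
    have b2 : L2Norm (fun x => -2 * ψ t * heatKernel t x)
        ≤ ENNReal.ofReal (4 * N * T ^ (β - 1 / 4)) := by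
      rcases ht.1.eq_or_lt with rfl | ht0
      · simp [h0, L2Norm]
      -- Because `ψ 0 = 0`, the Hölder bound between `t` and `0` controls `|ψ t|` by `N t^β`, which
      -- offsets the `L²` norm of the kernel, of order `t^(-1/4)`.
      have h2 := hh t ht 0 ⟨le_rfl, hT.le⟩
      rw [h0, sub_zero, sub_zero, abs_of_pos ht0] at h2
      have h5 := Real.sqrt_pos.2 ht0
      refine (eLpNorm_le_of_abs_le_gauss (a := 2 * (N * t ^ β) * (1 / √t)) ht0 (by positivity)
        fun x => ?_).trans (ENNReal.ofReal_le_ofReal ?_)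
      · rw [abs_mul, abs_mul, show |(-2 : ℝ)| = 2 by norm_num,
          abs_of_nonneg (heatKernel_nonneg t x), mul_assoc _ (1 / √t)]
        have := heatKernel_le ht0 x
        have := heatKernel_nonneg t x
        gcongr
      · have e4 : t ^ β * (1 / √t) * t ^ (1 / 4 : ℝ) = t ^ (β - 1 / 4) := by
          rw [one_div, Real.sqrt_eq_rpow, ← Real.rpow_neg ht0.le, ← Real.rpow_add ht0,
            ← Real.rpow_add ht0]
          ring_nf
        calc 2 * (N * t ^ β) * (1 / √t) * (2 * t ^ (1 / 4 : ℝ))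
            = 4 * N * (t ^ β * (1 / √t) * t ^ (1 / 4 : ℝ)) := by ring
          _ ≤ _ := by
            rw [e4]
            have := Real.rpow_le_rpow ht0.le ht.2 hβ'.le
            gcongr
    refine (add_le_add b1 b2).trans ?_
    rw [← ENNReal.ofReal_add (by positivity) (by positivity)]
    refine ENNReal.ofReal_le_ofReal ?_
    rw [heatSolConst]
    nlinarith [mul_nonneg p1 hN]

/-! ### Passage from the Hölder norm to pointwise bounds -/

theorem abs_le_of_CβNorm_le {T : ℝ} {β N : ℝ≥0} {ψ : ℝ → ℝ} (h : CβNorm T β ψ ≤ N) {s : ℝ}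
    (hs : s ∈ Icc 0 T) : |ψ s| ≤ N := by
  have h1 : ‖ψ s‖ₑ ≤ N :=
    (le_iSup₂ (f := fun t (_ : t ∈ Icc 0 T) => ‖ψ t‖ₑ) s hs).trans (le_self_add.trans h)
  rw [← ofReal_norm, Real.norm_eq_abs, ENNReal.ofReal_le_iff_le_toReal (by simp)] at h1
  exact h1

theorem holderWith_of_CβNorm_le {T : ℝ} {β N : ℝ≥0} {ψ : ℝ → ℝ} (h : CβNorm T β ψ ≤ N) :
    HolderWith N β ((Icc 0 T).domRestrict ψ) := by
  have h1 : eHolderNorm β ((Icc 0 T).domRestrict ψ) ≤ N := le_add_self.trans h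
  have h2 : MemHolder β ((Icc 0 T).domRestrict ψ) :=
    eHolderNorm_lt_top.1 (h1.trans_lt ENNReal.coe_lt_top)
  rw [← h2.coe_nnHolderNorm_eq_eHolderNorm, ENNReal.coe_le_coe] at h1
  intro x y
  exact (h2.holderWith x y).trans (by gcongr)

theorem abs_sub_le_of_CβNorm_le {T : ℝ} {β N : ℝ≥0} {ψ : ℝ → ℝ} (h : CβNorm T β ψ ≤ N) {s r : ℝ}
    (hs : s ∈ Icc 0 T) (hr : r ∈ Icc 0 T) : |ψ s - ψ r| ≤ N * |s - r| ^ (β : ℝ) :=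
  (holderWith_of_CβNorm_le h).dist_le ⟨s, hs⟩ ⟨r, hr⟩

/-- Nothing is assumed of `ψ` outside `[0, T]`. Extending it by its endpoint values yields a
globally continuous datum with the same `heatSol` on `[0, T]`. -/
theorem exists_continuous_eqOn {T : ℝ} (hT : 0 < T) {β : ℝ≥0} (hβ : 0 < β) {ψ : ℝ → ℝ}
    (h : CβNorm T β ψ < ⊤) : ∃ φ : ℝ → ℝ, Continuous φ ∧ EqOn ψ φ (Icc 0 T) := by
  lift CβNorm T β ψ to ℝ≥0 using h.ne with N hN
  have hc := (holderWith_of_CβNorm_le hN.symm.le).continuous hβ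
  exact ⟨IccExtend hT.le ((Icc 0 T).domRestrict ψ), hc.Icc_extend',
    fun s hs => (IccExtend_of_mem hT.le ((Icc 0 T).domRestrict ψ) hs).symm⟩

theorem heatSol_congr {T : ℝ} {ψ φ : ℝ → ℝ} (h : EqOn ψ φ (Icc 0 T)) {t : ℝ} (ht : t ∈ Icc 0 T) :
    heatSol ψ t = heatSol φ t := by
  ext x
  rw [heatSol, heatSol]
  congr 1
  refine intervalIntegral.integral_congr fun τ hτ => ?_
  rw [uIcc_of_le ht.1] at hτ
  simp only [h ⟨hτ.1, hτ.2.trans ht.2⟩]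

section HolderDatum

variable {T : ℝ} {β : ℝ≥0} {ψ : ℝ → ℝ}

theorem hasWeakDeriv_deriv_heatSol (hT : 0 < T) (hβ : 0 < β) (h : CβNorm T β ψ < ⊤) {t : ℝ}
    (ht : t ∈ Icc 0 T) : HasWeakDeriv (heatSol ψ t) (deriv (heatSol ψ t)) := by
  obtain ⟨φ, hφ, e⟩ := exists_continuous_eqOn hT hβ h
  rw [heatSol_congr e ht]
  refine (hasWeakDeriv_heatSol hφ ht.1).congr .rfl ?_
  filter_upwards [self_mem_ae_restrict measurableSet_Ioi] with x hx
  exact (hasDerivAt_heatSol hφ ht.1 hx).deriv.symm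

theorem l2Norm_heatSol_le_of_CβNorm_le (hT : 0 < T) (hβ : 1 / 4 < β) {N : ℝ≥0}
    (h : CβNorm T β ψ ≤ N) (h0 : ψ 0 = 0) {t : ℝ} (ht : t ∈ Icc 0 T) :
    L2Norm (heatSol ψ t) ≤ ENNReal.ofReal (heatSolConst T β) * N ∧
      L2Norm (deriv (heatSol ψ t)) ≤ ENNReal.ofReal (heatSolConst T β) * N := by
  have hβ0 : 0 < β := lt_trans (by norm_num) hβ
  have hβ' : (1 / 4 : ℝ) < β := by exact_mod_cast hβ
  obtain ⟨φ, hφ, e⟩ := exists_continuous_eqOn hT hβ0 (h.trans_lt ENNReal.coe_lt_top)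
  have key := l2Norm_heatSol_le hT hβ' N.2 hφ (by rw [← e ⟨le_rfl, hT.le⟩, h0])
    (fun s hs => by rw [← e hs]; exact abs_le_of_CβNorm_le h hs)
    (fun s hs r hr => by rw [← e hs, ← e hr]; exact abs_sub_le_of_CβNorm_le h hs hr) ht
  have ed : deriv (heatSol ψ t) =ᵐ[μx] heatSolDx φ t := by
    filter_upwards [self_mem_ae_restrict measurableSet_Ioi] with x hx
    rw [heatSol_congr e ht]
    exact (hasDerivAt_heatSol hφ ht.1 hx).deriv
  rw [ENNReal.ofReal_mul (heatSolConst_pos hT hβ').le] at key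
  have eN : ENNReal.ofReal (N : ℝ) = N := ENNReal.ofReal_coe_nnreal
  refine ⟨?_, ?_⟩
  · rw [heatSol_congr e ht, ← eN]; exact key.1
  · rw [L2Norm, eLpNorm_congr_ae ed, ← eN]; exact key.2

theorem ae_μtx_mem (T : ℝ) : ∀ᵐ p ∂μtx T, p.1 ∈ Icc 0 T ∧ 0 < p.2 := by
  have h1 : ∀ᵐ p ∂μtx T, p.1 ∈ Icc 0 T :=
    Measure.quasiMeasurePreserving_fst.ae (self_mem_ae_restrict measurableSet_Icc)
  have h2 : ∀ᵐ p ∂μtx T, 0 < p.2 :=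
    Measure.quasiMeasurePreserving_snd.ae (self_mem_ae_restrict measurableSet_Ioi)
  filter_upwards [h1, h2] with p a b using ⟨a, b⟩

/-- The domain of integration depends on the parameter, so it is encoded as the indicator of a
measurable set of triples before the measurability of parametric integrals is applied. -/
theorem stronglyMeasurable_setIntegral_mul {k φ : ℝ → ℝ → ℝ}
    (hk : Measurable fun p : ℝ × ℝ => k p.1 p.2) (hφ : Measurable (Function.uncurry φ)) :
    StronglyMeasurable fun p : ℝ × ℝ => ∫ s in Ioo 0 p.1, k s p.2 * φ p.1 s := by
  have hG : Measurable ({q : (ℝ × ℝ) × ℝ | 0 < q.2 ∧ q.2 < q.1.1}.indicator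
      fun q => k q.2 q.1.2 * φ q.1.1 q.2) := by
    refine Measurable.indicator ?_ ?_
    · exact (hk.comp (f := fun q : (ℝ × ℝ) × ℝ => (q.2, q.1.2)) (by fun_prop)).mul
        (hφ.comp (f := fun q : (ℝ × ℝ) × ℝ => (q.1.1, q.2)) (by fun_prop))
    · exact (measurableSet_lt measurable_const measurable_snd).inter
        (measurableSet_lt measurable_snd (by fun_prop))
  have e : (fun p : ℝ × ℝ => ∫ s in Ioo 0 p.1, k s p.2 * φ p.1 s)
      = fun p => ∫ s, {q : (ℝ × ℝ) × ℝ | 0 < q.2 ∧ q.2 < q.1.1}.indicator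
        (fun q => k q.2 q.1.2 * φ q.1.1 q.2) (p, s) := by
    ext p
    rw [← integral_indicator measurableSet_Ioo]
    rfl
  rw [e]
  exact hG.stronglyMeasurable.integral_prod_right'

theorem aestronglyMeasurable_heatSol (hT : 0 < T) (hβ : 0 < β) (h : CβNorm T β ψ < ⊤) :
    AEStronglyMeasurable (Function.uncurry (heatSol ψ)) (μtx T) := by
  obtain ⟨φ, hφ, e⟩ := exists_continuous_eqOn hT hβ h
  refine ⟨_, stronglyMeasurable_setIntegral_mul (k := fun s x => -2 * heatDx s x)
    (φ := fun t s => φ (t - s)) (measurable_heatDx.const_mul _)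
    (hφ.measurable.comp (f := fun p : ℝ × ℝ => p.1 - p.2) (by fun_prop)), ?_⟩
  filter_upwards [ae_μtx_mem T] with p hp
  rw [Function.uncurry, heatSol_congr e hp.1]
  exact heatSol_eq hp.1.1 p.2

theorem aestronglyMeasurable_deriv_heatSol (hT : 0 < T) (hβ : 0 < β) (h : CβNorm T β ψ < ⊤) :
    AEStronglyMeasurable (Function.uncurry fun t x => deriv (heatSol ψ t) x) (μtx T) := by
  obtain ⟨φ, hφ, e⟩ := exists_continuous_eqOn hT hβ h
  refine ⟨_, stronglyMeasurable_setIntegral_mul (k := fun s x => -2 * heatDxx s x)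
    (φ := fun t s => φ (t - s)) (measurable_heatDxx.const_mul _)
    (hφ.measurable.comp (f := fun p : ℝ × ℝ => p.1 - p.2) (by fun_prop)), ?_⟩
  filter_upwards [ae_μtx_mem T] with p hp
  rw [Function.uncurry, heatSol_congr e hp.1]
  exact (hasDerivAt_heatSol hφ hp.1.1 hp.2).deriv

theorem heatSol_sub (hT : 0 < T) (hβ : 0 < β) {ψ' : ℝ → ℝ} (h : CβNorm T β ψ < ⊤)
    (h' : CβNorm T β ψ' < ⊤) {t : ℝ} (ht : t ∈ Icc 0 T) {x : ℝ} (hx : 0 < x) :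
    heatSol (fun s => ψ s - ψ' s) t x = heatSol ψ t x - heatSol ψ' t x ∧
      deriv (heatSol (fun s => ψ s - ψ' s) t) x
        = deriv (heatSol ψ t) x - deriv (heatSol ψ' t) x := by
  obtain ⟨φ, hφ, e⟩ := exists_continuous_eqOn hT hβ h
  obtain ⟨φ', hφ', e'⟩ := exists_continuous_eqOn hT hβ h'
  have e'' : EqOn (fun s => ψ s - ψ' s) (fun s => φ s - φ' s) (Icc 0 T) := fun s hs => by
    simp only [e hs, e' hs]
  have key : ∀ y, 0 < y → heatSol (fun s => φ s - φ' s) t y = heatSol φ t y - heatSol φ' t y := by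
    intro y hy
    rw [heatSol_eq ht.1, heatSol_eq ht.1, heatSol_eq ht.1,
      ← integral_sub (integrable_heatDx_mul hφ t hy) (integrable_heatDx_mul hφ' t hy)]
    simp_rw [mul_sub]
  rw [heatSol_congr e ht, heatSol_congr e' ht, heatSol_congr e'' ht]
  refine ⟨key x hx, ?_⟩
  have hev : heatSol (fun s => φ s - φ' s) t =ᶠ[𝓝 x] fun y => heatSol φ t y - heatSol φ' t y :=
    Filter.eventually_of_mem (Ioi_mem_nhds hx) key
  rw [hev.deriv_eq, deriv_fun_sub (hasDerivAt_heatSol hφ ht.1 hx).differentiableAt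
    (hasDerivAt_heatSol hφ' ht.1 hx).differentiableAt]

end HolderDatum

/-! ### Gronwall's inequality -/

/-- The constant in the Duhamel estimate. -/
def duhamelConst (T : ℝ) : ℝ := smoothConst T * Real.Gamma (1 / 4)

theorem duhamelConst_pos {T : ℝ} (hT : 0 < T) : 0 < duhamelConst T :=
  mul_pos (smoothConst_pos hT) (Real.Gamma_pos_of_pos (by norm_num))

/-- The exponential rate in the Gronwall estimate. -/
def growthRate (T B : ℝ) : ℝ := (1 + 4 * duhamelConst T * (B + 1)) ^ 4

/-- The growth factor in the Gronwall estimate. -/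
def growth (T : ℝ) (B : ℝ≥0) : ℝ≥0 := 48 * (Real.exp (growthRate T B * T)).toNNReal

/-- Gronwall for a kernel singularity `s^(-3/4)`: in the norm weighted by `exp(-l t)` the Duhamel
term gains `l^(-1/4)`, so for large `l` the part depending on `z` is at most half of the weighted
norm `Φ` and can be absorbed. Absorption is legitimate because `hfin` makes `Φ` finite. -/
theorem w12Norm_le_of_duhamel {T : ℝ} (hT : 0 < T) {z : ℝ → ℝ → ℝ} {z₀ : ℝ → ℝ} {F : ℝ → ℝ → ℝ}
    {N B M : ℝ≥0} (hz₀ : W12Bound z₀ N) (h₀ : HasZeroTrace z₀)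
    (hmild : ∀ t ∈ Icc 0 T, ∀ᵐ x ∂μx, z t x = dirichletConv t z₀ x + duhamel F t x)
    (hF : IsSource T F fun τ => B * W12Norm (z τ) + M)
    (hfin : essSup (fun t => W12Norm (z t)) (μt T) < ⊤) {t : ℝ} (ht : t ∈ Icc 0 T) :
    W12Norm (z t) ≤ growth T B * (N + M) := by
  set κ := duhamelConst T with hκ
  have hκ0 : 0 < κ := duhamelConst_pos hT
  set l := growthRate T B with hl
  have hr : 0 < 1 + 4 * κ * (B + 1) := by positivity
  have hl0 : 0 < l := pow_pos hr 4
  -- The fourth power in `growthRate` is undone by the exponent `1/4`; the rate is tuned to make `4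
  -- * c * (B + 1) ≤ 1`.
  have hlr : (1 / l) ^ (1 / 4 : ℝ) = 1 / (1 + 4 * κ * (B + 1)) := by
    rw [hl, growthRate, ← hκ, ← one_div_pow, ← Real.rpow_natCast, ← Real.rpow_mul (by positivity)]
    norm_num
  set c := ENNReal.ofReal (κ * (1 / l) ^ (1 / 4 : ℝ)) with hc
  have hcB : 4 * c * (B + 1) ≤ 1 := by
    have e1 : (B : ℝ≥0∞) + 1 = ENNReal.ofReal ((B : ℝ) + 1) := by
      rw [ENNReal.ofReal_add B.coe_nonneg zero_le_one, ENNReal.ofReal_coe_nnreal, ENNReal.ofReal_one]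
    have e4 : (4 : ℝ≥0∞) = ENNReal.ofReal 4 := by norm_num
    rw [hc, hlr, e1, e4, ← ENNReal.ofReal_mul (by norm_num), ← ENNReal.ofReal_mul (by positivity),
      ← ENNReal.ofReal_one]
    refine ENNReal.ofReal_le_ofReal ?_
    rw [mul_one_div, mul_div_assoc', div_mul_eq_mul_div, div_le_one hr]
    linarith
  set Φ := essSup (fun t => ENNReal.ofReal (Real.exp (-(l * t))) * W12Norm (z t)) (μt T) with hΦ
  have hexp : ∀ τ, ENNReal.ofReal (Real.exp (l * τ)) * ENNReal.ofReal (Real.exp (-(l * τ))) = 1 := by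
    intro τ
    rw [← ENNReal.ofReal_mul (Real.exp_pos _).le, ← Real.exp_add]
    simp
  have hexp1 : ∀ τ, 0 ≤ τ → 1 ≤ ENNReal.ofReal (Real.exp (l * τ)) := fun τ hτ => by
    rw [← ENNReal.ofReal_one]
    exact ENNReal.ofReal_le_ofReal (Real.one_le_exp (by positivity))
  have hΦfin : Φ < ⊤ := by
    refine lt_of_le_of_lt (essSup_mono_ae ?_) hfin
    filter_upwards [self_mem_ae_restrict measurableSet_Icc] with τ hτ
    refine mul_le_of_le_one_left zero_le ?_
    rw [← hexp τ]
    exact le_mul_of_one_le_left zero_le (hexp1 τ hτ.1)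
  have hW : ∀ᵐ τ ∂μt T, W12Norm (z τ) ≤ Φ * ENNReal.ofReal (Real.exp (l * τ)) := by
    filter_upwards [ENNReal.ae_le_essSup
      (fun t => ENNReal.ofReal (Real.exp (-(l * t))) * W12Norm (z t))] with τ hτ
    calc W12Norm (z τ) = ENNReal.ofReal (Real.exp (-(l * τ))) * W12Norm (z τ)
          * ENNReal.ofReal (Real.exp (l * τ)) := by
          rw [mul_right_comm, mul_comm (ENNReal.ofReal _), hexp, one_mul]
      _ ≤ _ := by gcongr
  have hF' : IsSource T F fun τ => (B * Φ + M) * ENNReal.ofReal (Real.exp (l * τ)) := by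
    refine hF.mono ?_
    filter_upwards [hW, self_mem_ae_restrict measurableSet_Icc] with τ h1 hτ
    rw [add_mul, mul_assoc]
    gcongr
    exact le_mul_of_one_le_right zero_le (hexp1 τ hτ.1)
  have hBM : B * Φ + M < ⊤ :=
    ENNReal.add_lt_top.2 ⟨ENNReal.mul_lt_top ENNReal.coe_lt_top hΦfin, ENNReal.coe_lt_top⟩
  -- The inequality is doubled to avoid halves in `ℝ≥0∞`. The factor `4 * c` collects this `2` and
  -- the `2` from `W12Bound.w12Norm_le`; likewise `48 = 4 * 12`.
  have step : ∀ s ∈ Icc 0 T,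
      2 * W12Norm (z s) ≤ ENNReal.ofReal (Real.exp (l * s)) * (48 * N + (Φ + M)) := by
    intro s hs
    have h1 := W12Bound.dirichletConv hs.1 ENNReal.coe_lt_top hz₀ h₀
    have h2 := W12Bound.duhamel hl0 hs hBM hF'
    have h3 := ((h1.add h2).congr ((hmild s hs).mono fun x hx => hx.symm)).w12Norm_le
    have e : ENNReal.ofReal (smoothConst T * Real.Gamma (1 / 4) * (1 / l) ^ (1 / 4 : ℝ)
        * Real.exp (l * s)) = c * ENNReal.ofReal (Real.exp (l * s)) :=
      ENNReal.ofReal_mul (by positivity)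
    rw [e] at h3
    calc 2 * W12Norm (z s)
        ≤ 2 * (2 * (12 * N + c * ENNReal.ofReal (Real.exp (l * s)) * (B * Φ + M))) := by gcongr
      _ = 48 * N + ENNReal.ofReal (Real.exp (l * s)) * (4 * c * (B * Φ + M)) := by ring
      _ ≤ ENNReal.ofReal (Real.exp (l * s)) * (48 * N)
          + ENNReal.ofReal (Real.exp (l * s)) * (4 * c * ((B + 1) * (Φ + M))) := by
          refine add_le_add (le_mul_of_one_le_left zero_le (hexp1 s hs.1))
            (mul_le_mul' le_rfl (mul_le_mul' le_rfl ?_))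
          calc (B : ℝ≥0∞) * Φ + M ≤ (B * Φ + M) + (B * M + Φ) := le_self_add
            _ = (B + 1) * (Φ + M) := by ring
      _ ≤ ENNReal.ofReal (Real.exp (l * s)) * (48 * N)
          + ENNReal.ofReal (Real.exp (l * s)) * (Φ + M) := by
          gcongr
          rw [← mul_assoc]
          exact mul_le_of_le_one_left zero_le hcB
      _ = _ := by ring
  have hΦle : Φ ≤ 48 * N + M := by
    have h2 : Φ + Φ ≤ Φ + (48 * N + M) := by
      rw [← two_mul, hΦ, ← ENNReal.essSup_const_mul]
      refine essSup_le_of_ae_le _ ?_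
      filter_upwards [self_mem_ae_restrict measurableSet_Icc] with s hs
      calc 2 * (ENNReal.ofReal (Real.exp (-(l * s))) * W12Norm (z s))
          = ENNReal.ofReal (Real.exp (-(l * s))) * (2 * W12Norm (z s)) := by ring
        _ ≤ ENNReal.ofReal (Real.exp (-(l * s)))
            * (ENNReal.ofReal (Real.exp (l * s)) * (48 * N + (Φ + M))) := by
            exact mul_le_mul' le_rfl (step s hs)
        _ = Φ + (48 * N + M) := by
            rw [← mul_assoc, mul_comm (ENNReal.ofReal _), hexp]; ring
    exact (ENNReal.add_le_add_iff_left hΦfin.ne).1 h2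
  -- The bound on `Φ` only concerns almost every time. Putting it back into `step`, which holds at
  -- each time of `[0, T]`, gives the estimate everywhere.
  have hfinal : 2 * W12Norm (z t) ≤ 2 * (growth T B * (N + M)) := by
    have eg : ((growth T B : ℝ≥0) : ℝ≥0∞) = 48 * ENNReal.ofReal (Real.exp (l * T)) := by
      rw [growth, ENNReal.coe_mul]; rfl
    rw [eg]
    calc 2 * W12Norm (z t) ≤ _ := step t ht
      _ ≤ ENNReal.ofReal (Real.exp (l * T)) * (48 * N + ((48 * N + M) + M)) := by
        gcongr; exact ht.2
      _ = ENNReal.ofReal (Real.exp (l * T)) * (96 * N + 2 * M) := by ring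
      _ ≤ ENNReal.ofReal (Real.exp (l * T)) * (96 * N + 96 * M) := by
        gcongr; norm_num
      _ = _ := by ring
  exact (ENNReal.mul_le_mul_iff_right two_ne_zero ENNReal.ofNat_ne_top).1 hfinal

/-! ### Products as sources -/

theorem eLpNorm_one_mul_le {f g : ℝ → ℝ} (hf : AEStronglyMeasurable f μx)
    (hg : AEStronglyMeasurable g μx) :
    eLpNorm (fun x => f x * g x) 1 μx ≤ L2Norm f * L2Norm g := by
  have := lintegral_mul_le_eLpNorm_two hf.enorm hg.enorm
  rw [eLpNorm_enorm, eLpNorm_enorm] at this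
  rw [eLpNorm_one_eq_lintegral_enorm]
  simpa only [enorm_mul, L2Norm] using this

/-- Hölder's inequality puts a product of two `L²` factors only in `L¹`; terms such as `b ∂ₓv` are
the reason why sources have an `L¹` component. -/
theorem IsSource.mul_of_l2Norm_le {T : ℝ} {f g : ℝ → ℝ → ℝ}
    (hf : AEStronglyMeasurable (Function.uncurry f) (μtx T))
    (hg : AEStronglyMeasurable (Function.uncurry g) (μtx T)) {A : ℝ≥0∞} {N : ℝ → ℝ≥0∞}
    (bf : ∀ᵐ τ ∂μt T, L2Norm (f τ) ≤ A) (bg : ∀ᵐ τ ∂μt T, L2Norm (g τ) ≤ N τ) :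
    IsSource T (fun τ y => f τ y * g τ y) fun τ => A * N τ := by
  refine ⟨fun τ y => f τ y * g τ y, fun _ _ => 0, hf.mul hg, aestronglyMeasurable_const,
    fun τ y => (add_zero _).symm, ?_⟩
  filter_upwards [bf, bg, ae_aestronglyMeasurable_of_uncurry hf,
    ae_aestronglyMeasurable_of_uncurry hg] with τ h1 h2 m1 m2
  rw [eLpNorm_zero', add_zero]
  exact (eLpNorm_one_mul_le m1 m2).trans (mul_le_mul' h1 h2)

theorem IsSource.mul_of_ae_enorm_le {T : ℝ} {f g : ℝ → ℝ → ℝ}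
    (hf : AEStronglyMeasurable (Function.uncurry f) (μtx T))
    (hg : AEStronglyMeasurable (Function.uncurry g) (μtx T)) {A : ℝ≥0} {N : ℝ → ℝ≥0∞}
    (bf : ∀ᵐ τ ∂μt T, ∀ᵐ y ∂μx, ‖f τ y‖ₑ ≤ A) (bg : ∀ᵐ τ ∂μt T, L2Norm (g τ) ≤ N τ) :
    IsSource T (fun τ y => f τ y * g τ y) fun τ => A * N τ := by
  refine ⟨fun _ _ => 0, fun τ y => f τ y * g τ y, aestronglyMeasurable_const, hf.mul hg,
    fun τ y => (zero_add _).symm, ?_⟩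
  filter_upwards [bf, bg] with τ h1 h2
  rw [eLpNorm_zero', zero_add]
  have : eLpNorm (fun y => f τ y * g τ y) 2 μx ≤ A • eLpNorm (g τ) 2 μx := by
    refine eLpNorm_le_nnreal_smul_eLpNorm_of_ae_le_mul ?_ 2
    filter_upwards [h1] with y hy
    rw [nnnorm_mul]
    gcongr
    exact_mod_cast hy
  exact this.trans (mul_le_mul_right h2 _)

theorem dirichletConv_sub {t : ℝ} (ht : 0 ≤ t) {f g : ℝ → ℝ} (hf : MemLp f 2 μx)
    (hg : MemLp g 2 μx) (x : ℝ) :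
    dirichletConv t (fun y => f y - g y) x = dirichletConv t f x - dirichletConv t g x := by
  rcases ht.eq_or_lt with rfl | ht
  · simp [dirichletConv]
  have mk : MemLp (dirKer t x) 2 μx := by
    have := continuous_heatKernel t
    exact memLp_two_of_abs_le_gaussSum (a := 1 / √t) ht x (by unfold dirKer; fun_prop)
      (by positivity) (abs_dirKer_le ht x)
  have i1 : Integrable (fun y => dirKer t x y * f y) μx := mk.integrable_mul hf
  have i2 : Integrable (fun y => dirKer t x y * g y) μx := mk.integrable_mul hg
  simp only [dirichletConv, ht, if_true, mul_sub]
  exact integral_sub i1 i2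

/-! ### Estimates for mild solutions -/

/-- The sum of the norms of the coefficients `b` and `γ`. -/
def coeffSum (T : ℝ) (D : LinData) : ℝ≥0 :=
  (LinftyL2Norm T D.b).toNNReal + (LinftyNorm T D.γ).toNNReal

theorem HasZeroTrace.sub {f g : ℝ → ℝ} (hf : HasZeroTrace f) (hg : HasZeroTrace g) :
    HasZeroTrace fun x => f x - g x :=
  let ⟨f₀, ef, cf, zf⟩ := hf
  let ⟨g₀, eg, cg, zg⟩ := hg
  ⟨fun x => f₀ x - g₀ x, ef.sub eg, cf.sub cg, by simp [zf, zg]⟩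

theorem memLp_two_of_w12Norm_lt_top {f : ℝ → ℝ} (h : W12Norm f < ⊤) : MemLp f 2 μx :=
  let ⟨_, h1, h2, _⟩ := W12Bound.of_w12Norm_lt_top h
  ⟨h1.aestronglyMeasurable_fun, h2.trans_lt h⟩

theorem ae_l2Norm_le_of_linftyL2Norm_le {T : ℝ} {b : ℝ → ℝ → ℝ} {A : ℝ≥0∞}
    (h : LinftyL2Norm T b ≤ A) : ∀ᵐ τ ∂μt T, L2Norm (b τ) ≤ A :=
  (ENNReal.ae_le_essSup _).mono fun _ hτ => hτ.trans h

theorem ae_l2Norm_le_of_CL2Norm_le {T : ℝ} {γ : ℝ → ℝ → ℝ} {A : ℝ≥0∞} (h : CL2Norm T γ ≤ A) :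
    ∀ᵐ τ ∂μt T, L2Norm (γ τ) ≤ A := by
  filter_upwards [self_mem_ae_restrict measurableSet_Icc] with τ hτ
  exact (le_iSup₂ (f := fun t (_ : t ∈ Icc 0 T) => L2Norm (γ t)) τ hτ).trans h

theorem l2Norm_add_le {f g : ℝ → ℝ} {A A' : ℝ≥0∞} (hf : AEStronglyMeasurable f μx)
    (hg : AEStronglyMeasurable g μx) (bf : L2Norm f ≤ A) (bg : L2Norm g ≤ A') :
    L2Norm (fun x => f x + g x) ≤ A + A' :=
  (eLpNorm_add_le hf hg one_le_two).trans (add_le_add bf bg)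

theorem MemLinftyW12.ae_l2Norm_le {T : ℝ} {v w : ℝ → ℝ → ℝ} (h : MemLinftyW12 T v w) :
    ∀ᵐ τ ∂μt T, L2Norm (v τ) ≤ W12Norm (v τ) ∧ L2Norm (w τ) ≤ W12Norm (v τ) :=
  h.hasWeakDeriv.mono fun _ hτ => hτ.l2Norm_le

theorem MemLinftyW12.sub {T : ℝ} {v w v' w' : ℝ → ℝ → ℝ} (h : MemLinftyW12 T v w)
    (h' : MemLinftyW12 T v' w') :
    MemLinftyW12 T (fun t x => v t x - v' t x) (fun t x => w t x - w' t x) where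
  measurable_fun := h.1.sub h'.1
  measurable_deriv := h.2.sub h'.2
  hasWeakDeriv := by filter_upwards [h.3, h'.3] with t a b using a.sub b
  norm_lt_top := by
    refine lt_of_le_of_lt (essSup_le_of_ae_le (2 * (essSup (fun t => W12Norm (v t)) (μt T)
      + essSup (fun t => W12Norm (v' t)) (μt T))) ?_)
      (ENNReal.mul_lt_top (by simp) (ENNReal.add_lt_top.2 ⟨h.4, h'.4⟩))
    filter_upwards [h.3, h'.3, ENNReal.ae_le_essSup fun t => W12Norm (v t),
      ENNReal.ae_le_essSup fun t => W12Norm (v' t)] with t a a' b b'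
    have c : W12Bound (v t) (W12Norm (v t)) := ⟨_, a, a.l2Norm_le⟩
    have c' : W12Bound (v' t) (W12Norm (v' t)) := ⟨_, a', a'.l2Norm_le⟩
    exact ((c.mono b).sub (c'.mono b')).w12Norm_le

section Solutions

variable {T : ℝ} {β : ℝ≥0} {D D₁ D₂ : LinData}

theorem LinData.Admissible.ae_l2Norm_b_le (hD : D.Admissible T β) :
    ∀ᵐ τ ∂μt T, L2Norm (D.b τ) ≤ (LinftyL2Norm T D.b).toNNReal :=
  ae_l2Norm_le_of_linftyL2Norm_le (ENNReal.coe_toNNReal hD.b_norm.ne).symm.le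

theorem LinData.Admissible.ae_enorm_γ_le (hD : D.Admissible T β) :
    ∀ᵐ τ ∂μt T, ∀ᵐ y ∂μx, ‖D.γ τ y‖ₑ ≤ (LinftyNorm T D.γ).toNNReal := by
  have h1 : LinftyNorm T D.γ ≠ ⊤ := hD.γ_memLp.2.ne
  have h2 : ∀ᵐ p ∂μtx T, ‖Function.uncurry D.γ p‖ₑ ≤ (LinftyNorm T D.γ).toNNReal := by
    rw [ENNReal.coe_toNNReal h1, LinftyNorm, eLpNorm_exponent_top]
    exact enorm_ae_le_eLpNormEssSup _ _
  exact Measure.ae_ae_of_ae_prod h2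

theorem LinData.Admissible.isSource (hD : D.Admissible T β) {f g : ℝ → ℝ → ℝ}
    (hf : AEStronglyMeasurable (Function.uncurry f) (μtx T))
    (hg : AEStronglyMeasurable (Function.uncurry g) (μtx T)) {N : ℝ → ℝ≥0∞}
    (h : ∀ᵐ τ ∂μt T, L2Norm (g τ) ≤ N τ ∧ L2Norm (f τ) ≤ N τ) :
    IsSource T (fun τ y => D.b τ y * f τ y + D.γ τ y * g τ y) fun τ => coeffSum T D * N τ := by
  have h1 := IsSource.mul_of_l2Norm_le hD.b_measurable hf hD.ae_l2Norm_b_le (h.mono fun _ h => h.2)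
  have h2 := IsSource.mul_of_ae_enorm_le hD.γ_memLp.1 hg hD.ae_enorm_γ_le (h.mono fun _ h => h.1)
  refine (h1.add h2).mono (ae_of_all _ fun τ => ?_)
  rw [coeffSum, ENNReal.coe_add, add_mul]

/-- A bound for the heat solution. -/
def heatBound (T : ℝ) (β N : ℝ≥0) : ℝ≥0 := (heatSolConst T β).toNNReal * N

theorem ae_l2Norm_heatSol_le (hT : 0 < T) (hβ : 1 / 4 < β) {ψ : ℝ → ℝ} {N : ℝ≥0}
    (h : CβNorm T β ψ ≤ N) (h0 : ψ 0 = 0) :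
    ∀ᵐ τ ∂μt T, L2Norm (heatSol ψ τ) ≤ heatBound T β N ∧
      L2Norm (deriv (heatSol ψ τ)) ≤ heatBound T β N := by
  filter_upwards [self_mem_ae_restrict measurableSet_Icc] with τ hτ
  rw [heatBound, ENNReal.coe_mul]
  exact l2Norm_heatSol_le_of_CβNorm_le hT hβ h h0 hτ

/-- A mild solution solves the Duhamel equation with a single source. -/
theorem LinData.Admissible.ae_mild_eq (hT : 0 < T) (hβ : 1 / 4 < β) (hD : D.Admissible T β)
    {v w : ℝ → ℝ → ℝ} (hw : MemLinftyW12 T v w) {t : ℝ} (ht : t ∈ Icc 0 T) :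
    ∀ᵐ x ∂μx, duhamel (fun τ y => (D.b τ y * w τ y + D.γ τ y * v τ y)
        + (D.b τ y * deriv (heatSol D.ψ τ) y + D.γ τ y * heatSol D.ψ τ y)) t x
      = duhamel (fun τ y => D.b τ y * w τ y + D.γ τ y * v τ y) t x
        + duhamel (fun τ y => D.b τ y * deriv (heatSol D.ψ τ) y + D.γ τ y * heatSol D.ψ τ y) t x := by
  have hβ0 : 0 < β := lt_trans (by norm_num) hβ
  have s1 : IsSource T (fun τ y => D.b τ y * w τ y + D.γ τ y * v τ y)
      fun _ => coeffSum T D * essSup (fun t => W12Norm (v t)) (μt T) := by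
    refine (hD.isSource hw.2 hw.1 hw.ae_l2Norm_le).mono ?_
    filter_upwards [ENNReal.ae_le_essSup fun t => W12Norm (v t)] with τ hτ
    gcongr
  have s2 := hD.isSource (aestronglyMeasurable_deriv_heatSol hT hβ0 hD.ψ_holder)
    (aestronglyMeasurable_heatSol hT hβ0 hD.ψ_holder)
    (ae_l2Norm_heatSol_le hT hβ (ENNReal.coe_toNNReal hD.ψ_holder.ne).symm.le hD.ψ_zero)
  exact ae_duhamel_add ht (ENNReal.mul_lt_top ENNReal.coe_lt_top hw.4) s1
    (ENNReal.mul_lt_top ENNReal.coe_lt_top ENNReal.coe_lt_top) s2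

/-- The bound for a single mild solution, in terms of the norms of the data. -/
def mildBound (T : ℝ) (β : ℝ≥0) (B N₀ N : ℝ≥0) : ℝ≥0 :=
  growth T B * (N₀ + B * heatBound T β N)

/-- The terms in `ũ` act as an inhomogeneity of size `coeffSum * heatBound` in the Gronwall
estimate. The bound is needed for the products of coefficient differences with the second solution.
-/
theorem IsMildSolution.w12Norm_le (hT : 0 < T) (hβ : 1 / 4 < β) (hD : D.Admissible T β)
    {v : ℝ → ℝ → ℝ} (hv : IsMildSolution T D v) {t : ℝ} (ht : t ∈ Icc 0 T) :
    W12Norm (v t) ≤ mildBound T β (coeffSum T D) (W12Norm D.v₀).toNNReal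
      (CβNorm T β D.ψ).toNNReal := by
  have hβ0 : 0 < β := lt_trans (by norm_num) hβ
  obtain ⟨w, hw, hm⟩ := hv
  have hz : W12Bound D.v₀ (W12Norm D.v₀).toNNReal := by
    rw [ENNReal.coe_toNNReal hD.v₀_norm.ne]
    exact .of_w12Norm_lt_top hD.v₀_norm
  have s1 := hD.isSource hw.2 hw.1 hw.ae_l2Norm_le
  have s2 := hD.isSource (aestronglyMeasurable_deriv_heatSol hT hβ0 hD.ψ_holder)
    (aestronglyMeasurable_heatSol hT hβ0 hD.ψ_holder)
    (ae_l2Norm_heatSol_le hT hβ (ENNReal.coe_toNNReal hD.ψ_holder.ne).symm.le hD.ψ_zero)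
  have key := w12Norm_le_of_duhamel (M := coeffSum T D * heatBound T β (CβNorm T β D.ψ).toNNReal)
    hT hz hD.v₀_trace (z := v) (fun s hs => ?_) (by simpa using s1.add s2) hw.4 ht
  · rw [mildBound, ENNReal.coe_mul, ENNReal.coe_add]
    exact key
  · filter_upwards [hm s hs, hD.ae_mild_eq hT hβ hw hs] with x h1 h2
    rw [h1, h2, add_assoc]
    rfl

/-- The difference of the sources is arranged so that differences of `v` and of `ũ` carry the
coefficients of `D₁`, and differences of coefficients multiply `v₂ + ũ₂`. Only the terms in `v₁ -
v₂` are fed back into Gronwall; the rest has size independent of the unknown. -/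
theorem IsMildSolution.w12Norm_sub_le (hT : 0 < T) (hβ : 1 / 4 < β) (hD₁ : D₁.Admissible T β)
    (hD₂ : D₂.Admissible T β) {v₁ v₂ : ℝ → ℝ → ℝ} (hv₁ : IsMildSolution T D₁ v₁)
    (hv₂ : IsMildSolution T D₂ v₂) {N₀ N A : ℝ≥0}
    (hN₀ : W12Norm (fun x => D₁.v₀ x - D₂.v₀ x) ≤ N₀)
    (hN : CβNorm T β (fun t => D₁.ψ t - D₂.ψ t) ≤ N)
    (hA : LinftyL2Norm T (fun t x => D₁.b t x - D₂.b t x)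
      + CL2Norm T (fun t x => D₁.γ t x - D₂.γ t x) ≤ A) {t : ℝ} (ht : t ∈ Icc 0 T) :
    W12Norm (fun x => v₁ t x - v₂ t x) ≤ growth T (coeffSum T D₁) * (N₀
      + (coeffSum T D₁ * heatBound T β N
        + (mildBound T β (coeffSum T D₂) (W12Norm D₂.v₀).toNNReal (CβNorm T β D₂.ψ).toNNReal
          + heatBound T β (CβNorm T β D₂.ψ).toNNReal) * A)) := by
  have hβ0 : 0 < β := lt_trans (by norm_num) hβ
  set P := mildBound T β (coeffSum T D₂) (W12Norm D₂.v₀).toNNReal (CβNorm T β D₂.ψ).toNNReal with hP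
  set U := heatBound T β (CβNorm T β D₂.ψ).toNNReal with hU
  have hP' : ∀ t ∈ Icc 0 T, W12Norm (v₂ t) ≤ P := fun t ht => hv₂.w12Norm_le hT hβ hD₂ ht
  have hU' := ae_l2Norm_heatSol_le hT hβ (ENNReal.coe_toNNReal hD₂.ψ_holder.ne).symm.le hD₂.ψ_zero
  rw [← hU] at hU'
  obtain ⟨w₁, hw₁, hm₁⟩ := hv₁
  obtain ⟨w₂, hw₂, hm₂⟩ := hv₂
  have hw := hw₁.sub hw₂
  have mu₁ := aestronglyMeasurable_heatSol hT hβ0 hD₁.ψ_holder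
  have mu₂ := aestronglyMeasurable_heatSol hT hβ0 hD₂.ψ_holder
  have md₁ := aestronglyMeasurable_deriv_heatSol hT hβ0 hD₁.ψ_holder
  have md₂ := aestronglyMeasurable_deriv_heatSol hT hβ0 hD₂.ψ_holder
  have hu : ∀ᵐ τ ∂μt T,
      L2Norm (fun y => heatSol D₁.ψ τ y - heatSol D₂.ψ τ y) ≤ heatBound T β N ∧
      L2Norm (fun y => deriv (heatSol D₁.ψ τ) y - deriv (heatSol D₂.ψ τ) y)
        ≤ heatBound T β N := by
    filter_upwards [ae_l2Norm_heatSol_le hT hβ hN (by simp [hD₁.ψ_zero, hD₂.ψ_zero]),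
      self_mem_ae_restrict measurableSet_Icc] with τ h1 hτ
    have e := ae_μx_iff.2 (ae_of_all volume
      fun y (hy : 0 < y) => heatSol_sub hT hβ0 hD₁.ψ_holder hD₂.ψ_holder hτ hy)
    exact ⟨(eLpNorm_congr_ae (e.mono fun y hy => hy.1)).symm.trans_le h1.1,
      (eLpNorm_congr_ae (e.mono fun y hy => hy.2)).symm.trans_le h1.2⟩
  have hvu : ∀ᵐ τ ∂μt T, L2Norm (fun y => v₂ τ y + heatSol D₂.ψ τ y) ≤ P + U ∧
      L2Norm (fun y => w₂ τ y + deriv (heatSol D₂.ψ τ) y) ≤ P + U := by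
    filter_upwards [hw₂.ae_l2Norm_le, hU', self_mem_ae_restrict measurableSet_Icc,
      ae_aestronglyMeasurable_of_uncurry hw₂.1, ae_aestronglyMeasurable_of_uncurry hw₂.2,
      ae_aestronglyMeasurable_of_uncurry mu₂, ae_aestronglyMeasurable_of_uncurry md₂]
      with τ h1 h2 hτ m1 m2 m3 m4
    exact ⟨l2Norm_add_le m1 m3 (h1.1.trans (hP' τ hτ)) h2.1,
      l2Norm_add_le m2 m4 (h1.2.trans (hP' τ hτ)) h2.2⟩
  have s1 := hD₁.isSource hw.2 hw.1 hw.ae_l2Norm_le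
  have s2 := hD₁.isSource (f := fun τ y => deriv (heatSol D₁.ψ τ) y - deriv (heatSol D₂.ψ τ) y)
    (g := fun τ y => heatSol D₁.ψ τ y - heatSol D₂.ψ τ y) (md₁.sub md₂) (mu₁.sub mu₂) hu
  have s3 := IsSource.mul_of_l2Norm_le (f := fun t x => D₁.b t x - D₂.b t x)
    (g := fun τ y => w₂ τ y + deriv (heatSol D₂.ψ τ) y)
    (hD₁.b_measurable.sub hD₂.b_measurable) (hw₂.2.add md₂)
    (ae_l2Norm_le_of_linftyL2Norm_le le_rfl) (hvu.mono fun _ h => h.2)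
  have s4 := IsSource.mul_of_l2Norm_le (f := fun t x => D₁.γ t x - D₂.γ t x)
    (g := fun τ y => v₂ τ y + heatSol D₂.ψ τ y)
    (hD₁.γ_memLp.1.sub hD₂.γ_memLp.1) (hw₂.1.add mu₂)
    (ae_l2Norm_le_of_CL2Norm_le le_rfl) (hvu.mono fun _ h => h.1)
  set H : ℝ → ℝ → ℝ := fun τ y =>
    ((D₁.b τ y * w₁ τ y + D₁.γ τ y * v₁ τ y)
        + (D₁.b τ y * deriv (heatSol D₁.ψ τ) y + D₁.γ τ y * heatSol D₁.ψ τ y))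
      - ((D₂.b τ y * w₂ τ y + D₂.γ τ y * v₂ τ y)
        + (D₂.b τ y * deriv (heatSol D₂.ψ τ) y + D₂.γ τ y * heatSol D₂.ψ τ y)) with hH
  have sH : IsSource T H fun τ => coeffSum T D₁ * W12Norm (fun x => v₁ τ x - v₂ τ x)
      + ((coeffSum T D₁ * heatBound T β N + (P + U) * A : ℝ≥0) : ℝ≥0∞) := by
    have e : H = fun τ y => ((D₁.b τ y * (w₁ τ y - w₂ τ y) + D₁.γ τ y * (v₁ τ y - v₂ τ y))
        + (D₁.b τ y * (deriv (heatSol D₁.ψ τ) y - deriv (heatSol D₂.ψ τ) y)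
          + D₁.γ τ y * (heatSol D₁.ψ τ y - heatSol D₂.ψ τ y)))
        + ((D₁.b τ y - D₂.b τ y) * (w₂ τ y + deriv (heatSol D₂.ψ τ) y)
          + (D₁.γ τ y - D₂.γ τ y) * (v₂ τ y + heatSol D₂.ψ τ y)) := by
      funext τ y
      rw [hH]
      ring
    rw [e]
    refine ((s1.add s2).add (s3.add s4)).mono (ae_of_all _ fun τ => ?_)
    push_cast
    rw [add_assoc, ← add_mul, mul_comm (_ + _ : ℝ≥0∞) ((P : ℝ≥0∞) + U)]
    gcongr
  have fin {v w : ℝ → ℝ → ℝ} (h : MemLinftyW12 T v w) (c M : ℝ≥0) :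
      c * essSup (fun t => W12Norm (v t)) (μt T) + M < ⊤ :=
    ENNReal.add_lt_top.2 ⟨ENNReal.mul_lt_top ENNReal.coe_lt_top h.4, ENNReal.coe_lt_top⟩
  -- A bound constant in time is enough for additivity of the Duhamel integral, which uses only
  -- finiteness.
  have sH' : IsSource T H fun _ => coeffSum T D₁
      * essSup (fun τ => W12Norm (fun x => v₁ τ x - v₂ τ x)) (μt T)
      + ((coeffSum T D₁ * heatBound T β N + (P + U) * A : ℝ≥0) : ℝ≥0∞) := by
    refine sH.mono ?_
    filter_upwards [ENNReal.ae_le_essSup fun τ => W12Norm (fun x => v₁ τ x - v₂ τ x)] with τ hτ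
    gcongr
  have sF₂ : IsSource T (fun τ y => (D₂.b τ y * w₂ τ y + D₂.γ τ y * v₂ τ y)
      + (D₂.b τ y * deriv (heatSol D₂.ψ τ) y + D₂.γ τ y * heatSol D₂.ψ τ y))
      fun _ => coeffSum T D₂ * essSup (fun τ => W12Norm (v₂ τ)) (μt T)
        + ((coeffSum T D₂ * U : ℝ≥0) : ℝ≥0∞) := by
    refine ((hD₂.isSource hw₂.2 hw₂.1 hw₂.ae_l2Norm_le).add (hD₂.isSource md₂ mu₂ hU')).mono ?_
    filter_upwards [ENNReal.ae_le_essSup fun τ => W12Norm (v₂ τ)] with τ hτ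
    push_cast
    gcongr
  have hz : W12Bound (fun x => D₁.v₀ x - D₂.v₀ x) N₀ :=
    (W12Bound.of_w12Norm_lt_top (hN₀.trans_lt ENNReal.coe_lt_top)).mono hN₀
  refine (w12Norm_le_of_duhamel hT hz (hD₁.v₀_trace.sub hD₂.v₀_trace)
    (z := fun t x => v₁ t x - v₂ t x) (fun s hs => ?_) sH hw.4 ht).trans (le_of_eq (by push_cast; rfl))
  filter_upwards [hm₁ s hs, hm₂ s hs, hD₁.ae_mild_eq hT hβ hw₁ hs, hD₂.ae_mild_eq hT hβ hw₂ hs,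
    ae_duhamel_add hs (fin hw₂ _ _) sF₂ (fin hw _ _) sH'] with x h1 h2 h3 h4 h5
  -- Writing the first source as the second plus `H` lets additivity also serve as the subtraction
  -- rule for Duhamel integrals.
  have e : (fun τ y => ((D₂.b τ y * w₂ τ y + D₂.γ τ y * v₂ τ y)
      + (D₂.b τ y * deriv (heatSol D₂.ψ τ) y + D₂.γ τ y * heatSol D₂.ψ τ y)) + H τ y)
      = fun τ y => (D₁.b τ y * w₁ τ y + D₁.γ τ y * v₁ τ y)
        + (D₁.b τ y * deriv (heatSol D₁.ψ τ) y + D₁.γ τ y * heatSol D₁.ψ τ y) := by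
    funext τ y
    rw [hH]
    ring
  rw [e, h3, h4] at h5
  rw [dirichletConv_sub hs.1 (memLp_two_of_w12Norm_lt_top hD₁.v₀_norm)
    (memLp_two_of_w12Norm_lt_top hD₂.v₀_norm)]
  simp only [duhamel] at h5 ⊢
  linarith

end Solutions

/-! ### The bounding functions and the main theorem -/

theorem locallyBdd_of_continuous {X : Type*} [TopologicalSpace X] {ρ : X → ℝ≥0} (h : Continuous ρ) :
    LocallyBdd ρ := fun x =>
  ⟨{y | ρ y < ρ x + 1}, (h.tendsto x).eventually_lt_const (lt_add_one _), ρ x + 1,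
    fun _ hy => le_of_lt hy⟩

theorem continuous_growth (T : ℝ) : Continuous (growth T) := by
  unfold growth growthRate
  fun_prop

theorem continuous_mildBound (T : ℝ) (β : ℝ≥0) :
    Continuous fun p : ℝ≥0 × ℝ≥0 × ℝ≥0 => mildBound T β p.1 p.2.1 p.2.2 := by
  have := continuous_growth T
  unfold mildBound heatBound
  fun_prop

/-- Positivity of `ρ₁` ensures `ρ₁ * ⊤ = ⊤`, which settles the case of an infinite norm of the
difference of initial data. -/
theorem one_le_growth {T : ℝ} (hT : 0 < T) (B : ℝ≥0) : 1 ≤ growth T B := by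
  have h : (1 : ℝ≥0) ≤ (Real.exp (growthRate T B * T)).toNNReal := by
    rw [Real.one_le_toNNReal]
    refine Real.one_le_exp (mul_nonneg ?_ hT.le)
    unfold growthRate
    positivity
  calc (1 : ℝ≥0) ≤ 48 * 1 := by norm_num
    _ ≤ growth T B := by unfold growth; gcongr

theorem w12Norm_heatSol_sub_le {T : ℝ} (hT : 0 < T) {β : ℝ≥0} (hβ : 1 / 4 < β) {ψ₁ ψ₂ : ℝ → ℝ}
    (h₁ : CβNorm T β ψ₁ < ⊤) (h₂ : CβNorm T β ψ₂ < ⊤) (z₁ : ψ₁ 0 = 0) (z₂ : ψ₂ 0 = 0) {N : ℝ≥0}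
    (hN : CβNorm T β (fun t => ψ₁ t - ψ₂ t) ≤ N) {t : ℝ} (ht : t ∈ Icc 0 T) :
    W12Norm (fun x => heatSol ψ₁ t x - heatSol ψ₂ t x)
      ≤ (2 * (heatSolConst T β).toNNReal : ℝ≥0) * N := by
  have hβ0 : 0 < β := lt_trans (by norm_num) hβ
  have b := l2Norm_heatSol_le_of_CβNorm_le hT hβ hN (by simp [z₁, z₂]) ht
  have c : W12Bound (heatSol (fun s => ψ₁ s - ψ₂ s) t)
      (ENNReal.ofReal (heatSolConst T β) * N) :=
    ⟨_, hasWeakDeriv_deriv_heatSol hT hβ0 (hN.trans_lt ENNReal.coe_lt_top) ht, b⟩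
  have e : heatSol (fun s => ψ₁ s - ψ₂ s) t =ᵐ[μx] fun x => heatSol ψ₁ t x - heatSol ψ₂ t x :=
    ae_μx_iff.2 (ae_of_all volume fun y hy => (heatSol_sub hT hβ0 h₁ h₂ ht hy).1)
  refine (c.congr e).w12Norm_le.trans (le_of_eq ?_)
  rw [ENNReal.coe_mul, mul_assoc]
  rfl

end HalfLine

end

theorem mainTheorem10 (T : ℝ) (hT : 0 < T) (β : ℝ≥0) (hβ₁ : 1 / 4 < β) (hβ₂ : β < 1 / 2) :
    ∃ (C : ℝ≥0) (ρ₁ ρ₂ : (Fin 4 → ℝ≥0) → ℝ≥0) (ρ₃ : (Fin 4 → ℝ≥0) × (Fin 4 → ℝ≥0) → ℝ≥0),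
      Measurable ρ₁ ∧ HalfLine.LocallyBdd ρ₁ ∧
      Measurable ρ₂ ∧ HalfLine.LocallyBdd ρ₂ ∧
      Measurable ρ₃ ∧ HalfLine.LocallyBdd ρ₃ ∧
      ∀ D₁ D₂ : HalfLine.LinData, D₁.Admissible T β → D₂.Admissible T β →
        HalfLine.MemCL2 T D₁.γ → HalfLine.MemCL2 T D₂.γ →
        (⨆ t ∈ Icc 0 T,
            HalfLine.W12Norm (fun x => HalfLine.heatSol D₁.ψ t x - HalfLine.heatSol D₂.ψ t x))
          ≤ C * HalfLine.CβNorm T β (fun t => D₁.ψ t - D₂.ψ t) ∧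
        ∀ v₁ v₂ : ℝ → ℝ → ℝ,
          HalfLine.IsMildSolution T D₁ v₁ → HalfLine.IsMildSolution T D₂ v₂ →
          (⨆ t ∈ Icc 0 T, HalfLine.W12Norm (fun x => v₁ t x - v₂ t x))
            ≤ ρ₁ (HalfLine.coeffNorms T D₁ D₂)
                * HalfLine.W12Norm (fun x => D₁.v₀ x - D₂.v₀ x)
              + ρ₂ (HalfLine.coeffNorms T D₁ D₂)
                * HalfLine.CβNorm T β (fun t => D₁.ψ t - D₂.ψ t)
              + ρ₃ (HalfLine.dataNorms T β D₁ D₂, HalfLine.coeffNorms T D₁ D₂)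
                * (HalfLine.LinftyL2Norm T (fun t x => D₁.b t x - D₂.b t x)
                  + HalfLine.CL2Norm T (fun t x => D₁.γ t x - D₂.γ t x)) := by
  have hβ' : (1 / 4 : ℝ) < β := by exact_mod_cast hβ₁
  have cg := HalfLine.continuous_growth T
  -- Entries `0` and `2` of `coeffNorms` belong to `D₁`, entries `1` and `3` to `D₂`. The summand
  -- `1` in the second and third functions keeps them nonzero, since `0 * ⊤ = 0` in `ℝ≥0∞`.
  have c₁ : Continuous fun c : Fin 4 → ℝ≥0 => HalfLine.growth T (c 0 + c 2) := by fun_prop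
  have c₂ : Continuous fun c : Fin 4 → ℝ≥0 =>
      HalfLine.growth T (c 0 + c 2) * ((c 0 + c 2) * (HalfLine.heatSolConst T β).toNNReal) + 1 := by
    fun_prop
  have c₃ : Continuous fun p : (Fin 4 → ℝ≥0) × (Fin 4 → ℝ≥0) =>
      HalfLine.growth T (p.2 0 + p.2 2)
        * (HalfLine.mildBound T β (p.2 1 + p.2 3) (p.1 1) (p.1 3)
          + HalfLine.heatBound T β (p.1 3)) + 1 := by
    have cm := (HalfLine.continuous_mildBound T β).comp
      (f := fun p : (Fin 4 → ℝ≥0) × (Fin 4 → ℝ≥0) => (p.2 1 + p.2 3, p.1 1, p.1 3)) (by fun_prop)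
    simp only [Function.comp_def] at cm
    unfold HalfLine.heatBound
    fun_prop
  refine ⟨2 * (HalfLine.heatSolConst T β).toNNReal, _, _, _, c₁.measurable,
    HalfLine.locallyBdd_of_continuous c₁, c₂.measurable, HalfLine.locallyBdd_of_continuous c₂,
    c₃.measurable, HalfLine.locallyBdd_of_continuous c₃, fun D₁ D₂ hD₁ hD₂ _ _ => ⟨?_, ?_⟩⟩
  · by_cases hN : HalfLine.CβNorm T β (fun t => D₁.ψ t - D₂.ψ t) = ⊤
    · rw [hN, ENNReal.mul_top]
      · exact le_top
      · have := HalfLine.heatSolConst_pos hT hβ'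
        rw [ENNReal.coe_ne_zero]
        exact mul_ne_zero two_ne_zero (Real.toNNReal_pos.2 this).ne'
    · lift HalfLine.CβNorm T β (fun t => D₁.ψ t - D₂.ψ t) to ℝ≥0 using hN with N hN'
      exact iSup₂_le fun t ht => HalfLine.w12Norm_heatSol_sub_le hT hβ₁ hD₁.ψ_holder
        hD₂.ψ_holder hD₁.ψ_zero hD₂.ψ_zero hN'.symm.le ht
  · intro v₁ v₂ hv₁ hv₂
    have hg := HalfLine.one_le_growth hT
      (HalfLine.coeffNorms T D₁ D₂ 0 + HalfLine.coeffNorms T D₁ D₂ 2)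
    -- If some norm on the right is infinite, its positive coefficient makes the right side `⊤`.
    -- Otherwise all three norms are real numbers and the estimate for differences applies.
    by_cases hN₀ : HalfLine.W12Norm (fun x => D₁.v₀ x - D₂.v₀ x) = ⊤
    · rw [hN₀, ENNReal.mul_top (ENNReal.coe_ne_zero.2 (zero_lt_one.trans_le hg).ne')]
      simp
    by_cases hN : HalfLine.CβNorm T β (fun t => D₁.ψ t - D₂.ψ t) = ⊤
    · rw [hN, ENNReal.mul_top (by simp)]
      simp
    by_cases hA : HalfLine.LinftyL2Norm T (fun t x => D₁.b t x - D₂.b t x)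
        + HalfLine.CL2Norm T (fun t x => D₁.γ t x - D₂.γ t x) = ⊤
    · rw [hA, ENNReal.mul_top (by simp)]
      simp
    lift HalfLine.W12Norm (fun x => D₁.v₀ x - D₂.v₀ x) to ℝ≥0 using hN₀ with N₀ hN₀'
    lift HalfLine.CβNorm T β (fun t => D₁.ψ t - D₂.ψ t) to ℝ≥0 using hN with N hN'
    lift HalfLine.LinftyL2Norm T (fun t x => D₁.b t x - D₂.b t x)
        + HalfLine.CL2Norm T (fun t x => D₁.γ t x - D₂.γ t x) to ℝ≥0 using hA with A hA'
    refine iSup₂_le fun t ht => (HalfLine.IsMildSolution.w12Norm_sub_le hT hβ₁ hD₁ hD₂ hv₁ hv₂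
      hN₀'.symm.le hN'.symm.le hA'.symm.le ht).trans ?_
    have e₀ : HalfLine.coeffNorms T D₁ D₂ 0 + HalfLine.coeffNorms T D₁ D₂ 2
      = HalfLine.coeffSum T D₁ := rfl
    have e₁ : HalfLine.coeffNorms T D₁ D₂ 1 + HalfLine.coeffNorms T D₁ D₂ 3
      = HalfLine.coeffSum T D₂ := rfl
    have e₂ : HalfLine.dataNorms T β D₁ D₂ 1 = (HalfLine.W12Norm D₂.v₀).toNNReal := rfl
    have e₃ : HalfLine.dataNorms T β D₁ D₂ 3 = (HalfLine.CβNorm T β D₂.ψ).toNNReal := rfl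
    simp only [e₀, e₁, e₂, e₃]
    norm_cast
    calc _ = HalfLine.growth T (HalfLine.coeffSum T D₁) * N₀
          + HalfLine.growth T (HalfLine.coeffSum T D₁)
            * (HalfLine.coeffSum T D₁ * (HalfLine.heatSolConst T β).toNNReal) * N
          + HalfLine.growth T (HalfLine.coeffSum T D₁) * (HalfLine.mildBound T β
              (HalfLine.coeffSum T D₂) (HalfLine.W12Norm D₂.v₀).toNNReal
              (HalfLine.CβNorm T β D₂.ψ).toNNReal
            + HalfLine.heatBound T β (HalfLine.CβNorm T β D₂.ψ).toNNReal) * A := by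
          rw [HalfLine.heatBound]; ring
      _ ≤ _ := by gcongr <;> exact le_self_add
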